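/- Let $d\ge 1$ and let $\Omega\subset\mathbb{R}^d$ be a bounded open set with smooth boundary. Let $\mathcal{A}$ be the class of functions $\varphi:[0,\infty)\to[0,\infty)$ such that: $\varphi$ is continuous on $[0,\infty)$ except at finitely many points of $(0,\infty)$, where it has one-sided limits; $\varphi(0)=0$ and $\varphi(t)=\min\{\varphi(t+),\varphi(t-)\}$ for all $t>0$; there are constants $a,b>0$ with $\varphi(t)\le a t^2$ on $[0,1]$ and $\varphi(t)\le b$ on $[0,\infty)$; $\varphi$ is non-decreasing; and $\gamma_d\int_0^\infty \varphi(t)t^{-2}\,dt=1$, where $\gamma_d=\int_{\mathbb{S}^{d-1}}|\sigma\cdot e|\,d\sigma$ for some (equivalently, any) $e\in\mathbb{S}^{d-1}$. For a measurable $u:\Omega\to\mathbb{R}$ and $\delta>0$ set $$\Lambda_\delta(u)=\delta\int_\Omega\int_\Omega\frac{\varphi(|u(x)-u(y)|/\delta)}{|x-y|^{d+1}}\,dx\,dy\in[0,\infty].$$ (i) For every $\varphi\in\mathcal{A}$ and every $u\in\bigcup_{p>1}W^{1,p}(\Omega)$, $$\lim_{\delta\to0^+}\Lambda_\delta(u)=\int_\Omega|\nabla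 u|\,dx.$$ (ii) If moreover $\Omega$ is connected, then for every $p\in(1,\infty]$ there is a constant $C_p<\infty$, depending only on $\Omega$ and $p$, such that $$\Lambda_\delta(u)\le C_p\,\|\nabla u\|_{L^p(\Omega)}\qquad\text{for all }\varphi\in\mathcal{A},\ u\in W^{1,p}(\Omega),\ \delta>0.$$ -/

import Mathlib

open MeasureTheory Set Filter Topology
open scoped ENNReal NNReal ContDiff InnerProductSpace

noncomputable section

namespace NonlocalTV

/-- The Euclidean space `ℝ^d`. -/
abbrev E (d : ℕ) : Type := EuclideanSpace ℝ (Fin d)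

/-- The class `𝒜` (in dimension `d`). Only the values of `φ` on `[0, ∞)` matter. -/
structure MemClassA (d : ℕ) (φ : ℝ → ℝ) : Prop where
  /-- `φ` takes values in `[0, ∞)`. -/
  nonneg : ∀ t, 0 ≤ t → 0 ≤ φ t
  /-- `φ` is continuous on `[0, ∞)` except at finitely many points of `(0, ∞)`. -/
  continuous_off_finite : ∃ S : Set ℝ, S.Finite ∧ S ⊆ Ioi 0 ∧
    ∀ t ∈ Ici (0 : ℝ) \ S, ContinuousWithinAt φ (Ici 0) t
  map_zero : φ 0 = 0
  /-- At every `t > 0` the one-sided limits exist and `φ t = min {φ(t+), φ(t-)}`. -/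
  eq_min_limits : ∀ t, 0 < t → ∃ r l : ℝ,
    Tendsto φ (𝓝[>] t) (𝓝 r) ∧ Tendsto φ (𝓝[<] t) (𝓝 l) ∧ φ t = min r l
  le_sq : ∃ a : ℝ, 0 < a ∧ ∀ t ∈ Icc (0 : ℝ) 1, φ t ≤ a * t ^ 2
  bounded : ∃ b : ℝ, 0 < b ∧ ∀ t, 0 ≤ t → φ t ≤ b
  monotone : MonotoneOn φ (Ici 0)
  /-- `γ_d ∫_0^∞ φ(t) t⁻² dt = 1`, where `γ_d = ∫_{S^{d-1}} |σ · e| dσ` for some unit vector `e`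
  (`volume.toSphere` is the surface measure of the unit sphere). -/
  normalized : ∃ e : E d, ‖e‖ = 1 ∧
    (∫ σ : Metric.sphere (0 : E d) 1, |⟪(σ : E d), e⟫_ℝ| ∂((volume : Measure (E d)).toSphere)) *
      (∫ t in Ioi (0 : ℝ), φ t / t ^ 2) = 1

/-- `Λ(u) = ∫_Ω ∫_Ω φ(|u(x) - u(y)|) / |x - y|^(d+1) dx dy`, with values in `[0, ∞]`. -/
def Lam {d : ℕ} (φ : ℝ → ℝ) (Ω : Set (E d)) (u : E d → ℝ) : ℝ≥0∞ :=
  ∫⁻ x in Ω, ∫⁻ y in Ω, ENNReal.ofReal (φ |u x - u y| / ‖x - y‖ ^ (d + 1))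

/-- `Λ_δ(u) = δ Λ(u / δ)`. -/
def LamScaled {d : ℕ} (φ : ℝ → ℝ) (Ω : Set (E d)) (δ : ℝ) (u : E d → ℝ) : ℝ≥0∞ :=
  ENNReal.ofReal δ * Lam φ Ω (fun x => u x / δ)

/-- `g` is the weak gradient of `u` in the open set `Ω`: both are locally integrable in `Ω`, and
`∫_Ω u ∂_v ψ = - ∫_Ω (g · v) ψ` for all test functions `ψ ∈ C_c^∞(Ω)` and all directions `v`. -/
structure HasWeakGradient {d : ℕ} (Ω : Set (E d)) (u : E d → ℝ) (g : E d → E d) : Prop where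
  locallyIntegrableOn : LocallyIntegrableOn u Ω
  locallyIntegrableOn_gradient : LocallyIntegrableOn g Ω
  integral_eq : ∀ ψ : E d → ℝ, ContDiff ℝ ∞ ψ → HasCompactSupport ψ → tsupport ψ ⊆ Ω →
    ∀ v : E d, ∫ x in Ω, u x * fderiv ℝ ψ x v = - ∫ x in Ω, ⟪g x, v⟫_ℝ * ψ x

/-- `u ∈ W^{1,p}(Ω)`: `u ∈ L^p(Ω)`, and `u` has a weak gradient that lies in `L^p(Ω)`. -/
def MemW1p {d : ℕ} (Ω : Set (E d)) (p : ℝ≥0∞) (u : E d → ℝ) : Prop :=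
  MemLp u p (volume.restrict Ω) ∧
    ∃ g : E d → E d, HasWeakGradient Ω u g ∧ MemLp g p (volume.restrict Ω)

/-- The open set `Ω` has a smooth boundary: near every boundary point, and in suitable orthonormal
coordinates (with `e` the last axis), `Ω` is the part of a ball strictly above the graph of a
smooth function of the other coordinates. Here `x - ⟪x, e⟫ e` is the orthogonal projection of `x`
to the hyperplane `e^⊥`, so that only the values of `h` on `e^⊥` matter. -/
def HasSmoothBoundary {d : ℕ} (Ω : Set (E d)) : Prop :=
  ∀ x₀ ∈ frontier Ω, ∃ (r : ℝ) (e : E d) (h : E d → ℝ), 0 < r ∧ ‖e‖ = 1 ∧ ContDiff ℝ ∞ h ∧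
    Ω ∩ Metric.ball x₀ r = {x ∈ Metric.ball x₀ r | h (x - ⟪x, e⟫_ℝ • e) < ⟪x, e⟫_ℝ}

end NonlocalTV

end

open MeasureTheory Set Filter Topology
open scoped ENNReal NNReal ContDiff InnerProductSpace

noncomputable section

namespace NonlocalTV

/-- The kernel `|z|^{-(d+1)}`, with value `0` at the origin. -/
def kern (d : ℕ) (z : E d) : ℝ≥0∞ := ENNReal.ofReal ((‖z‖ ^ (d + 1))⁻¹)

lemma measurable_kern (d : ℕ) : Measurable (kern d) := by unfold kern; fun_prop

lemma kern_neg (d : ℕ) (z : E d) : kern d (-z) = kern d z := by simp [kern]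

lemma kern_sub_comm {d : ℕ} (x y : E d) : kern d (x - y) = kern d (y - x) := by
  rw [← kern_neg, neg_sub]

lemma kern_ne_top (d : ℕ) (z : E d) : kern d z ≠ ⊤ := ENNReal.ofReal_ne_top

lemma lintegral_polar {d : ℕ} (hd : 1 ≤ d) {F : E d → ℝ≥0∞} (hF : Measurable F) :
    ∫⁻ z, F z = ∫⁻ σ : Metric.sphere (0 : E d) 1, (∫⁻ t in Ioi (0 : ℝ),
      ENNReal.ofReal (t ^ (d - 1)) * F (t • (σ : E d))) ∂(volume : Measure (E d)).toSphere := by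
  have hfin : Module.finrank ℝ (E d) = d := finrank_euclideanSpace_fin
  have : Nonempty (Fin d) := ⟨⟨0, hd⟩⟩
  have hmp := (volume : Measure (E d)).measurePreserving_homeomorphUnitSphereProd
  rw [hfin] at hmp
  have h1 : ∫⁻ z, F z = ∫⁻ z : ({0}ᶜ : Set (E d)), F z ∂(volume.comap Subtype.val) := by
    rw [lintegral_subtype_comap (measurableSet_singleton _).compl, restrict_compl_singleton]
  have h2 : ∫⁻ z : ({0}ᶜ : Set (E d)), F z ∂(volume.comap Subtype.val) =
      ∫⁻ q, F ((q.2 : ℝ) • (q.1 : E d))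
        ∂((volume : Measure (E d)).toSphere.prod (Measure.volumeIoiPow (d - 1))) := by
    have hm : Measurable fun q : Metric.sphere (0 : E d) 1 × Ioi (0 : ℝ) =>
        F ((q.2 : ℝ) • (q.1 : E d)) := hF.comp (by fun_prop)
    rw [← hmp.lintegral_comp hm]
    refine lintegral_congr fun z => ?_
    congr 1
    have := (homeomorphUnitSphereProd (E d)).symm_apply_apply z
    conv_lhs => rw [← this]
    rfl
  rw [h1, h2, lintegral_prod _ (by fun_prop)]
  refine lintegral_congr fun σ => ?_
  rw [Measure.volumeIoiPow, lintegral_withDensity_eq_lintegral_mul _ (by fun_prop)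
    (by fun_prop)]
  simp only [Pi.mul_apply]
  exact lintegral_subtype_comap measurableSet_Ioi
    (fun t : ℝ => ENNReal.ofReal (t ^ (d - 1)) * F (t • (σ : E d)))

/-- The one-dimensional integral `∫₀^∞ f(t) t⁻² dt`. -/
def invSqIntegral (f : ℝ → ℝ≥0∞) : ℝ≥0∞ := ∫⁻ t in Ioi (0 : ℝ), f t * ENNReal.ofReal ((t ^ 2)⁻¹)

lemma invSqIntegral_comp_mul {f : ℝ → ℝ≥0∞} (hf : Measurable f) {m : ℝ} (hm : 0 < m) :
    ∫⁻ t in Ioi (0 : ℝ), f (t * m) * ENNReal.ofReal ((t ^ 2)⁻¹) =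
      ENNReal.ofReal m * invSqIntegral f := by
  have hmap := Real.smul_map_volume_mul_right hm.ne'
  unfold invSqIntegral
  set G : ℝ → ℝ≥0∞ := fun s => (Ioi (0 : ℝ)).indicator
    (fun s => f s * (ENNReal.ofReal (m ^ 2) * ENNReal.ofReal ((s ^ 2)⁻¹))) s with hG
  have hGm : Measurable G := by
    apply Measurable.indicator _ measurableSet_Ioi
    fun_prop
  have hL : ∫⁻ t in Ioi (0 : ℝ), f (t * m) * ENNReal.ofReal ((t ^ 2)⁻¹) =
      ∫⁻ t, G (t * m) := by
    rw [← lintegral_indicator measurableSet_Ioi]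
    refine lintegral_congr fun t => ?_
    by_cases ht : 0 < t
    · have htm : 0 < t * m := by positivity
      simp only [hG, indicator, mem_Ioi, ht, htm, if_true]
      rw [← ENNReal.ofReal_mul (by positivity)]
      congr 2
      field_simp
    · have htm : ¬ 0 < t * m := fun h => ht (pos_of_mul_pos_left h hm.le)
      simp [hG, indicator, mem_Ioi, ht, htm]
  have hR : ∫⁻ t, G (t * m) = ∫⁻ s, G s ∂(Measure.map (fun x : ℝ => x * m) volume) := by
    rw [lintegral_map hGm (by fun_prop)]
  have hvol : Measure.map (fun x : ℝ => x * m) volume = ENNReal.ofReal m⁻¹ • (volume : Measure ℝ) := by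
    rw [Real.map_volume_mul_right hm.ne', abs_of_pos (inv_pos.2 hm)]
  rw [hL, hR, hvol, lintegral_smul_measure, hG]
  rw [lintegral_indicator measurableSet_Ioi, smul_eq_mul]
  have : ∀ s, f s * (ENNReal.ofReal (m ^ 2) * ENNReal.ofReal ((s ^ 2)⁻¹)) =
      ENNReal.ofReal (m ^ 2) * (f s * ENNReal.ofReal ((s ^ 2)⁻¹)) := fun s => by ring
  simp_rw [this]
  rw [lintegral_const_mul _ (by fun_prop), ← mul_assoc, ← ENNReal.ofReal_mul (by positivity)]
  congr 2
  field_simp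

/-- Polar coordinates for `f ∘ q` against the kernel, when `q` is positively homogeneous. -/
lemma lintegral_homogeneous_mul_kern {d : ℕ} (hd : 1 ≤ d) {f : ℝ → ℝ≥0∞} (hf : Measurable f)
    (hf0 : f 0 = 0) {q : E d → ℝ} (hq : Measurable q) (hq0 : ∀ z, 0 ≤ q z)
    (hqh : ∀ t : ℝ, 0 < t → ∀ z, q (t • z) = t * q z) :
    ∫⁻ z, f (q z) * kern d z =
      (∫⁻ σ : Metric.sphere (0 : E d) 1, ENNReal.ofReal (q σ)
        ∂(volume : Measure (E d)).toSphere) * invSqIntegral f := by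
  have hk := measurable_kern d
  rw [lintegral_polar hd (by fun_prop : Measurable fun z => f (q z) * kern d z),
    ← lintegral_mul_const _ (by fun_prop)]
  refine lintegral_congr fun σ => ?_
  have hσ : ‖(σ : E d)‖ = 1 := by simp
  have h1 : ∫⁻ t in Ioi (0 : ℝ), ENNReal.ofReal (t ^ (d - 1)) *
      (f (q (t • (σ : E d))) * kern d (t • (σ : E d))) =
      ∫⁻ t in Ioi (0 : ℝ), f (t * q σ) * ENNReal.ofReal ((t ^ 2)⁻¹) := by
    refine setLIntegral_congr_fun measurableSet_Ioi fun t (ht : 0 < t) => ?_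
    simp only [kern, hqh t ht, norm_smul, hσ, mul_one, Real.norm_eq_abs,
      abs_of_pos ht]
    rw [mul_left_comm, ← ENNReal.ofReal_mul (by positivity)]
    congr 2
    obtain ⟨k, rfl⟩ : ∃ k, d = k + 1 := ⟨d - 1, by omega⟩
    simp only [Nat.add_sub_cancel]
    field_simp
    ring
  rw [h1]
  rcases (hq0 σ).eq_or_lt with h | h
  · simp [← h, hf0]
  · exact invSqIntegral_comp_mul hf h

/-- `∫_{S^{d-1}} |σ · a| dσ`. -/
def sphereInner {d : ℕ} (a : E d) : ℝ≥0∞ :=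
  ∫⁻ σ : Metric.sphere (0 : E d) 1, ENNReal.ofReal |⟪(σ : E d), a⟫_ℝ|
    ∂(volume : Measure (E d)).toSphere

/-- The surface measure of the unit sphere. -/
def sphereArea (d : ℕ) : ℝ≥0∞ := (volume : Measure (E d)).toSphere univ

lemma sphereArea_ne_top (d : ℕ) : sphereArea d ≠ ⊤ := measure_ne_top _ _

lemma lintegral_abs_inner_mul_kern {d : ℕ} (hd : 1 ≤ d) {f : ℝ → ℝ≥0∞} (hf : Measurable f)
    (hf0 : f 0 = 0) (a : E d) :
    ∫⁻ z, f |⟪z, a⟫_ℝ| * kern d z = sphereInner a * invSqIntegral f :=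
  lintegral_homogeneous_mul_kern hd hf hf0 (q := fun z => |⟪z, a⟫_ℝ|) (by fun_prop)
    (fun _ => abs_nonneg _) fun t ht z => by
      rw [real_inner_smul_left, abs_mul, abs_of_pos ht]

lemma lintegral_norm_mul_kern {d : ℕ} (hd : 1 ≤ d) {f : ℝ → ℝ≥0∞} (hf : Measurable f)
    (hf0 : f 0 = 0) {m : ℝ} (hm : 0 ≤ m) :
    ∫⁻ z, f (m * ‖z‖) * kern d z = ENNReal.ofReal m * sphereArea d * invSqIntegral f := by
  rw [lintegral_homogeneous_mul_kern hd hf hf0 (q := fun z => m * ‖z‖) (by fun_prop)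
    (fun _ => by positivity) fun t ht z => by
      rw [norm_smul, Real.norm_eq_abs, abs_of_pos ht]; ring]
  congr 1
  have : ∀ σ : Metric.sphere (0 : E d) 1, ENNReal.ofReal (m * ‖(σ : E d)‖) = ENNReal.ofReal m := by
    intro σ; simp
  simp_rw [this]
  rw [lintegral_const, sphereArea]

lemma invSqIntegral_indicator_Ioi_one :
    invSqIntegral ((Ioi (1 : ℝ)).indicator fun _ => 1) = 1 := by
  unfold invSqIntegral
  have h1 : ∀ t : ℝ, (Ioi (1 : ℝ)).indicator (fun _ => (1 : ℝ≥0∞)) t * ENNReal.ofReal ((t ^ 2)⁻¹) =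
      (Ioi (1 : ℝ)).indicator (fun t => ENNReal.ofReal ((t ^ 2)⁻¹)) t := by
    intro t; by_cases h : t ∈ Ioi (1 : ℝ) <;> simp [h]
  simp_rw [h1]
  rw [lintegral_indicator measurableSet_Ioi, Measure.restrict_restrict measurableSet_Ioi,
    inter_eq_left.2 (Ioi_subset_Ioi zero_le_one)]
  have h2 : ∀ t ∈ Ioi (1 : ℝ), ENNReal.ofReal ((t ^ 2)⁻¹) = ENNReal.ofReal (t ^ (-2 : ℝ)) := by
    intro t ht
    have : (0 : ℝ) < t := zero_lt_one.trans ht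
    rw [Real.rpow_neg this.le]; norm_cast
  rw [setLIntegral_congr_fun measurableSet_Ioi h2, ← ofReal_integral_eq_lintegral_ofReal
    (integrableOn_Ioi_rpow_of_lt (by norm_num) zero_lt_one)
    ((ae_restrict_mem measurableSet_Ioi).mono fun t ht =>
      Real.rpow_nonneg (zero_le_one.trans (le_of_lt ht)) _),
    integral_Ioi_rpow_of_lt (by norm_num) zero_lt_one]
  norm_num

lemma sphereInner_map {d : ℕ} (hd : 1 ≤ d) (R : E d ≃ₗᵢ[ℝ] E d) (a : E d) :
    sphereInner (R a) = sphereInner a := by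
  have hf : Measurable ((Ioi (1 : ℝ)).indicator fun _ => (1 : ℝ≥0∞)) :=
    measurable_const.indicator measurableSet_Ioi
  have hf0 : (Ioi (1 : ℝ)).indicator (fun _ => (1 : ℝ≥0∞)) 0 = 0 := by simp
  have h1 := lintegral_abs_inner_mul_kern hd hf hf0 a
  have h2 := lintegral_abs_inner_mul_kern hd hf hf0 (R a)
  rw [invSqIntegral_indicator_Ioi_one, mul_one] at h1 h2
  have hk := measurable_kern d
  rw [← h1, ← h2, ← R.measurePreserving.lintegral_comp
    (f := fun z => (Ioi (1 : ℝ)).indicator (fun _ => (1 : ℝ≥0∞)) |⟪z, R a⟫_ℝ| * kern d z)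
    (by fun_prop)]
  refine lintegral_congr fun z => ?_
  simp [kern]

lemma sphereInner_smul {d : ℕ} {s : ℝ} (hs : 0 ≤ s) (a : E d) :
    sphereInner (s • a) = ENNReal.ofReal s * sphereInner a := by
  unfold sphereInner
  rw [← lintegral_const_mul _ (by fun_prop)]
  refine lintegral_congr fun σ => ?_
  rw [real_inner_smul_right, abs_mul, abs_of_nonneg hs, ENNReal.ofReal_mul hs]

lemma sphereInner_eq {d : ℕ} (hd : 1 ≤ d) {e : E d} (he : ‖e‖ = 1) (a : E d) :
    sphereInner a = ‖a‖ₑ * sphereInner e := by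
  by_cases ha : a = 0
  · subst ha; simp [sphereInner]
  have ha' : 0 < ‖a‖ := norm_pos_iff.2 ha
  have h1 : a = ‖a‖ • (‖a‖⁻¹ • a) := by rw [smul_smul, mul_inv_cancel₀ ha'.ne', one_smul]
  have h2 : ‖‖a‖⁻¹ • a‖ = ‖e‖ := by rw [norm_smul, norm_inv, norm_norm, he]; field_simp
  rw [h1, sphereInner_smul ha'.le, ← sphereInner_map hd _ (‖a‖⁻¹ • a), Submodule.reflection_sub h2,
    ← h1, ofReal_norm]

/-- The even `ℝ≥0∞`-valued function `t ↦ φ(|t|)`. -/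
def prof (φ : ℝ → ℝ) (t : ℝ) : ℝ≥0∞ := ENNReal.ofReal (φ |t|)

lemma prof_abs (φ : ℝ → ℝ) (t : ℝ) : prof φ |t| = prof φ t := by simp [prof]

lemma prof_le_prof {d : ℕ} {φ : ℝ → ℝ} (h : MemClassA d φ) {s t : ℝ} (hst : |s| ≤ |t|) :
    prof φ s ≤ prof φ t :=
  ENNReal.ofReal_le_ofReal (h.monotone (abs_nonneg s) (abs_nonneg t) hst)

lemma prof_zero {d : ℕ} {φ : ℝ → ℝ} (h : MemClassA d φ) : prof φ 0 = 0 := by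
  simp [prof, h.map_zero]

lemma measurable_prof {d : ℕ} {φ : ℝ → ℝ} (h : MemClassA d φ) : Measurable (prof φ) := by
  have hm : Monotone fun t : ℝ => φ (max t 0) := fun s t hst =>
    h.monotone (mem_Ici.2 (le_max_right _ _)) (mem_Ici.2 (le_max_right _ _))
      (max_le_max_right _ hst)
  have : prof φ = fun t => ENNReal.ofReal ((fun t : ℝ => φ (max t 0)) |t|) := by
    ext t; simp [prof]
  rw [this]
  exact (hm.measurable.comp (by fun_prop)).ennreal_ofReal

lemma prof_add_le {d : ℕ} {φ : ℝ → ℝ} (h : MemClassA d φ) {ε : ℝ} (h0 : 0 < ε) (h1 : ε < 1)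
    (a b : ℝ) : prof φ (a + b) ≤ prof φ (a / (1 - ε)) + prof φ (b / ε) := by
  have h1' : 0 < 1 - ε := by linarith
  rcases le_total |a + b| |a / (1 - ε)| with hc | hc
  · exact (prof_le_prof h hc).trans le_self_add
  · refine (prof_le_prof h ?_).trans le_add_self
    rw [abs_div, abs_of_pos h1', div_le_iff₀ h1'] at hc
    rw [abs_div, abs_of_pos h0, le_div_iff₀ h0]
    nlinarith [abs_add_le a b]

lemma prof_add_le' {d : ℕ} {φ : ℝ → ℝ} (h : MemClassA d φ) (a b : ℝ) :
    prof φ (a + b) ≤ prof φ (2 * a) + prof φ (2 * b) := by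
  have := prof_add_le h (ε := 1 / 2) (by norm_num) (by norm_num) a b
  convert this using 3 <;> ring

lemma exists_sphereInner_mul_invSqIntegral {d : ℕ} {φ : ℝ → ℝ} (h : MemClassA d φ) :
    ∃ e : E d, ‖e‖ = 1 ∧ sphereInner e * invSqIntegral (prof φ) = 1 := by
  obtain ⟨e, he, h1⟩ := h.normalized
  refine ⟨e, he, ?_⟩
  have hS : 0 ≤ ∫ σ : Metric.sphere (0 : E d) 1, |⟪(σ : E d), e⟫_ℝ|
      ∂((volume : Measure (E d)).toSphere) := integral_nonneg fun _ => abs_nonneg _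
  have hSi : Integrable (fun σ : Metric.sphere (0 : E d) 1 => |⟪(σ : E d), e⟫_ℝ|)
      ((volume : Measure (E d)).toSphere) := by
    by_contra hc
    rw [integral_undef hc, zero_mul] at h1
    exact zero_ne_one h1
  have hIi : IntegrableOn (fun t => φ t / t ^ 2) (Ioi (0 : ℝ)) := by
    by_contra hc
    rw [integral_undef hc, mul_zero] at h1
    exact zero_ne_one h1
  have h2 := congrArg ENNReal.ofReal h1
  rw [ENNReal.ofReal_mul hS, ENNReal.ofReal_one, ofReal_integral_eq_lintegral_ofReal hSi
    (Eventually.of_forall fun _ => abs_nonneg _), ofReal_integral_eq_lintegral_ofReal hIi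
    ((ae_restrict_mem measurableSet_Ioi).mono fun t ht =>
      div_nonneg (h.nonneg t (le_of_lt ht)) (sq_nonneg t))] at h2
  rw [← h2, sphereInner, invSqIntegral]
  congr 1
  refine setLIntegral_congr_fun measurableSet_Ioi fun t (ht : 0 < t) => ?_
  simp only [prof, abs_of_pos ht]
  rw [← ENNReal.ofReal_mul (h.nonneg t ht.le), div_eq_mul_inv]

lemma lintegral_prof_inner_mul_kern {d : ℕ} (hd : 1 ≤ d) {φ : ℝ → ℝ} (h : MemClassA d φ)
    (a : E d) : ∫⁻ z, prof φ ⟪z, a⟫_ℝ * kern d z = ‖a‖ₑ := by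
  obtain ⟨e, he, h1⟩ := exists_sphereInner_mul_invSqIntegral h
  simp_rw [← prof_abs φ ⟪_, a⟫_ℝ]
  rw [lintegral_abs_inner_mul_kern hd (measurable_prof h) (prof_zero h), sphereInner_eq hd he,
    mul_assoc, h1, mul_one]

/-- The common value of `∫₀^∞ φ(t) t⁻² dt` for all `φ` in the class `𝒜`. -/
lemma exists_invSqIntegral_eq {d : ℕ} (hd : 1 ≤ d) :
    ∃ κ : ℝ≥0, ∀ φ : ℝ → ℝ, MemClassA d φ → invSqIntegral (prof φ) = κ := by
  by_cases hex : ∃ φ, MemClassA d φ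
  swap
  · exact ⟨0, fun φ h => (hex ⟨φ, h⟩).elim⟩
  obtain ⟨φ₀, h₀⟩ := hex
  have key : ∀ φ ψ, MemClassA d φ → MemClassA d ψ →
      invSqIntegral (prof φ) = invSqIntegral (prof ψ) := by
    intro φ ψ h h'
    obtain ⟨e, he, h1⟩ := exists_sphereInner_mul_invSqIntegral h
    obtain ⟨e', he', h1'⟩ := exists_sphereInner_mul_invSqIntegral h'
    rw [sphereInner_eq hd he e', ← ofReal_norm, he', ENNReal.ofReal_one, one_mul, mul_comm] at h1'
    rw [mul_comm] at h1
    rw [ENNReal.eq_inv_of_mul_eq_one_left h1, ENNReal.eq_inv_of_mul_eq_one_left h1']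
  refine ⟨(invSqIntegral (prof φ₀)).toNNReal, fun φ h => ?_⟩
  rw [ENNReal.coe_toNNReal, key φ φ₀ h h₀]
  obtain ⟨e, he, h1⟩ := exists_sphereInner_mul_invSqIntegral h₀
  intro htop
  rw [htop] at h1
  by_cases h0 : sphereInner e = 0
  · simp [h0] at h1
  · simp [ENNReal.mul_top h0] at h1

lemma ofReal_prof_le {d : ℕ} {φ : ℝ → ℝ} (h : MemClassA d φ) (t : ℝ) :
    prof φ t ≤ ENNReal.ofReal |t| * invSqIntegral (prof φ) := by
  rcases eq_or_ne t 0 with rfl | ht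
  · simp [prof_zero h]
  have ht' : 0 < |t| := abs_pos.2 ht
  rw [← invSqIntegral_comp_mul (measurable_prof h) ht']
  calc prof φ t = prof φ t * invSqIntegral ((Ioi (1 : ℝ)).indicator fun _ => 1) := by
        rw [invSqIntegral_indicator_Ioi_one, mul_one]
    _ ≤ _ := by
        unfold invSqIntegral
        rw [← lintegral_const_mul]
        · refine setLIntegral_mono_ae' measurableSet_Ioi (Eventually.of_forall fun s (hs : 0 < s) => ?_)
          by_cases h1 : 1 < s
          · simp only [indicator, mem_Ioi, h1, if_true, one_mul]
            gcongr
            refine prof_le_prof h ?_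
            rw [abs_mul, abs_abs, abs_of_pos hs]
            nlinarith
          · simp [indicator, h1]
        · exact (measurable_const.indicator measurableSet_Ioi).mul (by fun_prop)

lemma exists_prof_le {d : ℕ} {φ : ℝ → ℝ} (h : MemClassA d φ) : ∃ b : ℝ≥0, ∀ t, prof φ t ≤ b := by
  obtain ⟨b, hb, hφ⟩ := h.bounded
  exact ⟨b.toNNReal, fun t => ENNReal.ofReal_le_ofReal (hφ _ (abs_nonneg t))⟩

lemma ae_continuousAt_prof_inner {d : ℕ} {φ : ℝ → ℝ} (h : MemClassA d φ) (a : E d) :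
    ∀ᵐ z : E d, ContinuousAt (prof φ) ⟪z, a⟫_ℝ := by
  obtain ⟨S, hS, hS0, hc⟩ := h.continuous_off_finite
  have hcont : ∀ t : ℝ, |t| ∉ S → ContinuousAt (prof φ) t := by
    intro t ht
    refine (ENNReal.continuous_ofReal.tendsto _).comp ?_
    refine (hc |t| ⟨abs_nonneg t, ht⟩).tendsto.comp ?_
    exact tendsto_nhdsWithin_iff.2 ⟨continuous_abs.tendsto t,
      Eventually.of_forall fun s => abs_nonneg s⟩
  rcases eq_or_ne a 0 with rfl | ha
  · refine Eventually.of_forall fun z => hcont _ ?_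
    simpa using fun h0 => lt_irrefl (0 : ℝ) (hS0 h0)
  have hnull : ∀ s : ℝ, volume {z : E d | ⟪z, a⟫_ℝ = s} = 0 := by
    intro s
    have hsub : {z : E d | ⟪z, a⟫_ℝ = s} =
        (fun z => z + -((s / ‖a‖ ^ 2) • a)) ⁻¹' ((ℝ ∙ a)ᗮ : Submodule ℝ (E d)) := by
      ext z
      have : ‖a‖ ≠ 0 := norm_ne_zero_iff.2 ha
      simp only [mem_ofPred_eq, mem_preimage, SetLike.mem_coe,
        Submodule.mem_orthogonal_singleton_iff_inner_left, inner_add_left, inner_neg_left,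
        real_inner_smul_left, real_inner_self_eq_norm_sq]
      rw [div_mul_cancel₀ _ (by positivity), ← sub_eq_add_neg, sub_eq_zero]
    rw [hsub, measure_preimage_add_right]
    refine Measure.addHaar_submodule _ _ fun htop => ha ?_
    have : a ∈ (ℝ ∙ a)ᗮ := htop ▸ Submodule.mem_top
    rwa [Submodule.mem_orthogonal_singleton_iff_inner_left, inner_self_eq_zero] at this
  have h1 : ∀ s ∈ S, ∀ᵐ z : E d, |⟪z, a⟫_ℝ| ≠ s := by
    intro s _
    have h2 : ∀ᵐ z : E d, ⟪z, a⟫_ℝ ≠ s := by rw [ae_iff]; simpa using hnull s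
    have h3 : ∀ᵐ z : E d, ⟪z, a⟫_ℝ ≠ -s := by rw [ae_iff]; simpa using hnull (-s)
    filter_upwards [h2, h3] with z hz hz' h4
    rcases eq_or_eq_neg_of_abs_eq h4 with h5 | h5
    · exact hz h5
    · exact hz' h5
  filter_upwards [(ae_ball_iff hS.countable).2 h1] with z hz
  exact hcont _ fun hmem => hz _ hmem rfl

/-- The centred maximal function over balls of dyadic radii. -/
def maxFun {d : ℕ} (f : E d → ℝ≥0∞) (x : E d) : ℝ≥0∞ :=
  ⨆ k : ℤ, (volume (Metric.ball (0 : E d) (2 ^ k)))⁻¹ * ∫⁻ y in Metric.ball x (2 ^ k), f y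

lemma measurable_setLIntegral_ball {d : ℕ} {f : E d → ℝ≥0∞} (hf : Measurable f) (r : ℝ) :
    Measurable fun x : E d => ∫⁻ y in Metric.ball x r, f y := by
  have h1 : ∀ x : E d, ∫⁻ y in Metric.ball x r, f y =
      ∫⁻ y, {q : E d × E d | dist q.2 q.1 < r}.indicator (fun q => f q.2) (x, y) := by
    intro x
    rw [← lintegral_indicator measurableSet_ball]
    rfl
  simp_rw [h1]
  refine Measurable.lintegral_prod_right' (f := {q : E d × E d | dist q.2 q.1 < r}.indicator
    (fun q => f q.2)) ?_
  exact (hf.comp measurable_snd).indicator (measurableSet_lt (by fun_prop) measurable_const)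

lemma measurable_maxFun {d : ℕ} {f : E d → ℝ≥0∞} (hf : Measurable f) : Measurable (maxFun f) :=
  Measurable.iSup fun _ => (measurable_setLIntegral_ball hf _).const_mul _

lemma volume_ball_pos {d : ℕ} (x : E d) {s : ℝ} (hs : 0 < s) : volume (Metric.ball x s) ≠ 0 :=
  (Metric.measure_ball_pos _ _ hs).ne'

lemma volume_ball_ne_top {d : ℕ} (x : E d) (s : ℝ) : volume (Metric.ball x s) ≠ ⊤ :=
  measure_ball_lt_top.ne

lemma volume_ball_eq {d : ℕ} (x : E d) {s : ℝ} (hs : 0 < s) :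
    volume (Metric.ball x s) = ENNReal.ofReal (s ^ d) * volume (Metric.ball (0 : E d) 1) := by
  rw [Measure.addHaar_ball_of_pos _ _ hs, finrank_euclideanSpace_fin]

lemma volume_ball_mul {d : ℕ} (x y : E d) {a s : ℝ} (ha : 0 < a) (hs : 0 < s) :
    volume (Metric.ball x (a * s)) = ENNReal.ofReal (a ^ d) * volume (Metric.ball y s) := by
  rw [volume_ball_eq x (mul_pos ha hs), volume_ball_eq y hs, mul_pow,
    ENNReal.ofReal_mul (by positivity), mul_assoc]

lemma setLIntegral_ball_two_zpow_le {d : ℕ} (f : E d → ℝ≥0∞) (x : E d) (k : ℤ) :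
    ∫⁻ y in Metric.ball x (2 ^ k), f y ≤ volume (Metric.ball (0 : E d) (2 ^ k)) * maxFun f x := by
  have h := le_iSup (fun k : ℤ => (volume (Metric.ball (0 : E d) (2 ^ k)))⁻¹ *
    ∫⁻ y in Metric.ball x (2 ^ k), f y) k
  calc _ = volume (Metric.ball (0 : E d) (2 ^ k)) * ((volume (Metric.ball (0 : E d) (2 ^ k)))⁻¹ *
      ∫⁻ y in Metric.ball x (2 ^ k), f y) := by
        rw [← mul_assoc, ENNReal.mul_inv_cancel (volume_ball_pos _ (by positivity))
          (volume_ball_ne_top _ _), one_mul]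
    _ ≤ _ := by gcongr; exact h

lemma setLIntegral_ball_le {d : ℕ} (f : E d → ℝ≥0∞) (x : E d) {s : ℝ} (hs : 0 < s) :
    ∫⁻ y in Metric.ball x s, f y ≤
      ENNReal.ofReal (2 ^ d) * volume (Metric.ball (0 : E d) s) * maxFun f x := by
  obtain ⟨n, h1, h2⟩ := exists_mem_Ico_zpow hs (one_lt_two)
  calc _ ≤ ∫⁻ y in Metric.ball x (2 ^ (n + 1)), f y :=
        lintegral_mono_set (Metric.ball_subset_ball h2.le)
    _ ≤ _ := setLIntegral_ball_two_zpow_le f x (n + 1)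
    _ ≤ _ := by
        gcongr
        rw [zpow_add_one₀ two_ne_zero, mul_comm, volume_ball_mul 0 0 two_pos (by positivity)]
        gcongr

lemma mul_volume_maxFun_gt_le {d : ℕ} (hd : 1 ≤ d) (f : E d → ℝ≥0∞) (lam : ℝ≥0∞) :
    lam * volume {x | lam < maxFun f x} ≤ ENNReal.ofReal (4 ^ d) * ∫⁻ x, f x := by
  set I := ∫⁻ x, f x with hI
  rcases eq_or_ne I ⊤ with hItop | hItop
  · rw [hItop, ENNReal.mul_top (by simp)]; exact le_top
  rcases eq_or_ne lam 0 with rfl | hl0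
  · simp
  rcases eq_or_ne lam ⊤ with rfl | hltop
  · simp
  set V := volume (Metric.ball (0 : E d) 1) with hV
  have hV0 : V ≠ 0 := volume_ball_pos _ one_pos
  have hVt : V ≠ ⊤ := volume_ball_ne_top _ _
  set t : Set (E d × ℤ) := {q | lam * volume (Metric.ball (0 : E d) (2 ^ q.2)) <
    ∫⁻ y in Metric.ball q.1 (2 ^ q.2), f y} with ht
  have hR : ∀ q ∈ t, (2 : ℝ) ^ q.2 ≤ max 1 (I / (lam * V)).toReal := by
    intro q hq
    by_contra! hc
    obtain ⟨hc1, hc2⟩ := max_lt_iff.1 hc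
    have h1 : lam * volume (Metric.ball (0 : E d) (2 ^ q.2)) < I :=
      lt_of_lt_of_le hq (setLIntegral_le_lintegral _ _)
    rw [volume_ball_eq _ (by positivity), ← hV] at h1
    have h2 : ENNReal.ofReal ((2 : ℝ) ^ q.2) ≤ ENNReal.ofReal (((2 : ℝ) ^ q.2) ^ d) :=
      ENNReal.ofReal_le_ofReal (le_self_pow₀ hc1.le (by omega))
    have hne : I / (lam * V) ≠ ⊤ := ENNReal.div_ne_top hItop (mul_ne_zero hl0 hV0)
    have h3 : I / (lam * V) < ENNReal.ofReal ((2 : ℝ) ^ q.2) :=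
      (ENNReal.lt_ofReal_iff_toReal_lt hne).2 hc2
    rw [ENNReal.div_lt_iff (Or.inl (mul_ne_zero hl0 hV0))
      (Or.inl (ENNReal.mul_ne_top hltop hVt))] at h3
    refine lt_irrefl _ (h3.trans_le (le_trans ?_ h1.le))
    rw [mul_left_comm]
    gcongr
  obtain ⟨u, hut, hdisj, hcov⟩ := Vitali.exists_disjoint_subfamily_covering_enlargement_ball t
    (fun q => q.1) (fun q => (2 : ℝ) ^ q.2) _ hR 4 (by norm_num)
  have hcount : u.Countable := hdisj.countable_of_isOpen (fun _ _ => Metric.isOpen_ball)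
    fun q _ => ⟨q.1, Metric.mem_ball_self (by positivity)⟩
  have hsub : {x | lam < maxFun f x} ⊆ ⋃ q ∈ u, Metric.ball q.1 (4 * 2 ^ q.2) := by
    intro x hx
    obtain ⟨k, hk⟩ := lt_iSup_iff.1 (show lam < ⨆ k : ℤ, _ from hx)
    have hmem : (x, k) ∈ t := by
      rw [mul_comm, ← div_eq_mul_inv, ENNReal.lt_div_iff_mul_lt
        (Or.inl (volume_ball_pos _ (by positivity))) (Or.inl (volume_ball_ne_top _ _))] at hk
      exact hk
    obtain ⟨b, hb, hbsub⟩ := hcov _ hmem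
    exact mem_biUnion hb (hbsub (Metric.mem_ball_self (by positivity)))
  calc lam * volume {x | lam < maxFun f x}
      ≤ lam * ∑' q : u, volume (Metric.ball q.1.1 (4 * 2 ^ q.1.2)) := by
        gcongr
        exact (measure_mono hsub).trans (measure_biUnion_le _ hcount _)
    _ = ENNReal.ofReal (4 ^ d) * ∑' q : u, lam * volume (Metric.ball (0 : E d) (2 ^ q.1.2)) := by
        rw [← ENNReal.tsum_mul_left, ← ENNReal.tsum_mul_left]
        refine tsum_congr fun q => ?_
        rw [volume_ball_mul _ 0 (by norm_num) (by positivity), mul_left_comm]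
    _ ≤ ENNReal.ofReal (4 ^ d) * ∑' q : u, ∫⁻ y in Metric.ball q.1.1 (2 ^ q.1.2), f y := by
        gcongr with q
        exact (hut q.2).le
    _ = ENNReal.ofReal (4 ^ d) * ∫⁻ y in ⋃ q ∈ u, Metric.ball q.1 (2 ^ q.2), f y := by
        rw [lintegral_biUnion hcount (fun _ _ => measurableSet_ball) hdisj]
    _ ≤ _ := by gcongr; exact setLIntegral_le_lintegral _ _

lemma maxFun_rpow_le {d : ℕ} {f : E d → ℝ≥0∞} (hf : Measurable f) {p : ℝ} (hp : 1 < p) (x : E d) :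
    maxFun f x ^ p ≤ maxFun (fun y => f y ^ p) x := by
  have hp0 : 0 < p := zero_lt_one.trans hp
  rw [← ENNReal.le_rpow_inv_iff hp0]
  refine iSup_le fun k => ?_
  refine le_trans ?_ (ENNReal.rpow_le_rpow (le_iSup (fun k : ℤ =>
    (volume (Metric.ball (0 : E d) (2 ^ k)))⁻¹ * ∫⁻ y in Metric.ball x (2 ^ k), f y ^ p) k)
    (inv_nonneg.2 hp0.le))
  set B := Metric.ball x ((2 : ℝ) ^ k)
  have hVB : volume (Metric.ball (0 : E d) (2 ^ k)) = volume B := by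
    rw [volume_ball_eq _ (by positivity), volume_ball_eq x (by positivity)]
  rw [hVB]
  set V := volume B
  have hV0 : V ≠ 0 := volume_ball_pos _ (by positivity)
  have hVt : V ≠ ⊤ := volume_ball_ne_top _ _
  have hpq := Real.HolderConjugate.conjExponent hp
  set q := p.conjExponent
  have hH := ENNReal.lintegral_mul_le_Lp_mul_Lq (volume.restrict B) hpq hf.aemeasurable
    (measurable_const : Measurable fun _ : E d => (1 : ℝ≥0∞)).aemeasurable
  simp only [Pi.mul_apply, mul_one, ENNReal.one_rpow, lintegral_const, one_mul,
    Measure.restrict_apply_univ, one_div] at hH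
  have hq : q⁻¹ = 1 - p⁻¹ := by rw [← hpq.inv_add_inv_eq_one]; ring
  calc V⁻¹ * ∫⁻ y in B, f y ≤ V⁻¹ * ((∫⁻ y in B, f y ^ p) ^ p⁻¹ * V ^ q⁻¹) := by gcongr
    _ = (V⁻¹ * ∫⁻ y in B, f y ^ p) ^ p⁻¹ := by
      rw [ENNReal.mul_rpow_of_nonneg _ _ (inv_nonneg.2 hp0.le), hq, ENNReal.rpow_sub _ _ hV0 hVt,
        ENNReal.rpow_one, ENNReal.inv_rpow, div_eq_mul_inv]
      calc _ = (V⁻¹ * V) * ((∫⁻ y in B, f y ^ p) ^ p⁻¹ * (V ^ p⁻¹)⁻¹) := by ring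
        _ = _ := by rw [ENNReal.inv_mul_cancel hV0 hVt, one_mul, mul_comm]

lemma le_add_tsum_dyadic {a m : ℝ≥0∞} (ha : a ≠ 0) (hat : a ≠ ⊤) :
    m ≤ a + ∑' n : ℕ, (if 2 ^ n * a < m then 2 ^ (n + 1) * a else 0) := by
  rcases le_or_gt m a with h | h
  · exact h.trans le_self_add
  refine le_trans ?_ le_add_self
  rcases eq_or_ne m ⊤ with rfl | hm
  · have h1 : (⊤ : ℝ≥0∞) = ∑' _ : ℕ, a := (ENNReal.tsum_const_eq_top_of_ne_zero ha).symm
    rw [h1]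
    refine ENNReal.tsum_le_tsum fun n => ?_
    rw [← h1, if_pos (ENNReal.mul_lt_top (by finiteness) hat.lt_top)]
    exact le_mul_of_one_le_left' (one_le_pow₀ one_le_two)
  · have hex : ∃ n : ℕ, m ≤ 2 ^ n * a := by
      obtain ⟨n, hn⟩ := ENNReal.exists_nat_mul_gt ha hm
      refine ⟨n, hn.le.trans ?_⟩
      gcongr
      exact_mod_cast Nat.lt_two_pow_self.le
    classical
    obtain ⟨n, hn⟩ : ∃ n, Nat.find hex = n + 1 := by
      refine Nat.exists_eq_succ_of_ne_zero fun h0 => ?_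
      have := Nat.find_spec hex
      rw [h0, pow_zero, one_mul] at this
      exact absurd h this.not_gt
    have h1 : m ≤ 2 ^ (n + 1) * a := hn ▸ Nat.find_spec hex
    have h2 : 2 ^ n * a < m := not_le.1 (Nat.find_min hex (by omega))
    refine le_trans ?_ (ENNReal.le_tsum n)
    rwa [if_pos h2]

lemma exists_setLIntegral_maxFun_le {d : ℕ} (hd : 1 ≤ d) {p : ℝ} (hp : 1 < p) {S : Set (E d)}
    (hS : volume S ≠ ⊤) :
    ∃ C : ℝ≥0, ∀ f : E d → ℝ≥0∞, Measurable f →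
      ∫⁻ x in S, maxFun f x ≤ C * (∫⁻ x, f x ^ p) ^ p⁻¹ := by
  have hp0 : 0 < p := zero_lt_one.trans hp
  set ρ : ℝ≥0∞ := 2 * (2 ^ p)⁻¹ with hρ
  have hρ1 : ρ < 1 := by
    have h2 : (2 : ℝ≥0∞) < 2 ^ p := by
      conv_lhs => rw [← ENNReal.rpow_one 2]
      exact ENNReal.rpow_lt_rpow_of_exponent_lt (by norm_num) (by simp) hp
    rw [hρ, ← div_eq_mul_inv]
    exact (ENNReal.div_lt_iff (Or.inl (by simp)) (Or.inl (by simp))).2 (by simpa using h2)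
  set C₁ : ℝ≥0∞ := volume S + 2 * ENNReal.ofReal (4 ^ d) * (1 - ρ)⁻¹ + 1 with hC₁
  have hC₁t : C₁ ≠ ⊤ := by
    have : (1 - ρ)⁻¹ ≠ ⊤ := ENNReal.inv_ne_top.2 (tsub_pos_of_lt hρ1).ne'
    finiteness
  refine ⟨C₁.toNNReal, fun f hf => ?_⟩
  rw [ENNReal.coe_toNNReal hC₁t]
  set A := (∫⁻ x, f x ^ p) ^ p⁻¹ with hA
  have hAp : A ^ p = ∫⁻ x, f x ^ p := by rw [hA, ENNReal.rpow_inv_rpow hp0.ne']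
  rcases eq_or_ne A 0 with h0 | h0
  · rw [h0, ENNReal.zero_rpow_of_pos hp0] at hAp
    have hf0 : f =ᵐ[volume] 0 := by
      filter_upwards [(lintegral_eq_zero_iff (hf.pow_const p)).1 hAp.symm] with x hx
      simpa [hp0, hp0.not_gt] using hx
    have hM : ∀ x, maxFun f x = 0 := by
      intro x
      refine le_antisymm (iSup_le fun k => ?_) zero_le
      rw [lintegral_congr_ae (ae_restrict_of_ae hf0)]
      simp
    simp [hM]
  rcases eq_or_ne A ⊤ with ht | ht
  · rw [ht, ENNReal.mul_top (by simp [hC₁])]; exact le_top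
  have hMm := measurable_maxFun hf
  have hlev : ∀ n : ℕ, volume {x | 2 ^ n * A < maxFun f x} ≤
      ENNReal.ofReal (4 ^ d) * ((2 ^ p)⁻¹) ^ n := by
    intro n
    have hw := mul_volume_maxFun_gt_le hd (fun y => f y ^ p) ((2 ^ n * A) ^ p)
    rw [← hAp] at hw
    have hle : volume {x | 2 ^ n * A < maxFun f x} ≤
        volume {x | (2 ^ n * A) ^ p < maxFun (fun y => f y ^ p) x} := by
      refine measure_mono fun x hx => ?_
      exact (ENNReal.rpow_lt_rpow hx hp0).trans_le (maxFun_rpow_le hf hp x)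
    have h1 : (2 ^ n * A) ^ p = ((2 : ℝ≥0∞) ^ p) ^ n * A ^ p := by
      rw [ENNReal.mul_rpow_of_nonneg _ _ hp0.le, ← ENNReal.rpow_natCast_mul,
        mul_comm (n : ℝ) p, ENNReal.rpow_mul_natCast]
    have hAp0 : A ^ p ≠ 0 := by simp [h0, ht]
    have hApt : A ^ p ≠ ⊤ := by simp [h0, ht]
    have hT0 : ((2 : ℝ≥0∞) ^ p) ^ n ≠ 0 := pow_ne_zero _ (by simp)
    have hTt : ((2 : ℝ≥0∞) ^ p) ^ n ≠ ⊤ := ENNReal.pow_ne_top (by simp)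
    refine hle.trans ?_
    rw [← ENNReal.inv_pow, ← div_eq_mul_inv, ENNReal.le_div_iff_mul_le (Or.inl hT0) (Or.inl hTt)]
    refine (ENNReal.mul_le_mul_iff_right hAp0 hApt).1 ?_
    calc _ = (2 ^ n * A) ^ p * volume {x | (2 ^ n * A) ^ p < maxFun (fun y => f y ^ p) x} := by
          rw [h1]; ring
      _ ≤ _ := hw.trans_eq (mul_comm _ _)
  calc ∫⁻ x in S, maxFun f x
      ≤ ∫⁻ x in S, (A + ∑' n : ℕ, (if 2 ^ n * A < maxFun f x then 2 ^ (n + 1) * A else 0)) :=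
        lintegral_mono fun x => le_add_tsum_dyadic h0 ht
    _ = A * volume S + ∑' n : ℕ, ∫⁻ x in S,
          {x | 2 ^ n * A < maxFun f x}.indicator (fun _ => 2 ^ (n + 1) * A) x := by
        rw [lintegral_add_left measurable_const, lintegral_const, Measure.restrict_apply_univ]
        congr 1
        rw [← lintegral_tsum]
        · simp only [indicator, mem_ofPred_eq]
        · intro n
          exact (measurable_const.indicator (measurableSet_lt measurable_const hMm)).aemeasurable
    _ ≤ A * volume S + ∑' n : ℕ, (2 * ENNReal.ofReal (4 ^ d) * A) * ρ ^ n := by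
        gcongr with n
        rw [lintegral_indicator_const (measurableSet_lt measurable_const hMm)]
        calc _ ≤ 2 ^ (n + 1) * A * (ENNReal.ofReal (4 ^ d) * ((2 ^ p)⁻¹) ^ n) := by
              gcongr
              exact (Measure.restrict_apply_le _ _).trans (hlev n)
          _ = _ := by rw [hρ, mul_pow]; ring
    _ = A * volume S + 2 * ENNReal.ofReal (4 ^ d) * A * (1 - ρ)⁻¹ := by
        rw [ENNReal.tsum_mul_left, ENNReal.tsum_geometric]
    _ ≤ C₁ * A := by
        rw [hC₁, add_mul, add_mul]
        refine le_trans (le_of_eq ?_) le_self_add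
        ring

/-- A sequence of smooth bumps shrinking to the origin. -/
def bump (d n : ℕ) : ContDiffBump (0 : E d) where
  rIn := 1 / (n + 1)
  rOut := 2 / (n + 1)
  rIn_pos := by positivity
  rIn_lt_rOut := by gcongr; norm_num

/-- The mollifying kernels. -/
def mker (d n : ℕ) : E d → ℝ := (bump d n).normed volume

lemma bump_rOut (d n : ℕ) : (bump d n).rOut = 2 / (n + 1) := rfl

lemma tendsto_bump_rOut (d : ℕ) : Tendsto (fun n => (bump d n).rOut) atTop (𝓝 0) := by
  simp_rw [bump_rOut]
  have h := tendsto_one_div_add_atTop_nhds_zero_nat (𝕜 := ℝ)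
  have := h.const_mul 2
  simpa [div_eq_mul_inv] using this

lemma mker_nonneg (d n : ℕ) (x : E d) : 0 ≤ mker d n x := (bump d n).nonneg_normed x

lemma contDiff_mker (d n : ℕ) {m : ℕ∞} : ContDiff ℝ m (mker d n) := (bump d n).contDiff_normed

lemma continuous_mker (d n : ℕ) : Continuous (mker d n) := (bump d n).continuous_normed

lemma hasCompactSupport_mker (d n : ℕ) : HasCompactSupport (mker d n) :=
  (bump d n).hasCompactSupport_normed

lemma tsupport_mker (d n : ℕ) : tsupport (mker d n) = Metric.closedBall 0 (bump d n).rOut :=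
  (bump d n).tsupport_normed_eq

lemma support_mker (d n : ℕ) : Function.support (mker d n) = Metric.ball 0 (bump d n).rOut :=
  (bump d n).support_normed_eq

lemma lintegral_mker (d n : ℕ) : ∫⁻ x, ENNReal.ofReal (mker d n x) = 1 := by
  have h := (bump d n).integral_normed (μ := volume)
  change ∫ x, mker d n x = 1 at h
  rw [← ofReal_integral_eq_lintegral_ofReal (f := mker d n) (bump d n).integrable_normed
    (Eventually.of_forall (mker_nonneg d n)), h, ENNReal.ofReal_one]

lemma lintegral_mker_sub_left (d n : ℕ) (y : E d) :
    ∫⁻ x, ENNReal.ofReal (mker d n (x - y)) = 1 := by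
  rw [lintegral_sub_right_eq_self (fun x => ENNReal.ofReal (mker d n x)) y, lintegral_mker]

lemma ofReal_mker_le (d n : ℕ) (x : E d) : ENNReal.ofReal (mker d n x) ≤
    ENNReal.ofReal (2 ^ d) * (volume (Metric.ball (0 : E d) (bump d n).rOut))⁻¹ := by
  have h1 : (bump d n).rOut ≤ 2 * (bump d n).rIn := by
    simp only [bump]; rw [mul_one_div]
  have h2 := (bump d n).normed_le_div_measure_closedBall_rOut volume 2 h1 x
  rw [finrank_euclideanSpace_fin, measureReal_def, Measure.addHaar_closedBall _ _
    (bump d n).rOut_pos.le, finrank_euclideanSpace_fin, ← volume_ball_eq 0 (bump d n).rOut_pos] at h2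
  refine (ENNReal.ofReal_le_ofReal h2).trans (le_of_eq ?_)
  rw [ENNReal.ofReal_div_of_pos, ENNReal.ofReal_toReal (volume_ball_ne_top _ _), div_eq_mul_inv]
  exact ENNReal.toReal_pos (volume_ball_pos _ (bump d n).rOut_pos) (volume_ball_ne_top _ _)

/-- Mollification. -/
def mollify {d : ℕ} {F : Type*} [NormedAddCommGroup F] [NormedSpace ℝ F] (n : ℕ) (u : E d → F) :
    E d → F :=
  convolution (mker d n) u (ContinuousLinearMap.lsmul ℝ ℝ) volume

/-- Mollification of `ℝ≥0∞`-valued functions. -/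
def lmollify {d : ℕ} (n : ℕ) (f : E d → ℝ≥0∞) (x : E d) : ℝ≥0∞ :=
  ∫⁻ y, ENNReal.ofReal (mker d n (x - y)) * f y

section
variable {d : ℕ} {F : Type*} [NormedAddCommGroup F] [NormedSpace ℝ F]

lemma mollify_apply (n : ℕ) (u : E d → F) (x : E d) :
    mollify n u x = ∫ y, mker d n (x - y) • u y := convolution_lsmul_swap

lemma enorm_mollify_le (n : ℕ) (u : E d → F) (x : E d) :
    ‖mollify n u x‖ₑ ≤ lmollify n (fun y => ‖u y‖ₑ) x := by
  rw [mollify_apply]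
  refine (enorm_integral_le_lintegral_enorm _).trans (le_of_eq (lintegral_congr fun y => ?_))
  rw [enorm_smul, Real.enorm_eq_ofReal (mker_nonneg d n _)]

lemma ae_tendsto_mollify [CompleteSpace F] {u : E d → F} (hu : Integrable u) :
    ∀ᵐ x, Tendsto (fun n => mollify n u x) atTop (𝓝 (u x)) :=
  ContDiffBump.ae_convolution_tendsto_right_of_locallyIntegrable (tendsto_bump_rOut d)
    (Eventually.of_forall fun n => by
      change (bump d n).rOut ≤ 2 * (bump d n).rIn
      simp only [bump]; rw [mul_one_div]) hu.locallyIntegrable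

lemma contDiff_mollify {u : E d → F} (hu : Integrable u) (n : ℕ) {m : ℕ∞} :
    ContDiff ℝ m (mollify n u) :=
  (hasCompactSupport_mker d n).contDiff_convolution_left _ (contDiff_mker d n) hu.locallyIntegrable

lemma integrable_mollify {u : E d → F} (hu : Integrable u) (n : ℕ) : Integrable (mollify n u) :=
  (bump d n).integrable_normed.integrable_convolution _ hu

end

lemma measurable_lmollify {d : ℕ} (n : ℕ) {f : E d → ℝ≥0∞} (hf : Measurable f) :
    Measurable (lmollify n f) := by
  have := (continuous_mker d n).measurable
  refine Measurable.lintegral_prod_right' (f := fun q : E d × E d =>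
    ENNReal.ofReal (mker d n (q.1 - q.2)) * f q.2) ?_
  fun_prop

lemma lmollify_le_setLIntegral {d : ℕ} (n : ℕ) (f : E d → ℝ≥0∞) (x : E d) :
    lmollify n f x ≤ ENNReal.ofReal (2 ^ d) *
      (volume (Metric.ball (0 : E d) (bump d n).rOut))⁻¹ *
        ∫⁻ y in Metric.ball x (bump d n).rOut, f y := by
  have hc : ENNReal.ofReal (2 ^ d) * (volume (Metric.ball (0 : E d) (bump d n).rOut))⁻¹ ≠ ⊤ :=
    ENNReal.mul_ne_top ENNReal.ofReal_ne_top
      (ENNReal.inv_ne_top.2 (volume_ball_pos _ (bump d n).rOut_pos))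
  rw [← lintegral_const_mul' _ _ hc, ← lintegral_indicator measurableSet_ball]
  refine lintegral_mono fun y => ?_
  by_cases hy : y ∈ Metric.ball x (bump d n).rOut
  · rw [indicator_of_mem hy]
    gcongr
    exact ofReal_mker_le d n _
  · have : x - y ∉ Function.support (mker d n) := by
      rw [support_mker]
      rwa [mem_ball_zero_iff, ← dist_eq_norm, dist_comm, ← Metric.mem_ball]
    rw [Function.notMem_support.1 this]
    simp

lemma lmollify_le_maxFun {d : ℕ} (n : ℕ) (f : E d → ℝ≥0∞) (x : E d) :
    lmollify n f x ≤ ENNReal.ofReal (4 ^ d) * maxFun f x := by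
  refine (lmollify_le_setLIntegral n f x).trans ?_
  have h := setLIntegral_ball_le f x (bump d n).rOut_pos
  set V := volume (Metric.ball (0 : E d) (bump d n).rOut)
  calc _ ≤ ENNReal.ofReal (2 ^ d) * V⁻¹ * (ENNReal.ofReal (2 ^ d) * V * maxFun f x) := by gcongr
    _ = ENNReal.ofReal (2 ^ d) * ENNReal.ofReal (2 ^ d) * (V⁻¹ * V) * maxFun f x := by ring
    _ = _ := by
      rw [ENNReal.inv_mul_cancel (volume_ball_pos _ (bump d n).rOut_pos) (volume_ball_ne_top _ _),
        ← ENNReal.ofReal_mul (by positivity), ← mul_pow, mul_one]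
      norm_num

/-- The averages of a mollified function are controlled by the maximal function. -/
lemma setLIntegral_ball_lmollify_le {d : ℕ} (n : ℕ) {f : E d → ℝ≥0∞} (hf : Measurable f) (x : E d)
    {s : ℝ} (hs : 0 < s) : ∫⁻ w in Metric.ball x s, lmollify n f w ≤
      ENNReal.ofReal (8 ^ d) * volume (Metric.ball (0 : E d) s) * maxFun f x := by
  set ε := (bump d n).rOut with hε
  have hε0 : 0 < ε := (bump d n).rOut_pos
  have h8 : (4 : ℝ) ^ d ≤ 8 ^ d := by gcongr; norm_num
  rcases le_total ε s with hc | hc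
  · have h1 : ∫⁻ w in Metric.ball x s, lmollify n f w ≤ ∫⁻ y in Metric.ball x (2 * s), f y := by
      have hm := (continuous_mker d n).measurable
      unfold lmollify
      rw [lintegral_lintegral_swap (by fun_prop), ← lintegral_indicator measurableSet_ball]
      refine lintegral_mono fun y => ?_
      rw [lintegral_mul_const _ (by fun_prop)]
      by_cases hy : y ∈ Metric.ball x (2 * s)
      · rw [indicator_of_mem hy]
        refine (mul_le_of_le_one_left' ?_)
        exact (setLIntegral_le_lintegral _ _).trans (lintegral_mker_sub_left d n y).le
      · rw [indicator_of_notMem hy]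
        have : ∫⁻ w in Metric.ball x s, ENNReal.ofReal (mker d n (w - y)) = 0 := by
          rw [setLIntegral_congr_fun (g := fun _ => 0) measurableSet_ball, lintegral_zero]
          intro w hw
          have : w - y ∉ Function.support (mker d n) := by
            rw [support_mker, mem_ball_zero_iff, ← dist_eq_norm]
            intro hwy
            apply hy
            rw [Metric.mem_ball] at hw ⊢
            have := dist_triangle y w x
            rw [dist_comm y w] at this
            linarith
          simp [Function.notMem_support.1 this]
        rw [this, zero_mul]
    refine h1.trans ((setLIntegral_ball_le f x (by positivity)).trans ?_)
    rw [volume_ball_mul 0 0 two_pos hs, ← mul_assoc, ← ENNReal.ofReal_mul (by positivity),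
      ← mul_pow]
    gcongr
    norm_num
  · have hpt : ∀ w ∈ Metric.ball x s, lmollify n f w ≤ ENNReal.ofReal (8 ^ d) * maxFun f x := by
      intro w hw
      refine (lmollify_le_setLIntegral n f w).trans ?_
      have hsub : Metric.ball w ε ⊆ Metric.ball x (2 * ε) := by
        apply Metric.ball_subset_ball'
        rw [Metric.mem_ball] at hw
        linarith
      have h2 := (lintegral_mono_set (f := f) hsub (μ := volume)).trans
        (setLIntegral_ball_le f x (by positivity))
      rw [volume_ball_mul 0 0 two_pos hε0] at h2
      set V := volume (Metric.ball (0 : E d) ε)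
      calc _ ≤ ENNReal.ofReal (2 ^ d) * V⁻¹ *
            (ENNReal.ofReal (2 ^ d) * (ENNReal.ofReal (2 ^ d) * V) * maxFun f x) := by gcongr
        _ = ENNReal.ofReal (2 ^ d) * ENNReal.ofReal (2 ^ d) * ENNReal.ofReal (2 ^ d) *
            (V⁻¹ * V) * maxFun f x := by ring
        _ = _ := by
          rw [ENNReal.inv_mul_cancel (volume_ball_pos _ hε0) (volume_ball_ne_top _ _),
            ← ENNReal.ofReal_mul (by positivity), ← ENNReal.ofReal_mul (by positivity), ← mul_pow,
            ← mul_pow, mul_one]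
          norm_num
    refine (setLIntegral_mono_ae' measurableSet_ball (Eventually.of_forall hpt)).trans ?_
    rw [setLIntegral_const, volume_ball_eq x hs, volume_ball_eq 0 hs]
    exact le_of_eq (by ring)

lemma HasWeakGradient.mono {d : ℕ} {Ω Ω' : Set (E d)} {u : E d → ℝ} {g : E d → E d}
    (h : HasWeakGradient Ω u g) (hΩ : MeasurableSet Ω) (hsub : Ω' ⊆ Ω) :
    HasWeakGradient Ω' u g where
  locallyIntegrableOn := h.locallyIntegrableOn.mono_set hsub
  locallyIntegrableOn_gradient := h.locallyIntegrableOn_gradient.mono_set hsub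
  integral_eq ψ hψ hc hs v := by
    have h1 := h.integral_eq ψ hψ hc (hs.trans hsub) v
    have key : ∀ F : E d → ℝ, (∀ x, x ∉ tsupport ψ → F x = 0) →
        ∫ x in Ω, F x = ∫ x in Ω', F x := by
      intro F hF
      refine setIntegral_eq_of_subset_of_forall_sdiff_eq_zero hΩ hsub fun x hx => hF x ?_
      exact fun hx' => hx.2 (hs hx')
    rw [key, key (fun x => ⟪g x, v⟫_ℝ * ψ x)] at h1
    · exact h1
    · intro x hx; rw [image_eq_zero_of_notMem_tsupport hx, mul_zero]
    · intro x hx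
      rw [image_eq_zero_of_notMem_tsupport (f := fderiv ℝ ψ)
        (fun h' => hx (tsupport_fderiv_subset ℝ h'))]
      simp

/-- Mollification commutes with the weak gradient away from the boundary. -/
lemma HasWeakGradient.fderiv_mollify {d : ℕ} {Ω : Set (E d)} {u : E d → ℝ}
    {g : E d → E d} (h : HasWeakGradient Ω u g) (hu : Integrable u) (hg : Integrable g) {n : ℕ}
    {w : E d} (hw : Metric.closedBall w (bump d n).rOut ⊆ Ω) (v : E d) :
    fderiv ℝ (mollify n u) w v = ⟪mollify n g w, v⟫_ℝ := by
  set ρ := mker d n with hρ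
  have hρ1 : ContDiff ℝ 1 ρ := contDiff_mker d n
  have h1 : fderiv ℝ (mollify n u) w v = ∫ y, fderiv ℝ ρ (w - y) v * u y := by
    have hfd := (hasCompactSupport_mker d n).hasFDerivAt_convolution_right
      (ContinuousLinearMap.lsmul ℝ ℝ : ℝ →L[ℝ] ℝ →L[ℝ] ℝ).flip hu.locallyIntegrable hρ1 w
    rw [convolution_flip] at hfd
    rw [show mollify n u = convolution (mker d n) u (ContinuousLinearMap.lsmul ℝ ℝ) volume from rfl,
      hfd.fderiv, convolution_precompR_apply _ hu.locallyIntegrable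
        ((hasCompactSupport_mker d n).fderiv ℝ) (hρ1.continuous_fderiv one_ne_zero)]
    rfl
  set ψ : E d → ℝ := fun y => ρ (w - y) with hψ
  have hψd : ∀ y, fderiv ℝ ψ y v = - fderiv ℝ ρ (w - y) v := by
    intro y
    have h2 : HasFDerivAt ψ ((fderiv ℝ ρ (w - y)).comp (-ContinuousLinearMap.id ℝ (E d))) y :=
      ((hρ1.differentiable one_ne_zero (w - y)).hasFDerivAt).comp y
        ((hasFDerivAt_id y).const_sub w)
    rw [h2.fderiv]; simp
  have hsupp : ∀ y, y ∉ Metric.closedBall w (bump d n).rOut → w - y ∉ tsupport ρ := by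
    intro y hy
    rwa [tsupport_mker, mem_closedBall_zero_iff, ← dist_eq_norm, dist_comm,
      ← Metric.mem_closedBall]
  have hts : tsupport ψ ⊆ Metric.closedBall w (bump d n).rOut := by
    refine closure_minimal (fun y hy => ?_) Metric.isClosed_closedBall
    by_contra hc
    exact hy (image_eq_zero_of_notMem_tsupport (f := ρ) (hsupp y hc))
  have hcs : HasCompactSupport ψ :=
    HasCompactSupport.of_support_subset_isCompact (isCompact_closedBall w _)
      ((subset_tsupport _).trans hts)
  have hψs : ContDiff ℝ ∞ ψ := (contDiff_mker d n).comp (contDiff_const.sub contDiff_id)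
  have h3 := h.integral_eq ψ hψs hcs (hts.trans hw) v
  have key : ∀ F : E d → ℝ, (∀ y, w - y ∉ tsupport ρ → F y = 0) →
      ∫ y in Ω, F y = ∫ y, F y := by
    intro F hF
    refine setIntegral_eq_integral_of_forall_compl_eq_zero fun y hy => hF y (hsupp y fun hy' => ?_)
    exact hy (hw hy')
  simp_rw [hψd] at h3
  rw [key, key (fun y => ⟪g y, v⟫_ℝ * ψ y)] at h3
  · rw [h1, mollify_apply, real_inner_comm, ← integral_inner]
    · simp_rw [mul_neg, integral_neg, neg_inj] at h3
      rw [show (fun y => fderiv ℝ ρ (w - y) v * u y) = fun y => u y * fderiv ℝ ρ (w - y) v from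
        funext fun y => mul_comm _ _, h3]
      refine integral_congr_ae (Eventually.of_forall fun y => ?_)
      simp only [hψ, inner_smul_right]
      rw [real_inner_comm, mul_comm]
    · exact ((hasCompactSupport_mker d n).convolutionExists_left
        (ContinuousLinearMap.lsmul ℝ ℝ) (continuous_mker d n) hg.locallyIntegrable w).integrable_swap
  · intro y hy; simp only [hψ]; rw [image_eq_zero_of_notMem_tsupport hy, mul_zero]
  · intro y hy
    rw [image_eq_zero_of_notMem_tsupport (f := fderiv ℝ ρ)
        (fun h' => hy (tsupport_fderiv_subset ℝ h'))]
    simp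

lemma lintegral_comp_add_smul {d : ℕ} {F : E d → ℝ≥0∞} (hF : Measurable F) (x : E d) {t : ℝ}
    (ht : 0 < t) :
    ∫⁻ z, F (x + t • z) = ENNReal.ofReal ((t ^ d)⁻¹) * ∫⁻ z, F z := by
  have h1 : ∫⁻ z, F (x + t • z) = ∫⁻ z, F (x + z) ∂(Measure.map (t • ·) volume) := by
    rw [lintegral_map (by fun_prop) (by fun_prop)]
  rw [h1, Measure.map_addHaar_smul _ ht.ne', lintegral_smul_measure, finrank_euclideanSpace_fin,
    abs_of_pos (by positivity), lintegral_add_left_eq_self F x, smul_eq_mul]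

lemma setLIntegral_ball_comp_homothety {d : ℕ} {G : E d → ℝ≥0∞} (hG : Measurable G) (x : E d)
    {t ρ : ℝ} (ht : 0 < t) :
    ∫⁻ z in Metric.ball x ρ, G (x + t • (z - x)) =
      ENNReal.ofReal ((t ^ d)⁻¹) * ∫⁻ z in Metric.ball x (t * ρ), G z := by
  rw [← lintegral_indicator measurableSet_ball, ← lintegral_indicator measurableSet_ball,
    ← lintegral_comp_add_smul (hG.indicator measurableSet_ball) x ht,
    ← lintegral_sub_right_eq_self
      (fun z => (Metric.ball x (t * ρ)).indicator G (x + t • z)) x]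
  refine lintegral_congr fun z => ?_
  have : z ∈ Metric.ball x ρ ↔ x + t • (z - x) ∈ Metric.ball x (t * ρ) := by
    simp only [Metric.mem_ball, dist_eq_norm, add_sub_cancel_left, norm_smul, Real.norm_eq_abs,
      abs_of_pos ht]
    exact (mul_lt_mul_iff_right₀ ht).symm
  by_cases h : z ∈ Metric.ball x ρ
  · rw [indicator_of_mem h, indicator_of_mem (this.1 h)]
  · rw [indicator_of_notMem h, indicator_of_notMem (this.not.1 h)]

lemma enorm_sub_le_lintegral_fderiv {d : ℕ} {v : E d → ℝ} (hv : ContDiff ℝ 1 v) (x z : E d) :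
    ‖v x - v z‖ₑ ≤
      ‖z - x‖ₑ * ∫⁻ t in Ioc (0 : ℝ) 1, ‖fderiv ℝ v (x + t • (z - x))‖ₑ := by
  have hd : ∀ t : ℝ, HasDerivAt (fun t : ℝ => v (x + t • (z - x)))
      (fderiv ℝ v (x + t • (z - x)) (z - x)) t := by
    intro t
    have h1 : HasDerivAt (fun t : ℝ => x + t • (z - x)) (z - x) t := by
      simpa using ((hasDerivAt_id t).smul_const (z - x)).const_add x
    exact ((hv.differentiable one_ne_zero _).hasFDerivAt).comp_hasDerivAt t h1
  have hc : Continuous fun t : ℝ => fderiv ℝ v (x + t • (z - x)) :=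
    (hv.continuous_fderiv one_ne_zero).comp (by fun_prop)
  have hint : IntervalIntegrable (fun t : ℝ => fderiv ℝ v (x + t • (z - x)) (z - x)) volume 0 1 :=
    (hc.clm_apply continuous_const).intervalIntegrable _ _
  have hftc := intervalIntegral.integral_eq_sub_of_hasDerivAt (fun t _ => hd t) hint
  simp only [one_smul, add_sub_cancel, zero_smul, add_zero] at hftc
  rw [← enorm_neg, neg_sub, ← hftc, intervalIntegral.integral_of_le zero_le_one,
    ← lintegral_const_mul _ hc.measurable.enorm]
  refine (enorm_integral_le_lintegral_enorm _).trans (lintegral_mono fun t => ?_)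
  rw [mul_comm]
  exact ContinuousLinearMap.le_opENorm _ _

lemma setLIntegral_ball_enorm_sub_le {d : ℕ} {v : E d → ℝ} (hv : ContDiff ℝ 1 v) {x c : E d}
    {r K : ℝ} (hr : 0 < r) (hK : 0 ≤ K) (hcx : dist c x ≤ K * r) {G : E d → ℝ≥0∞}
    (hG : Measurable G) {A : ℝ≥0∞}
    (hGA : ∀ ρ : ℝ, 0 < ρ → ∫⁻ w in Metric.ball x ρ, G w ≤ A * volume (Metric.ball (0 : E d) ρ))
    (hle : ∀ z ∈ Metric.ball c r, ∀ t ∈ Ioc (0 : ℝ) 1,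
      ‖fderiv ℝ v (x + t • (z - x))‖ₑ ≤ G (x + t • (z - x))) :
    ∫⁻ z in Metric.ball c r, ‖v x - v z‖ₑ ≤
      ENNReal.ofReal ((K + 1) * r) * (A * (ENNReal.ofReal ((K + 1) ^ d) *
        volume (Metric.ball (0 : E d) r))) := by
  have hK1 : 0 < K + 1 := by linarith
  have hball : ∀ z ∈ Metric.ball c r, ‖z - x‖ < (K + 1) * r := by
    intro z hz
    rw [← dist_eq_norm]
    have := dist_triangle z c x
    rw [Metric.mem_ball] at hz
    linarith
  have hsub : Metric.ball c r ⊆ Metric.ball x ((K + 1) * r) := fun z hz => by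
    rw [Metric.mem_ball, dist_eq_norm]; exact hball z hz
  calc ∫⁻ z in Metric.ball c r, ‖v x - v z‖ₑ
      ≤ ∫⁻ z in Metric.ball c r, ENNReal.ofReal ((K + 1) * r) *
          ∫⁻ t in Ioc (0 : ℝ) 1, G (x + t • (z - x)) := by
        refine setLIntegral_mono_ae' measurableSet_ball (Eventually.of_forall fun z hz => ?_)
        refine (enorm_sub_le_lintegral_fderiv hv x z).trans ?_
        gcongr ?_ * ?_
        · rw [← ofReal_norm]; exact ENNReal.ofReal_le_ofReal (hball z hz).le
        · exact setLIntegral_mono_ae' measurableSet_Ioc (Eventually.of_forall fun t ht => hle z hz t ht)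
    _ = ENNReal.ofReal ((K + 1) * r) *
          ∫⁻ t in Ioc (0 : ℝ) 1, ∫⁻ z in Metric.ball c r, G (x + t • (z - x)) := by
        rw [lintegral_const_mul' _ _ ENNReal.ofReal_ne_top, lintegral_lintegral_swap (by fun_prop)]
    _ ≤ ENNReal.ofReal ((K + 1) * r) * ∫⁻ t in Ioc (0 : ℝ) 1,
          A * (ENNReal.ofReal ((K + 1) ^ d) * volume (Metric.ball (0 : E d) r)) := by
        refine mul_le_mul' le_rfl ?_
        refine setLIntegral_mono_ae' measurableSet_Ioc (Eventually.of_forall fun t ht => ?_)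
        refine (lintegral_mono_set hsub).trans ?_
        rw [setLIntegral_ball_comp_homothety hG x ht.1]
        have h0 : 0 < (K + 1) * r := by positivity
        calc _ ≤ ENNReal.ofReal ((t ^ d)⁻¹) * (A * volume (Metric.ball (0 : E d)
              (t * ((K + 1) * r)))) := by gcongr; exact hGA _ (mul_pos ht.1 h0)
          _ = _ := by
              rw [volume_ball_mul 0 0 ht.1 h0, volume_ball_mul 0 0 hK1 hr, mul_left_comm,
                ← mul_assoc (ENNReal.ofReal _) (ENNReal.ofReal _) (_ * _),
                ← ENNReal.ofReal_mul (inv_nonneg.2 (pow_nonneg ht.1.le _)),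
                inv_mul_cancel₀ (pow_ne_zero _ ht.1.ne'), ENNReal.ofReal_one, one_mul]
    _ = _ := by simp

/-- The points `x` and `y` see a common ball of radius `|x - y|`, at distance comparable to
`|x - y|`, inside `Ω`. -/
def SeeCommonBall {d : ℕ} (Ω : Set (E d)) (K : ℝ) (x y : E d) : Prop :=
  ∃ c, dist c x ≤ K * dist x y ∧ dist c y ≤ K * dist x y ∧
    ∀ z ∈ Metric.closedBall c (dist x y), segment ℝ x z ⊆ Ω ∧ segment ℝ y z ⊆ Ω

lemma HasWeakGradient.ae_setLIntegral_ball_enorm_sub_le {d : ℕ} {Ω : Set (E d)} (hΩ : IsOpen Ω)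
    {u : E d → ℝ} {g : E d → E d} (h : HasWeakGradient Ω u g) (hu : Integrable u)
    (hg : Integrable g) (hgm : Measurable g) {K : ℝ} (hK : 0 ≤ K) :
    ∀ᵐ x, ∀ (c : E d) (r : ℝ), 0 < r → dist c x ≤ K * r →
      (∀ z ∈ Metric.closedBall c r, segment ℝ x z ⊆ Ω) →
      ∫⁻ z in Metric.ball c r, ‖u x - u z‖ₑ ≤ ENNReal.ofReal ((K + 1) * r) *
        (ENNReal.ofReal (8 ^ d) * maxFun (fun y => ‖g y‖ₑ) x * (ENNReal.ofReal ((K + 1) ^ d) *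
        volume (Metric.ball (0 : E d) r))) := by
  have hae := ae_tendsto_mollify hu
  filter_upwards [hae] with x hx c r hr hcx hseg
  have hcpt : IsCompact ((fun q : ℝ × E d => x + q.1 • (q.2 - x)) ''
      (Icc (0 : ℝ) 1 ×ˢ Metric.closedBall c r)) :=
    (isCompact_Icc.prod (isCompact_closedBall c r)).image (by fun_prop)
  have hsubΩ : (fun q : ℝ × E d => x + q.1 • (q.2 - x)) ''
      (Icc (0 : ℝ) 1 ×ˢ Metric.closedBall c r) ⊆ Ω := by
    rintro _ ⟨⟨t, z⟩, ⟨ht, hz⟩, rfl⟩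
    refine hseg z hz ?_
    rw [segment_eq_image']
    exact ⟨t, ht, rfl⟩
  obtain ⟨ε, hε, hεΩ⟩ := hcpt.exists_cthickening_subset_open hΩ hsubΩ
  have hev : ∀ᶠ n in atTop, ∫⁻ z in Metric.ball c r, ‖mollify n u x - mollify n u z‖ₑ ≤
      ENNReal.ofReal ((K + 1) * r) * (ENNReal.ofReal (8 ^ d) * maxFun (fun y => ‖g y‖ₑ) x *
        (ENNReal.ofReal ((K + 1) ^ d) * volume (Metric.ball (0 : E d) r))) := by
    filter_upwards [(tendsto_bump_rOut d).eventually_lt_const hε] with n hn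
    refine setLIntegral_ball_enorm_sub_le (contDiff_mollify hu n) hr hK hcx
      (measurable_lmollify n hgm.enorm) (fun ρ hρ => ?_) fun z hz t ht => ?_
    · refine (setLIntegral_ball_lmollify_le n hgm.enorm x hρ).trans (le_of_eq ?_)
      ring
    · refine le_trans ?_ (enorm_mollify_le n g _)
      have hw : Metric.closedBall (x + t • (z - x)) (bump d n).rOut ⊆ Ω := by
        refine ((Metric.closedBall_subset_closedBall hn.le).trans
          (Metric.closedBall_subset_cthickening ?_ ε)).trans hεΩ
        exact ⟨(t, z), ⟨⟨ht.1.le, ht.2⟩, Metric.ball_subset_closedBall hz⟩, rfl⟩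
      rw [← ofReal_norm, ← ofReal_norm]
      refine ENNReal.ofReal_le_ofReal (ContinuousLinearMap.opNorm_le_bound _ (norm_nonneg _)
        fun v => ?_)
      rw [h.fderiv_mollify hu hg hw]
      exact norm_inner_le_norm _ _
  calc ∫⁻ z in Metric.ball c r, ‖u x - u z‖ₑ
      = ∫⁻ z in Metric.ball c r, liminf (fun n => ‖mollify n u x - mollify n u z‖ₑ) atTop := by
        refine lintegral_congr_ae (ae_restrict_of_ae ?_)
        filter_upwards [hae] with z hz
        exact ((hx.sub hz).enorm.liminf_eq).symm
    _ ≤ liminf (fun n => ∫⁻ z in Metric.ball c r, ‖mollify n u x - mollify n u z‖ₑ) atTop := by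
        refine lintegral_liminf_le fun n => ?_
        have := (contDiff_mollify hu n (m := 0)).continuous.measurable
        fun_prop
    _ ≤ _ := liminf_le_of_frequently_le' hev.frequently

/-- A pointwise inequality of Hajłasz type. -/
lemma exists_enorm_sub_le_maxFun (d : ℕ) {K : ℝ} (hK : 0 ≤ K) :
    ∃ C : ℝ≥0, ∀ (Ω : Set (E d)), IsOpen Ω → ∀ (u : E d → ℝ) (g : E d → E d),
      HasWeakGradient Ω u g → Integrable u → Integrable g → Measurable u → Measurable g →
      ∃ S : Set (E d), (∀ᵐ x, x ∈ S) ∧ ∀ x ∈ S, ∀ y ∈ S, SeeCommonBall Ω K x y →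
        ‖u x - u y‖ₑ ≤ C * ENNReal.ofReal (dist x y) *
          (maxFun (fun z => ‖g z‖ₑ) x + maxFun (fun z => ‖g z‖ₑ) y) := by
  set C : ℝ≥0∞ := ENNReal.ofReal (K + 1) * ENNReal.ofReal (8 ^ d) * ENNReal.ofReal ((K + 1) ^ d)
    with hC
  refine ⟨C.toNNReal, fun Ω hΩ u g h hu hg hum hgm => ⟨_,
    h.ae_setLIntegral_ball_enorm_sub_le hΩ hu hg hgm hK, fun x hx y hy hxy => ?_⟩⟩
  rw [ENNReal.coe_toNNReal (by rw [hC]; finiteness)]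
  rcases eq_or_ne x y with rfl | hne
  · simp
  obtain ⟨c, hcx, hcy, hc⟩ := hxy
  set r := dist x y with hr
  have hr0 : 0 < r := dist_pos.2 hne
  have h1 := hx c r hr0 hcx fun z hz => (hc z hz).1
  have h2 := hy c r hr0 hcy fun z hz => (hc z hz).2
  set V := volume (Metric.ball (0 : E d) r) with hV
  have hV0 : V ≠ 0 := volume_ball_pos _ hr0
  have hVt : V ≠ ⊤ := volume_ball_ne_top _ _
  refine (ENNReal.mul_le_mul_iff_right hV0 hVt).1 ?_
  calc V * ‖u x - u y‖ₑ = ∫⁻ _ in Metric.ball c r, ‖u x - u y‖ₑ := by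
        rw [setLIntegral_const, volume_ball_eq c hr0, hV, volume_ball_eq 0 hr0, mul_comm]
    _ ≤ ∫⁻ z in Metric.ball c r, (‖u x - u z‖ₑ + ‖u y - u z‖ₑ) := by
        refine lintegral_mono fun z => ?_
        have : u x - u y = (u x - u z) - (u y - u z) := by ring
        rw [this]
        exact enorm_sub_le
    _ ≤ _ := by
        rw [lintegral_add_left (by fun_prop)]
        refine (add_le_add h1 h2).trans (le_of_eq ?_)
        rw [ENNReal.ofReal_mul (by linarith), hC]
        ring

lemma SeeCommonBall.mono {d : ℕ} {Ω Ω' : Set (E d)} {K K' : ℝ} {x y : E d}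
    (h : SeeCommonBall Ω K x y) (hΩ : Ω ⊆ Ω') (hK : K ≤ K') : SeeCommonBall Ω' K' x y := by
  obtain ⟨c, h1, h2, h3⟩ := h
  have : K * dist x y ≤ K' * dist x y := by gcongr
  exact ⟨c, h1.trans this, h2.trans this, fun z hz =>
    ⟨(h3 z hz).1.trans hΩ, (h3 z hz).2.trans hΩ⟩⟩

lemma seeCommonBall_of_ball_subset {d : ℕ} {Ω : Set (E d)} {x₀ : E d} {R : ℝ}
    (hR : Metric.ball x₀ R ⊆ Ω) {x y : E d} (hx : x ∈ Metric.ball x₀ (R / 4))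
    (hy : y ∈ Metric.ball x₀ (R / 4)) : SeeCommonBall Ω 1 x y := by
  rw [Metric.mem_ball] at hx hy
  have hxy := dist_triangle_right x y x₀
  have hR0 : 0 < R := by linarith [dist_nonneg (x := x) (y := x₀)]
  refine ⟨x, by simp, by simp, fun z hz => ?_⟩
  rw [Metric.mem_closedBall] at hz
  have hz' : z ∈ Metric.ball x₀ R := by
    rw [Metric.mem_ball]; linarith [dist_triangle z x x₀]
  have hx' : x ∈ Metric.ball x₀ R := by rw [Metric.mem_ball]; linarith
  have hy' : y ∈ Metric.ball x₀ R := by rw [Metric.mem_ball]; linarith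
  exact ⟨((convex_ball x₀ R).segment_subset hx' hz').trans hR,
    ((convex_ball x₀ R).segment_subset hy' hz').trans hR⟩

/-- Near a boundary point, `Ω` contains a common cone with vertex at any pair of points. -/
lemma exists_seeCommonBall_of_mem_frontier {d : ℕ} {Ω : Set (E d)} (hΩ : HasSmoothBoundary Ω)
    {x₀ : E d} (hx₀ : x₀ ∈ frontier Ω) : ∃ ρ : ℝ, 0 < ρ ∧ ∃ K : ℝ, 0 ≤ K ∧
      ∀ x ∈ Ω ∩ Metric.ball x₀ ρ, ∀ y ∈ Ω ∩ Metric.ball x₀ ρ, SeeCommonBall Ω K x y := by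
  obtain ⟨r, e, h, hr, he, hh, hΩr⟩ := hΩ x₀ hx₀
  set F : E d → ℝ := fun x => ⟪x, e⟫_ℝ - h (x - ⟪x, e⟫_ℝ • e) with hF
  have hFc : ContDiff ℝ 1 F := by
    have h1 : ContDiff ℝ 1 h := hh.of_le (by exact_mod_cast le_top)
    have h2 : ContDiff ℝ 1 fun x : E d => ⟪x, e⟫_ℝ := contDiff_id.inner ℝ contDiff_const
    exact h2.sub (h1.comp (contDiff_id.sub (h2.smul contDiff_const)))
  have hFadd : ∀ (p : E d) (τ : ℝ), F (p + τ • e) = F p + τ := by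
    intro p τ
    have h1 : ⟪p + τ • e, e⟫_ℝ = ⟪p, e⟫_ℝ + τ := by
      rw [inner_add_left, real_inner_smul_left, real_inner_self_eq_norm_sq, he]; ring
    have h2 : p + τ • e - ⟪p + τ • e, e⟫_ℝ • e = p - ⟪p, e⟫_ℝ • e := by
      rw [h1, add_smul]; abel
    simp only [hF]
    rw [h2, h1]; ring
  have hmem : ∀ x ∈ Metric.ball x₀ r, x ∈ Ω ↔ 0 < F x := by
    intro x hx
    have : x ∈ Ω ∩ Metric.ball x₀ r ↔ x ∈ {x ∈ Metric.ball x₀ r |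
      h (x - ⟪x, e⟫_ℝ • e) < ⟪x, e⟫_ℝ} := by rw [hΩr]
    simpa [hx, hF, hx.out] using this
  obtain ⟨L, t, ht, hL⟩ := hFc.contDiffAt.exists_lipschitzOnWith (x := x₀)
  obtain ⟨R', hR', hR't⟩ := Metric.mem_nhds_iff.1 ht
  set R := min R' r with hR
  have hR0 : 0 < R := lt_min hR' hr
  set K : ℝ := 2 * L with hK
  have hK0 : 0 ≤ K := by positivity
  set ρ : ℝ := R / (2 * K + 6) with hρ
  have hρ0 : 0 < ρ := by positivity
  have hρR : ρ * (2 * K + 6) = R := div_mul_cancel₀ _ (by positivity)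
  have key : ∀ (s : ℝ) (P : E d), 0 ≤ s → s < 2 * ρ → P ∈ Ω ∩ Metric.ball x₀ ρ → ∀ z : E d,
      ‖z - P - (K * s) • e‖ ≤ 2 * s → segment ℝ P z ⊆ Ω := by
    intro s P hs0 hs hP z hz
    rw [segment_eq_image']
    rintro _ ⟨τ, ⟨hτ0, hτ1⟩, rfl⟩
    set w := z - P - (K * s) • e with hw
    have hPd : ‖P - x₀‖ < ρ := by rw [← dist_eq_norm]; exact hP.2
    have hτw : ‖τ • w‖ ≤ 2 * s * τ := by
      rw [norm_smul, Real.norm_eq_abs, abs_of_nonneg hτ0]; nlinarith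
    have hτw' : ‖τ • w‖ ≤ 2 * s := hτw.trans (by nlinarith)
    have heq : P + τ • (z - P) = (P + τ • w) + (τ * (K * s)) • e := by
      rw [hw, smul_sub τ (z - P), smul_smul]; abel
    have hKs : K * s ≤ K * (2 * ρ) := by gcongr
    have hKρ : 0 ≤ K * ρ := by positivity
    have hin1 : P + τ • w ∈ Metric.ball x₀ R := by
      rw [Metric.mem_ball, dist_eq_norm]
      have : P + τ • w - x₀ = (P - x₀) + τ • w := by abel
      rw [this]
      refine (norm_add_le _ _).trans_lt ?_
      nlinarith
    have hin2 : P + τ • (z - P) ∈ Metric.ball x₀ r := by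
      refine Metric.ball_subset_ball (min_le_right R' r) ?_
      rw [heq, Metric.mem_ball, dist_eq_norm]
      have : (P + τ • w) + (τ * (K * s)) • e - x₀ = (P - x₀) + τ • w + (τ * (K * s)) • e := by abel
      rw [this]
      have h3 : ‖(τ * (K * s)) • e‖ ≤ K * s := by
        rw [norm_smul, he, mul_one, Real.norm_eq_abs, abs_of_nonneg (by positivity)]
        exact mul_le_of_le_one_left (by positivity) hτ1
      refine ((norm_add_le _ _).trans (add_le_add (norm_add_le _ _) h3)).trans_lt ?_
      nlinarith
    have hPR : P ∈ Metric.ball x₀ R := by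
      refine Metric.ball_subset_ball ?_ hP.2
      nlinarith
    rw [hmem _ hin2, heq, hFadd]
    have hlip := hL.dist_le_mul P (hR't (Metric.ball_subset_ball (min_le_left _ _) hPR)) _
      (hR't (Metric.ball_subset_ball (min_le_left _ _) hin1))
    rw [Real.dist_eq, dist_eq_norm, sub_add_cancel_left, norm_neg] at hlip
    have hFP : 0 < F P := (hmem P (Metric.ball_subset_ball (min_le_right _ _) hPR)).1 hP.1
    have h4 : (L : ℝ) * ‖τ • w‖ ≤ L * (2 * s * τ) := by gcongr
    have h5 := (abs_le.1 hlip).2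
    have h6 : τ * (K * s) = L * (2 * s * τ) := by rw [hK]; ring
    linarith
  refine ⟨ρ, hρ0, K + 1, by positivity, fun x hx y hy => ?_⟩
  set s := dist x y with hs
  have hs2 : s < 2 * ρ := by
    have := dist_triangle_right x y x₀
    have h1 := hx.2
    have h2 := hy.2
    rw [Metric.mem_ball] at h1 h2
    linarith
  have hs0 : 0 ≤ s := dist_nonneg
  have hcx : dist (x + (K * s) • e) x = K * s := by
    rw [dist_eq_norm, add_sub_cancel_left, norm_smul, he, mul_one, Real.norm_eq_abs,
      abs_of_nonneg (by positivity)]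
  refine ⟨x + (K * s) • e, ?_, ?_, fun z hz => ⟨?_, ?_⟩⟩
  · rw [hcx]; nlinarith
  · have := dist_triangle (x + (K * s) • e) x y
    rw [hcx] at this
    linarith
  · refine key s x hs0 hs2 hx z ?_
    rw [Metric.mem_closedBall, dist_eq_norm] at hz
    rw [sub_sub]
    linarith
  · refine key s y hs0 hs2 hy z ?_
    rw [Metric.mem_closedBall, dist_eq_norm] at hz
    have : z - y - (K * s) • e = (z - (x + (K * s) • e)) + (x - y) := by abel
    rw [this]
    have h2 := norm_add_le (z - (x + (K * s) • e)) (x - y)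
    rw [← dist_eq_norm x y] at h2
    linarith

lemma exists_seeCommonBall {d : ℕ} {Ω : Set (E d)} (hΩo : IsOpen Ω)
    (hΩb : Bornology.IsBounded Ω) (hΩ : HasSmoothBoundary Ω) : ∃ r : ℝ, 0 < r ∧ ∃ K : ℝ, 0 ≤ K ∧
      ∀ x ∈ Ω, ∀ y ∈ Ω, dist x y < r → SeeCommonBall Ω K x y := by
  have hcpt : IsCompact (closure Ω) := hΩb.isCompact_closure
  have : ∃ r : ℝ, 0 < r ∧ ∃ K : ℝ, 0 ≤ K ∧
      ∀ x ∈ closure Ω, x ∈ Ω → ∀ y ∈ Ω, dist x y < r → SeeCommonBall Ω K x y := by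
    refine hcpt.induction_on (p := fun s => ∃ r : ℝ, 0 < r ∧ ∃ K : ℝ, 0 ≤ K ∧
      ∀ x ∈ s, x ∈ Ω → ∀ y ∈ Ω, dist x y < r → SeeCommonBall Ω K x y) ?_ ?_ ?_ ?_
    · exact ⟨1, one_pos, 0, le_rfl, by simp⟩
    · rintro s t hst ⟨r, hr, K, hK, h⟩
      exact ⟨r, hr, K, hK, fun x hx => h x (hst hx)⟩
    · rintro s t ⟨r, hr, K, hK, h⟩ ⟨r', hr', K', hK', h'⟩
      refine ⟨min r r', lt_min hr hr', max K K', hK.trans (le_max_left _ _), ?_⟩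
      rintro x (hx | hx) hxΩ y hy hxy
      · exact (h x hx hxΩ y hy (hxy.trans_le (min_le_left _ _))).mono subset_rfl (le_max_left _ _)
      · exact (h' x hx hxΩ y hy (hxy.trans_le (min_le_right _ _))).mono subset_rfl
          (le_max_right _ _)
    · intro x₀ hx₀
      have hloc : ∃ ρ : ℝ, 0 < ρ ∧ ∃ K : ℝ, 0 ≤ K ∧ ∀ x ∈ Ω ∩ Metric.ball x₀ ρ,
          ∀ y ∈ Ω ∩ Metric.ball x₀ ρ, SeeCommonBall Ω K x y := by
        by_cases hx : x₀ ∈ Ω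
        · obtain ⟨R, hR, hRΩ⟩ := Metric.isOpen_iff.1 hΩo x₀ hx
          exact ⟨R / 4, by positivity, 1, zero_le_one, fun x hx y hy =>
            seeCommonBall_of_ball_subset hRΩ hx.2 hy.2⟩
        · exact exists_seeCommonBall_of_mem_frontier hΩ ⟨hx₀, by rwa [hΩo.interior_eq]⟩
      obtain ⟨ρ, hρ, K, hK, h⟩ := hloc
      refine ⟨Metric.ball x₀ (ρ / 2), mem_nhdsWithin_of_mem_nhds (Metric.ball_mem_nhds _ (by positivity)),
        ρ / 2, by positivity, K, hK, fun x hx hxΩ y hy hxy => h x ⟨hxΩ, ?_⟩ y ⟨hy, ?_⟩⟩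
      · exact Metric.ball_subset_ball (by linarith) hx
      · rw [Metric.mem_ball] at hx ⊢
        rw [dist_comm] at hxy
        linarith [dist_triangle y x x₀]
  obtain ⟨r, hr, K, hK, h⟩ := this
  exact ⟨r, hr, K, hK, fun x hx => h x (subset_closure hx) hx⟩

/-- The restriction of `Λ_δ(u)` to pairs `(x, y)` with `x ∈ A`, `y ∈ B`, `|x - y| < r`. -/
def nearEnergy {d : ℕ} (φ : ℝ → ℝ) (A B : Set (E d)) (r δ : ℝ) (u : E d → ℝ) : ℝ≥0∞ :=
  ENNReal.ofReal δ * ∫⁻ x in A, ∫⁻ y in B ∩ Metric.ball x r,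
    prof φ ((u x - u y) / δ) * kern d (x - y)

/-- The restriction of `Λ_δ(u)` to pairs at distance at least `r`. -/
def farEnergy {d : ℕ} (φ : ℝ → ℝ) (Ω : Set (E d)) (r δ : ℝ) (u : E d → ℝ) : ℝ≥0∞ :=
  ENNReal.ofReal δ * ∫⁻ x in Ω, ∫⁻ y in Ω \ Metric.ball x r,
    prof φ ((u x - u y) / δ) * kern d (x - y)

/-- A local Hajłasz type inequality for `u` in `Ω`, with the function `M`. -/
structure HajlaszBound {d : ℕ} (Ω : Set (E d)) (r : ℝ) (C : ℝ≥0) (u : E d → ℝ)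
    (M : E d → ℝ≥0∞) : Prop where
  measurable : Measurable u
  measurable_bound : Measurable M
  exists_set : ∃ S : Set (E d), (∀ᵐ x, x ∈ S) ∧ ∀ x ∈ Ω ∩ S, ∀ y ∈ Ω ∩ S, dist x y < r →
    ‖u x - u y‖ₑ ≤ C * ENNReal.ofReal (dist x y) * (M x + M y)

lemma lamScaled_eq {d : ℕ} {φ : ℝ → ℝ} (h : MemClassA d φ) (Ω : Set (E d)) (δ : ℝ) (u : E d → ℝ) :
    LamScaled φ Ω δ u = ENNReal.ofReal δ * ∫⁻ x in Ω, ∫⁻ y in Ω,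
      prof φ ((u x - u y) / δ) * kern d (x - y) := by
  unfold LamScaled Lam
  congr 1
  refine lintegral_congr fun x => lintegral_congr fun y => ?_
  rw [prof, kern, ← ENNReal.ofReal_mul (h.nonneg _ (abs_nonneg _)), sub_div, div_eq_mul_inv]

lemma measurable_energy_integrand {d : ℕ} {φ : ℝ → ℝ} (h : MemClassA d φ) {u : E d → ℝ}
    (hu : Measurable u) (δ : ℝ) : Measurable fun q : E d × E d =>
      prof φ ((u q.1 - u q.2) / δ) * kern d (q.1 - q.2) := by
  have := measurable_prof h
  have := measurable_kern d
  fun_prop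

lemma measurable_setLIntegral_inter_ball {d : ℕ} {F : E d × E d → ℝ≥0∞} (hF : Measurable F)
    {B : Set (E d)} (hB : MeasurableSet B) (r : ℝ) :
    Measurable fun x => ∫⁻ y in B ∩ Metric.ball x r, F (x, y) := by
  have h1 : ∀ x : E d, ∫⁻ y in B ∩ Metric.ball x r, F (x, y) =
      ∫⁻ y, (Prod.snd ⁻¹' B ∩ {q : E d × E d | dist q.2 q.1 < r}).indicator F (x, y) := by
    intro x
    rw [← lintegral_indicator (hB.inter measurableSet_ball)]
    rfl
  simp_rw [h1]
  exact (hF.indicator ((measurable_snd hB).inter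
    (measurableSet_lt (by fun_prop) measurable_const))).lintegral_prod_right'

lemma nearEnergy_le_lamScaled {d : ℕ} {φ : ℝ → ℝ} (h : MemClassA d φ) {Ω A B : Set (E d)}
    (hA : A ⊆ Ω) (hB : B ⊆ Ω) (r δ : ℝ) (u : E d → ℝ) :
    nearEnergy φ A B r δ u ≤ LamScaled φ Ω δ u := by
  rw [lamScaled_eq h, nearEnergy]
  refine mul_le_mul' le_rfl ?_
  exact (lintegral_mono fun x => lintegral_mono_set (inter_subset_left.trans hB)).trans
    (lintegral_mono_set hA)

lemma lamScaled_le_near_add_far {d : ℕ} {φ : ℝ → ℝ} (h : MemClassA d φ) {Ω : Set (E d)}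
    (hΩ : MeasurableSet Ω) {u : E d → ℝ} (hu : Measurable u) (r δ : ℝ) :
    LamScaled φ Ω δ u ≤ nearEnergy φ Ω Ω r δ u + farEnergy φ Ω r δ u := by
  rw [lamScaled_eq h, nearEnergy, farEnergy, ← mul_add, ← lintegral_add_left
    (measurable_setLIntegral_inter_ball (measurable_energy_integrand h hu δ) hΩ r)]
  gcongr with x
  rw [lintegral_inter_add_sdiff _ _ measurableSet_ball]

lemma lintegral_prof_mul_norm_sub_mul_kern {d : ℕ} (hd : 1 ≤ d) {φ : ℝ → ℝ} (h : MemClassA d φ)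
    {m : ℝ} (hm : 0 ≤ m) (x : E d) :
    ∫⁻ y, prof φ (m * ‖x - y‖) * kern d (x - y) =
      ENNReal.ofReal m * (sphereArea d * invSqIntegral (prof φ)) := by
  rw [lintegral_sub_left_eq_self (fun z => prof φ (m * ‖z‖) * kern d z) x,
    lintegral_norm_mul_kern hd (measurable_prof h) (prof_zero h) hm, mul_assoc]

/-- Pairs at small distance contribute at most a multiple of the integral of the Hajłasz bound. -/
lemma nearEnergy_le {d : ℕ} (hd : 1 ≤ d) {φ : ℝ → ℝ} (h : MemClassA d φ) {Ω A B : Set (E d)}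
    (hA : A ⊆ Ω) (hB : B ⊆ Ω) (hAm : MeasurableSet A) (hBm : MeasurableSet B) {r : ℝ} {C : ℝ≥0}
    {u : E d → ℝ} {M : E d → ℝ≥0∞} (hM : HajlaszBound Ω r C u M) (hMA : ∫⁻ x in A, M x ≠ ⊤)
    (hMB : ∫⁻ x in B, M x ≠ ⊤) {δ : ℝ} (hδ : 0 < δ) :
    nearEnergy φ A B r δ u ≤ 2 * C * (sphereArea d * invSqIntegral (prof φ)) *
      ((∫⁻ x in A, M x) + ∫⁻ x in B, M x) := by
  obtain ⟨S, hS, hbd⟩ := hM.exists_set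
  have hMm := hM.measurable_bound
  have hfA : ∀ᵐ x, x ∈ A → M x < ⊤ :=
    (ae_restrict_iff' hAm).1 (ae_lt_top hMm hMA)
  have hfB : ∀ᵐ x, x ∈ B → M x < ⊤ :=
    (ae_restrict_iff' hBm).1 (ae_lt_top hMm hMB)
  set a : E d → ℝ := fun x => 2 * C * (M x).toReal / δ with ha
  have ha0 : ∀ x, 0 ≤ a x := fun x => by positivity
  set Q := sphereArea d * invSqIntegral (prof φ) with hQ
  have hprofm := measurable_prof h
  have hkm := measurable_kern d
  have ham : Measurable a := by fun_prop
  have hpt : ∀ᵐ x, x ∈ A → ∀ᵐ y, y ∈ B ∩ Metric.ball x r →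
      prof φ ((u x - u y) / δ) * kern d (x - y) ≤
        prof φ (a x * ‖x - y‖) * kern d (x - y) + prof φ (a y * ‖x - y‖) * kern d (x - y) := by
    filter_upwards [hS, hfA] with x hxS hxf hxA
    filter_upwards [hS, hfB] with y hyS hyf hyB
    rw [← add_mul]
    gcongr
    have hdist : dist x y < r := by rw [dist_comm]; exact hyB.2
    have h1 := hbd x ⟨hA hxA, hxS⟩ y ⟨hB hyB.1, hyS⟩ hdist
    have h2 : |u x - u y| ≤ C * dist x y * ((M x).toReal + (M y).toReal) := by
      have h3 := ENNReal.toReal_mono (ENNReal.mul_ne_top (ENNReal.mul_ne_top ENNReal.coe_ne_top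
        ENNReal.ofReal_ne_top) (ENNReal.add_ne_top.2 ⟨(hxf hxA).ne, (hyf hyB.1).ne⟩)) h1
      rwa [toReal_enorm, Real.norm_eq_abs, ENNReal.toReal_mul, ENNReal.toReal_mul,
        ENNReal.toReal_ofReal dist_nonneg, ENNReal.toReal_add (hxf hxA).ne (hyf hyB.1).ne] at h3
    have h4 : |(u x - u y) / δ| ≤ |a x / 2 * ‖x - y‖ + a y / 2 * ‖x - y‖| := by
      have := ha0 x
      have := ha0 y
      rw [abs_div, abs_of_pos hδ, div_le_iff₀ hδ,
        abs_of_nonneg (a := a x / 2 * ‖x - y‖ + a y / 2 * ‖x - y‖) (by positivity)]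
      refine h2.trans (le_of_eq ?_)
      rw [ha, dist_eq_norm]
      field_simp
    refine (prof_le_prof h h4).trans ((prof_add_le' h _ _).trans (le_of_eq ?_))
    congr 2 <;> ring
  have hbound : ∫⁻ x in A, ∫⁻ y in B ∩ Metric.ball x r,
      prof φ ((u x - u y) / δ) * kern d (x - y) ≤
      (∫⁻ x in A, ENNReal.ofReal (a x) * Q) + ∫⁻ x in B, ENNReal.ofReal (a x) * Q := by
    calc _ ≤ ∫⁻ x in A, ((∫⁻ y in B, prof φ (a x * ‖x - y‖) * kern d (x - y)) +
            ∫⁻ y in B, prof φ (a y * ‖x - y‖) * kern d (x - y)) := by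
          refine lintegral_mono_ae ((ae_restrict_iff' hAm).2 ?_)
          filter_upwards [hpt] with x hx hxA
          rw [← lintegral_add_left (by fun_prop)]
          refine (lintegral_mono_ae ((ae_restrict_iff' (hBm.inter measurableSet_ball)).2
            (hx hxA))).trans (lintegral_mono_set inter_subset_left)
      _ = (∫⁻ x in A, ∫⁻ y in B, prof φ (a x * ‖x - y‖) * kern d (x - y)) +
            ∫⁻ y in B, ∫⁻ x in A, prof φ (a y * ‖x - y‖) * kern d (x - y) := by
          rw [lintegral_add_left (Measurable.lintegral_prod_right' (f := fun q : E d × E d =>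
            prof φ (a q.1 * ‖q.1 - q.2‖) * kern d (q.1 - q.2)) (by fun_prop))]
          rw [lintegral_lintegral_swap (f := fun x y => prof φ (a y * ‖x - y‖) * kern d (x - y))
            (by fun_prop)]
      _ ≤ _ := by
          gcongr with x y
          · exact (setLIntegral_le_lintegral _ _).trans
              (lintegral_prof_mul_norm_sub_mul_kern hd h (ha0 x) x).le
          · refine (setLIntegral_le_lintegral _ _).trans (le_of_eq ?_)
            rw [← lintegral_prof_mul_norm_sub_mul_kern hd h (ha0 y) y]
            exact lintegral_congr fun x => by rw [norm_sub_rev, kern_sub_comm]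
  have hcompute : ∀ D : Set (E d), MeasurableSet D → (∀ᵐ x, x ∈ D → M x < ⊤) →
      ENNReal.ofReal δ * ∫⁻ x in D, ENNReal.ofReal (a x) * Q = 2 * C * Q * ∫⁻ x in D, M x := by
    intro D hD hfD
    rw [← lintegral_const_mul _ (by fun_prop), ← lintegral_const_mul _ hMm]
    refine lintegral_congr_ae ((ae_restrict_iff' hD).2 ?_)
    filter_upwards [hfD] with x hx hxD
    have h1 : ENNReal.ofReal δ * ENNReal.ofReal (a x) = 2 * C * M x := by
      rw [← ENNReal.ofReal_mul hδ.le]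
      have : δ * a x = 2 * C * (M x).toReal := by rw [ha]; field_simp
      rw [this, ENNReal.ofReal_mul (by positivity), ENNReal.ofReal_toReal (hx hxD).ne,
        ENNReal.ofReal_mul zero_le_two]
      simp
    rw [← mul_assoc, h1]; ring
  rw [nearEnergy]
  refine (mul_le_mul' le_rfl hbound).trans ?_
  rw [mul_add, hcompute A hAm hfA, hcompute B hBm hfB, mul_add]

lemma kern_le_of_notMem_ball {d : ℕ} {x y : E d} {r : ℝ} (hr : 0 < r) (hy : y ∉ Metric.ball x r) :
    kern d (x - y) ≤ ENNReal.ofReal ((r ^ (d + 1))⁻¹) := by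
  rw [Metric.mem_ball, not_lt, dist_comm, dist_eq_norm] at hy
  exact ENNReal.ofReal_le_ofReal (inv_anti₀ (by positivity) (by gcongr))

lemma farEnergy_le_of_prof_le {d : ℕ} {φ : ℝ → ℝ} {b : ℝ≥0∞} (hb : ∀ t, prof φ t ≤ b)
    {Ω : Set (E d)} (hΩ : MeasurableSet Ω) {r : ℝ} (hr : 0 < r) (δ : ℝ) (u : E d → ℝ) :
    farEnergy φ Ω r δ u ≤ ENNReal.ofReal δ *
      (b * ENNReal.ofReal ((r ^ (d + 1))⁻¹) * volume Ω * volume Ω) := by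
  rw [farEnergy]
  refine mul_le_mul' le_rfl ?_
  calc _ ≤ ∫⁻ x in Ω, ∫⁻ y in Ω, b * ENNReal.ofReal ((r ^ (d + 1))⁻¹) := by
        refine lintegral_mono fun x => ?_
        refine le_trans (setLIntegral_mono_ae' (hΩ.diff measurableSet_ball)
          (Eventually.of_forall fun y hy => ?_)) (lintegral_mono_set sdiff_subset)
        exact mul_le_mul' (hb _) (kern_le_of_notMem_ball hr hy.2)
    _ = _ := by simp

lemma farEnergy_le_lintegral_enorm_sub {d : ℕ} {φ : ℝ → ℝ} (h : MemClassA d φ)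
    {Ω : Set (E d)} (hΩ : MeasurableSet Ω) {r : ℝ} (hr : 0 < r) {δ : ℝ} (hδ : 0 < δ)
    {u : E d → ℝ} (hu : Measurable u) :
    farEnergy φ Ω r δ u ≤ invSqIntegral (prof φ) * ENNReal.ofReal ((r ^ (d + 1))⁻¹) *
      ∫⁻ x in Ω, ∫⁻ y in Ω, ‖u x - u y‖ₑ := by
  set I := invSqIntegral (prof φ)
  set k := ENNReal.ofReal ((r ^ (d + 1))⁻¹)
  have hpt : ∀ x y, y ∉ Metric.ball x r → prof φ ((u x - u y) / δ) * kern d (x - y) ≤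
      ENNReal.ofReal δ⁻¹ * I * k * ‖u x - u y‖ₑ := by
    intro x y hy
    refine (mul_le_mul' (ofReal_prof_le h _) (kern_le_of_notMem_ball hr hy)).trans (le_of_eq ?_)
    rw [abs_div, abs_of_pos hδ, div_eq_mul_inv, ENNReal.ofReal_mul (abs_nonneg _),
      ← Real.norm_eq_abs, ofReal_norm]
    ring
  have hum : Measurable fun q : E d × E d => ‖u q.1 - u q.2‖ₑ := by fun_prop
  rw [farEnergy]
  calc _ ≤ ENNReal.ofReal δ * ∫⁻ x in Ω, ∫⁻ y in Ω,
          ENNReal.ofReal δ⁻¹ * I * k * ‖u x - u y‖ₑ := by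
        refine mul_le_mul' le_rfl (lintegral_mono fun x => ?_)
        exact le_trans (setLIntegral_mono_ae' (hΩ.diff measurableSet_ball)
          (Eventually.of_forall fun y hy => hpt x y hy.2)) (lintegral_mono_set sdiff_subset)
    _ = ENNReal.ofReal δ * (ENNReal.ofReal δ⁻¹ * I * k * ∫⁻ x in Ω, ∫⁻ y in Ω, ‖u x - u y‖ₑ) := by
        rw [← lintegral_const_mul _ hum.lintegral_prod_right']
        congr 1
        exact lintegral_congr fun x => lintegral_const_mul _ (by fun_prop)
    _ = (ENNReal.ofReal δ * ENNReal.ofReal δ⁻¹) * (I * k * ∫⁻ x in Ω, ∫⁻ y in Ω, ‖u x - u y‖ₑ) := by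
        ring
    _ = _ := by
        rw [← ENNReal.ofReal_mul hδ.le, mul_inv_cancel₀ hδ.ne', ENNReal.ofReal_one, one_mul]

/-- `∫_{A} ∫_{B} |u(x) - u(y)|`. -/
def oscIntegral {d : ℕ} (u : E d → ℝ) (A B : Set (E d)) : ℝ≥0∞ :=
  ∫⁻ x in A, ∫⁻ y in B, ‖u x - u y‖ₑ

lemma HajlaszBound.oscIntegral_le {d : ℕ} {Ω A B : Set (E d)} {r : ℝ} {C : ℝ≥0} {u : E d → ℝ}
    {M : E d → ℝ≥0∞} (h : HajlaszBound Ω r C u M) (hA : A ⊆ Ω) (hB : B ⊆ Ω)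
    (hAm : MeasurableSet A) (hBm : MeasurableSet B)
    (hAB : ∀ x ∈ A, ∀ y ∈ B, dist x y < r) :
    oscIntegral u A B ≤ 2 * C * ENNReal.ofReal r * volume Ω * ∫⁻ x in Ω, M x := by
  obtain ⟨S, hS, hbd⟩ := h.exists_set
  have hMm := h.measurable_bound
  calc oscIntegral u A B ≤ ∫⁻ x in A, ∫⁻ y in B, C * ENNReal.ofReal r * (M x + M y) := by
        refine lintegral_mono_ae ((ae_restrict_iff' hAm).2 ?_)
        filter_upwards [hS] with x hxS hx
        refine lintegral_mono_ae ((ae_restrict_iff' hBm).2 ?_)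
        filter_upwards [hS] with y hyS hy
        have hd := hAB x hx y hy
        refine (hbd x ⟨hA hx, hxS⟩ y ⟨hB hy, hyS⟩ hd).trans ?_
        gcongr
    _ ≤ ∫⁻ x in Ω, ∫⁻ y in Ω, C * ENNReal.ofReal r * (M x + M y) :=
        (lintegral_mono fun x => lintegral_mono_set hB).trans (lintegral_mono_set hA)
    _ = _ := by
        simp_rw [mul_add]
        have h1 : ∀ x, ∫⁻ y in Ω, (C * ENNReal.ofReal r * M x + C * ENNReal.ofReal r * M y) =
            C * ENNReal.ofReal r * M x * volume Ω + C * ENNReal.ofReal r * ∫⁻ y in Ω, M y := by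
          intro x
          rw [lintegral_add_left measurable_const, setLIntegral_const, lintegral_const_mul _ hMm]
        simp_rw [h1]
        rw [lintegral_add_left (by fun_prop), lintegral_mul_const _ (by fun_prop),
          lintegral_const_mul _ hMm, setLIntegral_const]
        ring

lemma measure_mul_oscIntegral_le {d : ℕ} {u : E d → ℝ} (hu : Measurable u) (A B D : Set (E d)) :
    volume B * oscIntegral u A D ≤
      volume D * oscIntegral u A B + volume A * oscIntegral u B D := by
  have hum : Measurable fun q : E d × E d => ‖u q.1 - u q.2‖ₑ := by fun_prop
  have hB : ∀ a : ℝ≥0∞, volume B * a = ∫⁻ _ in B, a := fun a => by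
    rw [setLIntegral_const, mul_comm]
  calc volume B * oscIntegral u A D
      = ∫⁻ x in A, ∫⁻ y in D, ∫⁻ _ in B, ‖u x - u y‖ₑ := by
        rw [oscIntegral, ← lintegral_const_mul _ hum.lintegral_prod_right']
        refine lintegral_congr fun x => ?_
        rw [← lintegral_const_mul _ (by fun_prop)]
        exact lintegral_congr fun y => hB _
    _ ≤ ∫⁻ x in A, ∫⁻ y in D, ((∫⁻ z in B, ‖u x - u z‖ₑ) + ∫⁻ z in B, ‖u z - u y‖ₑ) := by
        refine lintegral_mono fun x => lintegral_mono fun y => ?_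
        rw [← lintegral_add_left (by fun_prop)]
        refine lintegral_mono fun z => ?_
        have : u x - u y = (u x - u z) + (u z - u y) := by ring
        rw [this]
        exact enorm_add_le _ _
    _ = ∫⁻ x in A, (volume D * (∫⁻ z in B, ‖u x - u z‖ₑ) + oscIntegral u B D) := by
        refine lintegral_congr fun x => ?_
        rw [lintegral_add_left measurable_const, setLIntegral_const, mul_comm, oscIntegral,
          lintegral_lintegral_swap (f := fun y z => ‖u z - u y‖ₑ) (by fun_prop)]
    _ = _ := by
        rw [lintegral_add_right _ measurable_const, setLIntegral_const,
          lintegral_const_mul _ hum.lintegral_prod_right', mul_comm (oscIntegral u B D)]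
        rfl

/-- A Poincaré inequality in terms of the Hajłasz bound. -/
lemma exists_oscIntegral_le {d : ℕ} {Ω : Set (E d)} (hΩo : IsOpen Ω)
    (hΩb : Bornology.IsBounded Ω) (hΩc : IsPreconnected Ω) {r : ℝ} (hr : 0 < r) (C : ℝ≥0) :
    ∃ C' : ℝ≥0, ∀ (u : E d → ℝ) (M : E d → ℝ≥0∞), HajlaszBound Ω r C u M →
      oscIntegral u Ω Ω ≤ C' * ∫⁻ x in Ω, M x := by
  have hvol : volume Ω ≠ ⊤ := hΩb.measure_lt_top.ne
  set ρ := r / 4 with hρ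
  have hρ0 : 0 < ρ := by positivity
  set U : E d → Set (E d) := fun a => Ω ∩ Metric.ball a ρ with hU
  have hUo : ∀ a, IsOpen (U a) := fun a => hΩo.inter Metric.isOpen_ball
  have hUΩ : ∀ a, U a ⊆ Ω := fun a => inter_subset_left
  have hUt : ∀ a, volume (U a) ≠ ⊤ := fun a => measure_ne_top_of_subset (hUΩ a) hvol
  have hpair : ∀ a ∈ Ω, ∀ b ∈ Ω, ∃ C' : ℝ≥0, ∀ (u : E d → ℝ) (M : E d → ℝ≥0∞),
      HajlaszBound Ω r C u M → oscIntegral u (U a) (U b) ≤ C' * ∫⁻ x in Ω, M x := by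
    have hnear : ∀ a b, dist a b < ρ → ∃ C' : ℝ≥0, ∀ (u : E d → ℝ) (M : E d → ℝ≥0∞),
        HajlaszBound Ω r C u M → oscIntegral u (U a) (U b) ≤ C' * ∫⁻ x in Ω, M x := by
      intro a b hab
      refine ⟨(2 * C * ENNReal.ofReal r * volume Ω).toNNReal, fun u M h => ?_⟩
      rw [ENNReal.coe_toNNReal (by finiteness)]
      refine h.oscIntegral_le (hUΩ a) (hUΩ b) (hUo a).measurableSet
        (hUo b).measurableSet fun x hx y hy => ?_
      have h1 := hx.2
      have h2 := hy.2
      rw [Metric.mem_ball] at h1 h2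
      rw [dist_comm] at h2
      have := dist_triangle4 x a b y
      linarith
    intro a ha b hb
    refine hΩc.induction₂' (fun a b => ∃ C' : ℝ≥0, ∀ (u : E d → ℝ) (M : E d → ℝ≥0∞),
      HajlaszBound Ω r C u M → oscIntegral u (U a) (U b) ≤ C' * ∫⁻ x in Ω, M x) ?_ ?_ ha hb
    · intro x _
      filter_upwards [mem_nhdsWithin_of_mem_nhds (Metric.ball_mem_nhds x hρ0)] with y hy
      rw [Metric.mem_ball] at hy
      exact ⟨hnear x y (by rwa [dist_comm]), hnear y x hy⟩
    · rintro x y z - hy - ⟨C₁, h₁⟩ ⟨C₂, h₂⟩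
      have hy0 : volume (U y) ≠ 0 :=
        ((hUo y).measure_pos _ ⟨y, hy, Metric.mem_ball_self hρ0⟩).ne'
      refine ⟨((volume (U y))⁻¹ * (volume (U z) * C₁ + volume (U x) * C₂)).toNNReal,
        fun u M h => ?_⟩
      rw [ENNReal.coe_toNNReal (ENNReal.mul_ne_top (ENNReal.inv_ne_top.2 hy0)
        (by have := hUt z; have := hUt x; finiteness))]
      have h3 := measure_mul_oscIntegral_le h.measurable (U x) (U y) (U z)
      calc oscIntegral u (U x) (U z)
          = (volume (U y))⁻¹ * (volume (U y) * oscIntegral u (U x) (U z)) := by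
            rw [← mul_assoc, ENNReal.inv_mul_cancel hy0 (hUt y), one_mul]
        _ ≤ (volume (U y))⁻¹ * (volume (U z) * (C₁ * ∫⁻ x in Ω, M x) +
              volume (U x) * (C₂ * ∫⁻ x in Ω, M x)) := by
            gcongr
            refine h3.trans ?_
            gcongr
            exacts [h₁ u M h, h₂ u M h]
        _ = _ := by ring
  obtain ⟨t, htΩ, htf, hcov⟩ := Metric.finite_approx_of_totallyBounded
    (hΩb.isCompact_closure.totallyBounded.subset subset_closure) ρ hρ0
  choose! K hK using hpair
  have : Fintype t := htf.fintype
  refine ⟨∑ a : t, ∑ b : t, K a b, fun u M h => ?_⟩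
  have hres : volume.restrict Ω ≤ Measure.sum fun a : t => volume.restrict (U a) := by
    refine le_trans (Measure.restrict_mono (fun x hx => ?_) le_rfl) Measure.restrict_iUnion_le
    obtain ⟨a, ha, hxa⟩ := mem_iUnion₂.1 (hcov hx)
    exact mem_iUnion.2 ⟨⟨a, ha⟩, hx, hxa⟩
  have hsplit : ∀ f : E d → ℝ≥0∞, ∫⁻ x in Ω, f x ≤ ∑ a : t, ∫⁻ x in U a, f x := by
    intro f
    refine (lintegral_mono' hres le_rfl).trans ?_
    rw [lintegral_sum_measure, tsum_fintype]
  have hum : Measurable fun q : E d × E d => ‖u q.1 - u q.2‖ₑ := by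
    have := h.measurable; fun_prop
  calc oscIntegral u Ω Ω ≤ ∑ a : t, ∫⁻ x in U a, ∑ b : t, ∫⁻ y in U b, ‖u x - u y‖ₑ := by
        refine (hsplit _).trans (Finset.sum_le_sum fun a _ => lintegral_mono fun x => hsplit _)
    _ = ∑ a : t, ∑ b : t, oscIntegral u (U a) (U b) := by
        refine Finset.sum_congr rfl fun a _ => ?_
        rw [lintegral_finsetSum _ fun b _ => hum.lintegral_prod_right']
        rfl
    _ ≤ ∑ a : t, ∑ b : t, K a b * ∫⁻ x in Ω, M x := by
        gcongr with a _ b _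
        exact hK a (htΩ a.2) b (htΩ b.2) u M h
    _ = _ := by
        push_cast
        simp_rw [Finset.sum_mul]

lemma exists_measurable_zero_off {d : ℕ} {F : Type*} [NormedAddCommGroup F] [MeasurableSpace F]
    [BorelSpace F] {Ω : Set (E d)} (hΩ : MeasurableSet Ω) {u : E d → F}
    (hu : AEStronglyMeasurable u (volume.restrict Ω)) :
    ∃ u' : E d → F, Measurable u' ∧ (∀ x ∉ Ω, u' x = 0) ∧ u =ᵐ[volume.restrict Ω] u' := by
  refine ⟨Ω.indicator (hu.mk u), hu.stronglyMeasurable_mk.measurable.indicator hΩ,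
    fun x hx => indicator_of_notMem hx _, ?_⟩
  filter_upwards [hu.ae_eq_mk, ae_restrict_mem hΩ] with x hx hxΩ
  rw [indicator_of_mem hxΩ, hx]

lemma integrable_of_memLp_restrict {d : ℕ} {F : Type*} [NormedAddCommGroup F] {Ω : Set (E d)}
    (hΩ : volume Ω ≠ ⊤) {u : E d → F} (hu0 : ∀ x ∉ Ω, u x = 0) {p : ℝ≥0∞} (hp : 1 ≤ p)
    (hu : MemLp u p (volume.restrict Ω)) : Integrable u := by
  have : IsFiniteMeasure (volume.restrict Ω) := ⟨by simpa using hΩ.lt_top⟩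
  refine (integrableOn_iff_integrable_of_support_subset fun x hx => ?_).1 (hu.integrable hp)
  by_contra h
  exact hx (hu0 x h)

lemma HasWeakGradient.congr {d : ℕ} {Ω : Set (E d)} {u u' : E d → ℝ} {g g' : E d → E d}
    (h : HasWeakGradient Ω u g) (hu : u =ᵐ[volume.restrict Ω] u')
    (hg : g =ᵐ[volume.restrict Ω] g') (hu' : Integrable u') (hg' : Integrable g') :
    HasWeakGradient Ω u' g' where
  locallyIntegrableOn := hu'.locallyIntegrable.locallyIntegrableOn _
  locallyIntegrableOn_gradient := hg'.locallyIntegrable.locallyIntegrableOn _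
  integral_eq ψ hψ hc hs v := by
    have h1 := h.integral_eq ψ hψ hc hs v
    have h2 : ∫ x in Ω, u x * fderiv ℝ ψ x v = ∫ x in Ω, u' x * fderiv ℝ ψ x v :=
      integral_congr_ae (by filter_upwards [hu] with x hx; rw [hx])
    have h3 : ∫ x in Ω, ⟪g x, v⟫_ℝ * ψ x = ∫ x in Ω, ⟪g' x, v⟫_ℝ * ψ x :=
      integral_congr_ae (by filter_upwards [hg] with x hx; rw [hx])
    rw [← h2, ← h3, h1]

lemma lamScaled_congr {d : ℕ} {φ : ℝ → ℝ} {Ω : Set (E d)} {u u' : E d → ℝ}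
    (hu : u =ᵐ[volume.restrict Ω] u') (δ : ℝ) : LamScaled φ Ω δ u = LamScaled φ Ω δ u' := by
  unfold LamScaled Lam
  congr 1
  refine lintegral_congr_ae ?_
  filter_upwards [hu] with x hx
  refine lintegral_congr_ae ?_
  filter_upwards [hu] with y hy
  rw [hx, hy]

lemma HasWeakGradient.integrableOn_smul {d : ℕ} {Ω : Set (E d)} {u : E d → ℝ} {g : E d → E d}
    (h : HasWeakGradient Ω u g) {ψ : E d → ℝ} (hψ : Continuous ψ) (hc : HasCompactSupport ψ)
    (hs : tsupport ψ ⊆ Ω) : Integrable fun x => ψ x • g x := by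
  have h1 : IntegrableOn (fun x => ψ x • g x) (tsupport ψ) :=
    IntegrableOn.continuousOn_smul_of_subset hψ.continuousOn
      (h.locallyIntegrableOn_gradient.integrableOn_compact_subset hs hc) hc
      (isClosed_tsupport ψ).measurableSet subset_rfl
  refine (integrableOn_iff_integrable_of_support_subset fun x hx => ?_).1 h1
  by_contra hx'
  exact hx (by simp [image_eq_zero_of_notMem_tsupport hx'])

/-- Weak gradients are unique almost everywhere. -/
lemma HasWeakGradient.ae_eq {d : ℕ} {Ω : Set (E d)} (hΩ : IsOpen Ω) {u : E d → ℝ}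
    {g g' : E d → E d} (h : HasWeakGradient Ω u g) (h' : HasWeakGradient Ω u g') :
    g =ᵐ[volume.restrict Ω] g' := by
  have key : ∀ᵐ x, x ∈ Ω → (g - g') x = 0 := by
    refine hΩ.ae_eq_zero_of_integral_contDiff_smul_eq_zero
      (h.locallyIntegrableOn_gradient.sub h'.locallyIntegrableOn_gradient) fun ψ hψ hc hs => ?_
    have hi := h.integrableOn_smul hψ.continuous hc hs
    have hi' := h'.integrableOn_smul hψ.continuous hc hs
    have hfull : ∀ G : E d → E d, ∀ v, ∫ x in Ω, ⟪G x, v⟫_ℝ * ψ x = ∫ x, ⟪v, ψ x • G x⟫_ℝ := by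
      intro G v
      rw [setIntegral_eq_integral_of_forall_compl_eq_zero]
      · refine integral_congr_ae (Eventually.of_forall fun x => ?_)
        simp only [inner_smul_right, real_inner_comm]
        rw [mul_comm]
      · intro x hx
        rw [image_eq_zero_of_notMem_tsupport fun hx' => hx (hs hx'), mul_zero]
    have hv : ∀ v, ⟪v, ∫ x, ψ x • g x⟫_ℝ = ⟪v, ∫ x, ψ x • g' x⟫_ℝ := by
      intro v
      have h1 := h.integral_eq ψ hψ hc hs v
      rw [h'.integral_eq ψ hψ hc hs v, neg_inj, hfull, hfull, integral_inner hi,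
        integral_inner hi'] at h1
      exact h1.symm
    simp only [Pi.sub_apply, smul_sub]
    rw [integral_sub hi hi', sub_eq_zero]
    exact ext_inner_left ℝ hv
  refine (ae_restrict_iff' hΩ.measurableSet).2 ?_
  filter_upwards [key] with x hx hxΩ
  exact sub_eq_zero.1 (hx hxΩ)

lemma exists_one_lt_rpow {p : ℝ≥0∞} (hp : 1 < p) :
    ∃ q : ℝ, 1 < q ∧ ENNReal.ofReal q ≤ p := by
  refine ⟨(min p 2).toReal, ?_, ?_⟩
  · rw [← ENNReal.toReal_one, ENNReal.toReal_lt_toReal ENNReal.one_ne_top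
      (ne_top_of_le_ne_top ENNReal.ofNat_ne_top (min_le_right p 2))]
    exact lt_min hp ENNReal.one_lt_two
  · rw [ENNReal.ofReal_toReal (ne_top_of_le_ne_top ENNReal.ofNat_ne_top (min_le_right p 2))]
    exact min_le_left _ _

lemma eLpNorm_ofReal_eq {d : ℕ} {q : ℝ} (hq : 1 < q) (g : E d → E d) (μ : Measure (E d)) :
    eLpNorm g (ENNReal.ofReal q) μ = (∫⁻ x, ‖g x‖ₑ ^ q ∂μ) ^ q⁻¹ := by
  have hq0 : 0 < q := zero_lt_one.trans hq
  rw [eLpNorm_eq_lintegral_rpow_enorm_toReal (by simpa using hq0) ENNReal.ofReal_ne_top,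
    ENNReal.toReal_ofReal hq0.le, one_div]

lemma exists_setLIntegral_maxFun_le_eLpNorm {d : ℕ} (hd : 1 ≤ d) {p : ℝ≥0∞} (hp : 1 < p)
    {Ω : Set (E d)} (hΩ : volume Ω ≠ ⊤) :
    ∃ C : ℝ≥0, ∀ g : E d → E d, Measurable g → (∀ x ∉ Ω, g x = 0) →
      ∫⁻ x in Ω, maxFun (fun z => ‖g z‖ₑ) x ≤ C * eLpNorm g p (volume.restrict Ω) := by
  obtain ⟨q, hq, hqp⟩ := exists_one_lt_rpow hp
  have hq0 : 0 < q := zero_lt_one.trans hq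
  obtain ⟨C, hC⟩ := exists_setLIntegral_maxFun_le hd hq hΩ
  set c : ℝ≥0∞ := volume Ω ^ (1 / q - 1 / p.toReal) with hc
  have hct : c ≠ ⊤ := by
    refine ENNReal.rpow_ne_top_of_nonneg ?_ hΩ
    rcases eq_or_ne p ⊤ with rfl | hpt
    · simp [hq0.le]
    · have : q ≤ p.toReal := by rwa [← ENNReal.ofReal_le_iff_le_toReal hpt]
      exact sub_nonneg.2 (one_div_le_one_div_of_le hq0 this)
  refine ⟨C * c.toNNReal, fun g hg hg0 => ?_⟩
  have h1 := hC (fun z => ‖g z‖ₑ) hg.enorm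
  have h2 : ∫⁻ x, ‖g x‖ₑ ^ q = ∫⁻ x in Ω, ‖g x‖ₑ ^ q := by
    refine (setLIntegral_eq_of_support_subset fun x hx => ?_).symm
    by_contra hx'
    exact hx (by simp [hg0 x hx', hq0])
  rw [h2, ← eLpNorm_ofReal_eq hq] at h1
  refine h1.trans ?_
  have h3 := eLpNorm_le_eLpNorm_mul_rpow_measure_univ hqp
    (hg.aestronglyMeasurable (μ := volume.restrict Ω))
  rw [ENNReal.toReal_ofReal hq0.le, Measure.restrict_apply_univ, ← hc] at h3
  rw [ENNReal.coe_mul, ENNReal.coe_toNNReal hct]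
  calc _ ≤ C * (eLpNorm g p (volume.restrict Ω) * c) := by gcongr
    _ = _ := by ring

lemma exists_hajlaszBound {d : ℕ} {Ω : Set (E d)} (hΩo : IsOpen Ω)
    (hΩb : Bornology.IsBounded Ω) (hΩ : HasSmoothBoundary Ω) :
    ∃ r : ℝ, 0 < r ∧ ∃ C : ℝ≥0, ∀ (u : E d → ℝ) (g : E d → E d), HasWeakGradient Ω u g →
      Integrable u → Integrable g → Measurable u → Measurable g →
        HajlaszBound Ω r C u (maxFun fun z => ‖g z‖ₑ) := by
  obtain ⟨r, hr, K, hK, hsee⟩ := exists_seeCommonBall hΩo hΩb hΩ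
  obtain ⟨C, hC⟩ := exists_enorm_sub_le_maxFun d hK
  refine ⟨r, hr, C, fun u g h hu hg hum hgm => ⟨hum, measurable_maxFun hgm.enorm, ?_⟩⟩
  obtain ⟨S, hS, hS'⟩ := hC Ω hΩo u g h hu hg hum hgm
  exact ⟨S, hS, fun x hx y hy hxy => hS' x hx.2 y hy.2 (hsee x hx.1 y hy.1 hxy)⟩

/-- The uniform bound for normalized representatives. -/
lemma exists_lamScaled_le {d : ℕ} (hd : 1 ≤ d) {Ω : Set (E d)} (hΩo : IsOpen Ω)
    (hΩb : Bornology.IsBounded Ω) (hΩ : HasSmoothBoundary Ω) (hΩc : IsConnected Ω) {p : ℝ≥0∞}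
    (hp : 1 < p) : ∃ C : ℝ≥0, ∀ φ : ℝ → ℝ, MemClassA d φ → ∀ (u : E d → ℝ) (g : E d → E d),
      HasWeakGradient Ω u g → Integrable u → Integrable g → Measurable u → Measurable g →
      (∀ x ∉ Ω, g x = 0) → eLpNorm g p (volume.restrict Ω) ≠ ⊤ → ∀ δ : ℝ, 0 < δ →
        LamScaled φ Ω δ u ≤ C * eLpNorm g p (volume.restrict Ω) := by
  have hvol : volume Ω ≠ ⊤ := hΩb.measure_lt_top.ne
  obtain ⟨r, hr, C₁, hC₁⟩ := exists_hajlaszBound hΩo hΩb hΩ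
  obtain ⟨C₂, hC₂⟩ := exists_oscIntegral_le hΩo hΩb hΩc.isPreconnected hr C₁
  obtain ⟨C₃, hC₃⟩ := exists_setLIntegral_maxFun_le_eLpNorm hd hp hvol
  obtain ⟨κ, hκ⟩ := exists_invSqIntegral_eq hd
  set A := (sphereArea d).toNNReal with hA
  have hA' : sphereArea d = A := (ENNReal.coe_toNNReal (sphereArea_ne_top d)).symm
  set k := ((r ^ (d + 1))⁻¹).toNNReal with hk
  refine ⟨(2 * C₁ * (A * κ) * 2 + κ * k * C₂) * C₃, fun φ hφ u g h hu hg hum hgm hg0 hgp δ hδ => ?_⟩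
  have hH := hC₁ u g h hu hg hum hgm
  have hM := hC₃ g hgm hg0
  set I := ∫⁻ x in Ω, maxFun (fun z => ‖g z‖ₑ) x with hI
  have hIt : I ≠ ⊤ := ne_top_of_le_ne_top (by finiteness) hM
  have hm := hΩo.measurableSet
  calc LamScaled φ Ω δ u ≤ nearEnergy φ Ω Ω r δ u + farEnergy φ Ω r δ u :=
        lamScaled_le_near_add_far hφ hm hum r δ
    _ ≤ 2 * C₁ * (A * κ) * (I + I) + κ * k * (C₂ * I) := by
        refine add_le_add ?_ ?_
        · have := nearEnergy_le hd hφ subset_rfl subset_rfl hm hm hH hIt hIt hδ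
          rwa [hκ φ hφ, hA'] at this
        · have := farEnergy_le_lintegral_enorm_sub hφ hm hr hδ hum
          rw [hκ φ hφ] at this
          refine this.trans (mul_le_mul' le_rfl (hC₂ u _ hH))
    _ = ((2 * C₁ * (A * κ) * 2 + κ * k * C₂ : ℝ≥0) : ℝ≥0∞) * I := by push_cast; ring
    _ ≤ _ := by
        rw [ENNReal.coe_mul _ C₃, mul_assoc _ (C₃ : ℝ≥0∞)]
        exact mul_le_mul' le_rfl hM

lemma kern_smul {d : ℕ} {t : ℝ} (ht : 0 < t) (z : E d) :
    kern d (t • z) = ENNReal.ofReal ((t ^ (d + 1))⁻¹) * kern d z := by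
  rw [kern, kern, ← ENNReal.ofReal_mul (by positivity), norm_smul, Real.norm_eq_abs,
    abs_of_pos ht, mul_pow, mul_inv]

/-- Rescaling of the inner integral in `nearEnergy`. -/
lemma ofReal_mul_setLIntegral_ball_eq {d : ℕ} {φ : ℝ → ℝ} (h : MemClassA d φ) {w : E d → ℝ}
    (hw : Measurable w) (x : E d) (r : ℝ) {δ : ℝ} (hδ : 0 < δ) :
    ENNReal.ofReal δ * ∫⁻ y in Metric.ball x r, prof φ ((w x - w y) / δ) * kern d (x - y) =
      ∫⁻ z, (Metric.ball (0 : E d) (r / δ)).indicator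
        (fun z => prof φ ((w x - w (x + δ • z)) / δ) * kern d z) z := by
  have hm := measurable_prof h
  have hk := measurable_kern d
  set F : E d → ℝ≥0∞ := (Metric.ball x r).indicator
    fun y => prof φ ((w x - w y) / δ) * kern d (x - y) with hF
  have hFm : Measurable F := Measurable.indicator (by fun_prop) measurableSet_ball
  have hsc := lintegral_comp_add_smul hFm x hδ
  have hpt : ∀ z, F (x + δ • z) = ENNReal.ofReal ((δ ^ (d + 1))⁻¹) *
      (Metric.ball (0 : E d) (r / δ)).indicator
        (fun z => prof φ ((w x - w (x + δ • z)) / δ) * kern d z) z := by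
    intro z
    have hmem : x + δ • z ∈ Metric.ball x r ↔ z ∈ Metric.ball (0 : E d) (r / δ) := by
      rw [Metric.mem_ball, mem_ball_zero_iff, dist_eq_norm, add_sub_cancel_left, norm_smul,
        Real.norm_eq_abs, abs_of_pos hδ, lt_div_iff₀ hδ, mul_comm]
    by_cases hz : z ∈ Metric.ball (0 : E d) (r / δ)
    · rw [hF, indicator_of_mem hz, indicator_of_mem (hmem.2 hz), sub_add_cancel_left, kern_neg,
        kern_smul hδ]
      ring
    · rw [hF, indicator_of_notMem hz, indicator_of_notMem (hmem.not.2 hz), mul_zero]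
  simp_rw [hpt] at hsc
  rw [lintegral_const_mul' _ _ ENNReal.ofReal_ne_top] at hsc
  rw [← lintegral_indicator measurableSet_ball, ← hF]
  have h1 : ∀ a : ℝ≥0∞, ENNReal.ofReal (δ ^ (d + 1)) * (ENNReal.ofReal ((δ ^ (d + 1))⁻¹) * a) = a := by
    intro a
    rw [← mul_assoc, ← ENNReal.ofReal_mul (by positivity), mul_inv_cancel₀ (by positivity),
      ENNReal.ofReal_one, one_mul]
  refine Eq.trans ?_ (h1 _)
  rw [hsc, ← mul_assoc, ← ENNReal.ofReal_mul (by positivity)]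
  congr 2
  field_simp
  ring

lemma tendsto_difference_quotient {d : ℕ} {w : E d → ℝ} {x : E d} {L : E d →L[ℝ] ℝ}
    (hw : HasFDerivAt w L x) (z : E d) :
    Tendsto (fun δ : ℝ => (w x - w (x + δ • z)) / δ) (𝓝[>] 0) (𝓝 (-(L z))) := by
  have h1 : HasDerivAt (fun t : ℝ => w (x + t • z)) (L z) 0 := by
    have h2 : HasDerivAt (fun t : ℝ => x + t • z) z 0 := by
      simpa using ((hasDerivAt_id (0 : ℝ)).smul_const z).const_add x
    have h3 : HasFDerivAt w L (x + (0 : ℝ) • z) := by simpa using hw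
    exact h3.comp_hasDerivAt 0 h2
  have h2 := (hasDerivAt_iff_tendsto_slope_zero.1 h1).mono_left
    (nhdsWithin_mono _ fun t (ht : t ∈ Ioi (0 : ℝ)) => ne_of_gt ht)
  refine h2.neg.congr fun t => ?_
  simp only [zero_add, zero_smul, add_zero, smul_eq_mul]
  ring

lemma toDual_symm_enorm {d : ℕ} (L : E d →L[ℝ] ℝ) :
    ‖(InnerProductSpace.toDual ℝ (E d)).symm L‖ₑ = ‖L‖ₑ := by
  rw [← ofReal_norm, ← ofReal_norm, LinearIsometryEquiv.norm_map]

/-- The limit of the localized functional for a `C¹` function. -/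
lemma tendsto_nearEnergy_of_contDiff {d : ℕ} (hd : 1 ≤ d) {φ : ℝ → ℝ} (h : MemClassA d φ)
    {w : E d → ℝ} (hw : ContDiff ℝ 1 w) {K B : Set (E d)} (hK : IsCompact K) {r : ℝ} (hr : 0 < r)
    (hB : ∀ x ∈ K, Metric.ball x r ⊆ B) :
    Tendsto (fun δ => nearEnergy φ K B r δ w) (𝓝[>] 0) (𝓝 (∫⁻ x in K, ‖fderiv ℝ w x‖ₑ)) := by
  have hm := measurable_prof h
  have hk := measurable_kern d
  have hwm : Measurable w := hw.continuous.measurable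
  obtain ⟨L, hL⟩ : ∃ L : ℝ, ∀ x ∈ Metric.cthickening r K, ‖fderiv ℝ w x‖ ≤ L :=
    hK.cthickening.exists_bound_of_continuousOn (hw.continuous_fderiv one_ne_zero).continuousOn
  set L' := max L 0
  have hL' : ∀ x ∈ K, ∀ y ∈ Metric.ball x r, |w x - w y| ≤ L' * ‖y - x‖ := by
    intro x hx y hy
    have := (convex_ball x r).norm_image_sub_le_of_norm_fderiv_le (f := w) (𝕜 := ℝ) (C := L')
      (fun p _ => hw.differentiable one_ne_zero p)
      (fun p hp => (hL p (Metric.closedBall_subset_cthickening hx r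
        (Metric.ball_subset_closedBall hp))).trans (le_max_left _ _))
      (Metric.mem_ball_self hr) hy
    rwa [Real.norm_eq_abs, abs_sub_comm] at this
  obtain ⟨κ, hκ⟩ := exists_invSqIntegral_eq hd
  have hfin : ∫⁻ z, prof φ (L' * ‖z‖) * kern d z ≠ ⊤ := by
    rw [lintegral_norm_mul_kern hd hm (prof_zero h) (le_max_right _ _), hκ φ h]
    have := sphereArea_ne_top d
    finiteness
  set D := ∫⁻ z, prof φ (L' * ‖z‖) * kern d z with hD
  set N : ℝ → E d → ℝ≥0∞ := fun δ x => ENNReal.ofReal δ *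
    ∫⁻ y in univ ∩ Metric.ball x r, prof φ ((w x - w y) / δ) * kern d (x - y) with hN
  have hNm : ∀ δ, Measurable (N δ) := fun δ =>
    (measurable_setLIntegral_inter_ball (measurable_energy_integrand h hwm δ)
      MeasurableSet.univ r).const_mul _
  have hNeq : ∀ δ, 0 < δ → ∀ x, N δ x = ∫⁻ z, (Metric.ball (0 : E d) (r / δ)).indicator
        (fun z => prof φ ((w x - w (x + δ • z)) / δ) * kern d z) z := by
    intro δ hδ x
    simp only [hN, univ_inter]
    exact ofReal_mul_setLIntegral_ball_eq h hwm x r hδ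
  have hdom : ∀ δ, 0 < δ → ∀ x ∈ K, ∀ z, (Metric.ball (0 : E d) (r / δ)).indicator
        (fun z => prof φ ((w x - w (x + δ • z)) / δ) * kern d z) z ≤
          prof φ (L' * ‖z‖) * kern d z := by
    intro δ hδ x hx z
    by_cases hz : z ∈ Metric.ball (0 : E d) (r / δ)
    swap
    · rw [indicator_of_notMem hz]; exact bot_le
    rw [indicator_of_mem hz]
    gcongr
    refine prof_le_prof h ?_
    have hmem : x + δ • z ∈ Metric.ball x r := by
      rw [mem_ball_zero_iff, lt_div_iff₀ hδ] at hz
      rwa [Metric.mem_ball, dist_eq_norm, add_sub_cancel_left, norm_smul, Real.norm_eq_abs,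
        abs_of_pos hδ, mul_comm]
    have := hL' x hx _ hmem
    rw [add_sub_cancel_left, norm_smul, Real.norm_eq_abs, abs_of_pos hδ] at this
    rw [abs_div, abs_of_pos hδ, div_le_iff₀ hδ, abs_of_nonneg (a := L' * ‖z‖) (by positivity)]
    linarith
  have hpos : ∀ᶠ δ : ℝ in 𝓝[>] 0, 0 < δ := self_mem_nhdsWithin
  have hlim : ∀ x ∈ K, Tendsto (fun δ => N δ x) (𝓝[>] 0) (𝓝 ‖fderiv ℝ w x‖ₑ) := by
    intro x hx
    set a := (InnerProductSpace.toDual ℝ (E d)).symm (-fderiv ℝ w x) with ha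
    have hae : ∀ z, -(fderiv ℝ w x z) = ⟪z, a⟫_ℝ := by
      intro z
      rw [ha, real_inner_comm, InnerProductSpace.toDual_symm_apply]
      rfl
    have hval : ‖fderiv ℝ w x‖ₑ = ∫⁻ z, prof φ ⟪z, a⟫_ℝ * kern d z := by
      rw [lintegral_prof_inner_mul_kern hd h, ha, toDual_symm_enorm, enorm_neg]
    rw [hval]
    refine (tendsto_lintegral_filter_of_dominated_convergence
      (F := fun δ z => (Metric.ball (0 : E d) (r / δ)).indicator
        (fun z => prof φ ((w x - w (x + δ • z)) / δ) * kern d z) z)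
      (fun z => prof φ (L' * ‖z‖) * kern d z) ?_ ?_ hfin ?_).congr' ?_
    · exact Eventually.of_forall fun δ => Measurable.indicator (by fun_prop) measurableSet_ball
    · filter_upwards [hpos] with δ hδ
      exact Eventually.of_forall fun z => hdom δ hδ x hx z
    · filter_upwards [ae_continuousAt_prof_inner h a] with z hz
      have h1 : Tendsto (fun δ : ℝ => prof φ ((w x - w (x + δ • z)) / δ) * kern d z) (𝓝[>] 0)
          (𝓝 (prof φ ⟪z, a⟫_ℝ * kern d z)) := by
        refine ENNReal.Tendsto.mul_const (hz.tendsto.comp ?_) (Or.inr (kern_ne_top d z))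
        rw [← hae z]
        exact tendsto_difference_quotient (hw.differentiable one_ne_zero x).hasFDerivAt z
      refine h1.congr' ?_
      have h2 : ∀ᶠ δ : ℝ in 𝓝[>] 0, δ * ‖z‖ < r := by
        have : Tendsto (fun δ : ℝ => δ * ‖z‖) (𝓝 0) (𝓝 0) := by
          simpa using (tendsto_id (x := 𝓝 (0 : ℝ))).mul_const ‖z‖
        exact (this.mono_left nhdsWithin_le_nhds).eventually_lt_const hr
      filter_upwards [hpos, h2] with δ hδ hz2
      rw [indicator_of_mem]
      rwa [mem_ball_zero_iff, lt_div_iff₀ hδ, mul_comm]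
    · filter_upwards [hpos] with δ hδ
      exact (hNeq δ hδ x).symm
  have hfinal := tendsto_lintegral_filter_of_dominated_convergence (μ := volume.restrict K)
    (l := 𝓝[>] (0 : ℝ)) (F := N) (f := fun x => ‖fderiv ℝ w x‖ₑ) (fun _ => D)
    (Eventually.of_forall hNm) ?_ ?_ ?_
  · refine hfinal.congr fun δ => ?_
    rw [nearEnergy, ← lintegral_const_mul' _ _ ENNReal.ofReal_ne_top]
    refine setLIntegral_congr_fun hK.measurableSet fun x hx => ?_
    simp only [hN, univ_inter, inter_eq_right.2 (hB x hx)]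
  · filter_upwards [hpos] with δ hδ
    refine (ae_restrict_iff' hK.measurableSet).2 (Eventually.of_forall fun x hx => ?_)
    rw [hNeq δ hδ x]
    exact lintegral_mono (hdom δ hδ x hx)
  · rw [setLIntegral_const]
    exact ENNReal.mul_ne_top hfin hK.measure_lt_top.ne
  · exact (ae_restrict_iff' hK.measurableSet).2 (Eventually.of_forall hlim)

lemma tendsto_of_eventually_le_add {ι : Type*} {l : Filter ι} {f : ι → ℝ≥0∞} {G : ℝ≥0∞}
    (hG : G ≠ ⊤) (h1 : ∀ η : ℝ≥0∞, 0 < η → ∀ᶠ i in l, f i ≤ G + η)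
    (h2 : ∀ η : ℝ≥0∞, 0 < η → ∀ᶠ i in l, G ≤ f i + η) : Tendsto f l (𝓝 G) := by
  refine (ENNReal.tendsto_nhds hG).2 fun η hη => ?_
  filter_upwards [h1 η hη, h2 η hη] with i hi1 hi2
  exact ⟨tsub_le_iff_right.2 hi2, hi1⟩

lemma HasWeakGradient.mollify {d : ℕ} {Ω Ω' : Set (E d)} {u : E d → ℝ} {g : E d → E d}
    (h : HasWeakGradient Ω u g) (hu : Integrable u) (hg : Integrable g) {n : ℕ}
    (hΩ' : ∀ w ∈ Ω', Metric.closedBall w (bump d n).rOut ⊆ Ω) :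
    HasWeakGradient Ω' (mollify n u) (mollify n g) where
  locallyIntegrableOn := (integrable_mollify hu n).locallyIntegrable.locallyIntegrableOn _
  locallyIntegrableOn_gradient :=
    (integrable_mollify hg n).locallyIntegrable.locallyIntegrableOn _
  integral_eq ψ hψ hc hs v := by
    set w := NonlocalTV.mollify n u with hw
    have hw1 : ContDiff ℝ 1 w := contDiff_mollify hu n
    have hψ1 : ContDiff ℝ 1 ψ := hψ.of_le (by exact_mod_cast le_top)
    have hw' : Continuous fun x => fderiv ℝ w x v :=
      (hw1.continuous_fderiv one_ne_zero).clm_apply continuous_const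
    have hψ' : Continuous fun x => fderiv ℝ ψ x v :=
      (hψ1.continuous_fderiv one_ne_zero).clm_apply continuous_const
    have hc' : HasCompactSupport fun x => fderiv ℝ ψ x v := hc.fderiv_apply ℝ v
    have hparts := integral_mul_fderiv_eq_neg_fderiv_mul_of_integrable (μ := volume)
      (f := w) (g := ψ) (v := v)
      ((hw'.mul hψ.continuous).integrable_of_hasCompactSupport hc.mul_left)
      ((hw1.continuous.mul hψ').integrable_of_hasCompactSupport hc'.mul_left)
      ((hw1.continuous.mul hψ.continuous).integrable_of_hasCompactSupport hc.mul_left)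
      (fun x _ => hw1.differentiable one_ne_zero x) (fun x _ => hψ1.differentiable one_ne_zero x)
    have h1 : ∫ x in Ω', w x * fderiv ℝ ψ x v = ∫ x, w x * fderiv ℝ ψ x v := by
      refine setIntegral_eq_integral_of_forall_compl_eq_zero fun x hx => ?_
      rw [image_eq_zero_of_notMem_tsupport (f := fderiv ℝ ψ)
        (fun h' => hx (hs (tsupport_fderiv_subset ℝ h')))]
      simp
    have h2 : ∫ x in Ω', ⟪NonlocalTV.mollify n g x, v⟫_ℝ * ψ x =
        ∫ x, ⟪NonlocalTV.mollify n g x, v⟫_ℝ * ψ x := by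
      refine setIntegral_eq_integral_of_forall_compl_eq_zero fun x hx => ?_
      rw [image_eq_zero_of_notMem_tsupport fun hx' => hx (hs hx'), mul_zero]
    rw [h1, h2, hparts]
    congr 1
    refine integral_congr_ae (Eventually.of_forall fun x => ?_)
    by_cases hx : x ∈ tsupport ψ
    · simp only [hw]
      rw [h.fderiv_mollify hu hg (hΩ' x (hs hx))]
    · simp [image_eq_zero_of_notMem_tsupport hx]

lemma HasWeakGradient.sub {d : ℕ} {Ω : Set (E d)} {u u' : E d → ℝ} {g g' : E d → E d}
    (h : HasWeakGradient Ω u g) (h' : HasWeakGradient Ω u' g') (hu : Integrable u)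
    (hu' : Integrable u') (hg : Integrable g) (hg' : Integrable g') :
    HasWeakGradient Ω (u - u') (g - g') where
  locallyIntegrableOn := h.locallyIntegrableOn.sub h'.locallyIntegrableOn
  locallyIntegrableOn_gradient :=
    h.locallyIntegrableOn_gradient.sub h'.locallyIntegrableOn_gradient
  integral_eq ψ hψ hc hs v := by
    have hψ1 : ContDiff ℝ 1 ψ := hψ.of_le (by exact_mod_cast le_top)
    have hψ' : Continuous fun x => fderiv ℝ ψ x v :=
      (hψ1.continuous_fderiv one_ne_zero).clm_apply continuous_const
    have hc' : HasCompactSupport fun x => fderiv ℝ ψ x v := hc.fderiv_apply ℝ v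
    have i1 : ∀ f : E d → ℝ, Integrable f → Integrable fun x => f x * fderiv ℝ ψ x v := by
      intro f hf
      simpa [mul_comm] using
        hf.locallyIntegrable.integrable_smul_left_of_hasCompactSupport hψ' hc'
    have i2 : ∀ f : E d → E d, Integrable f → Integrable fun x => ⟪f x, v⟫_ℝ * ψ x := by
      intro f hf
      refine ((hf.inner_const v).locallyIntegrable.integrable_smul_left_of_hasCompactSupport
        hψ.continuous hc).congr (Eventually.of_forall fun x => ?_)
      exact mul_comm (ψ x) _
    have h1 := h.integral_eq ψ hψ hc hs v
    have h2 := h'.integral_eq ψ hψ hc hs v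
    simp only [Pi.sub_apply, sub_mul, inner_sub_left]
    rw [integral_sub (i1 u hu).integrableOn (i1 u' hu').integrableOn,
      integral_sub (i2 g hg).integrableOn (i2 g' hg').integrableOn, h1, h2]
    ring

lemma ae_enorm_le_maxFun {d : ℕ} {g : E d → E d} (hg : Integrable g) :
    ∀ᵐ x, ‖g x‖ₑ ≤ ENNReal.ofReal (4 ^ d) * maxFun (fun y => ‖g y‖ₑ) x := by
  filter_upwards [ae_tendsto_mollify hg] with x hx
  exact le_of_tendsto' hx.enorm fun n =>
    (enorm_mollify_le n g x).trans (lmollify_le_maxFun n _ x)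

/-- Mollifications converge in `L^q` on sets of finite measure, for some `q > 1`. -/
lemma exists_tendsto_lintegral_sub_mollify {d : ℕ} (hd : 1 ≤ d) {g : E d → E d}
    (hg : Integrable g) (hgm : Measurable g) {p : ℝ} (hp : 1 < p) (hgp : ∫⁻ x, ‖g x‖ₑ ^ p ≠ ⊤)
    {D : Set (E d)} (hD : volume D ≠ ⊤) :
    ∃ q : ℝ, 1 < q ∧
      Tendsto (fun n => ∫⁻ x in D, ‖g x - mollify n g x‖ₑ ^ q) atTop (𝓝 0) := by
  set q := (1 + p) / 2 with hq
  have hq1 : 1 < q := by rw [hq]; linarith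
  have hq0 : 0 < q := by linarith
  have hpq : 1 < p / q := by rw [one_lt_div hq0, hq]; linarith
  refine ⟨q, hq1, ?_⟩
  obtain ⟨C, hC⟩ := exists_setLIntegral_maxFun_le hd hpq hD
  set c : ℝ≥0∞ := ENNReal.ofReal (4 ^ d) with hc
  set M := maxFun (fun y => ‖g y‖ₑ) with hM
  have hMm : Measurable M := measurable_maxFun hgm.enorm
  have hfin : ∫⁻ x in D, (2 * c * M x) ^ q ≠ ⊤ := by
    have h1 := hC (fun y => ‖g y‖ₑ ^ q) (hgm.enorm.pow_const q)
    have h2 : ∀ x, (‖g x‖ₑ ^ q) ^ (p / q) = ‖g x‖ₑ ^ p := fun x => by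
      rw [← ENNReal.rpow_mul, mul_div_cancel₀ _ hq0.ne']
    simp_rw [h2] at h1
    have h3 : ∫⁻ x in D, M x ^ q ≠ ⊤ := by
      refine ne_top_of_le_ne_top ?_ ((lintegral_mono fun x =>
        maxFun_rpow_le hgm.enorm hq1 x).trans h1)
      exact ENNReal.mul_ne_top ENNReal.coe_ne_top
        (ENNReal.rpow_ne_top_of_nonneg (by positivity) hgp)
    simp_rw [ENNReal.mul_rpow_of_nonneg _ _ hq0.le]
    rw [lintegral_const_mul _ (hMm.pow_const q)]
    refine ENNReal.mul_ne_top (ENNReal.mul_ne_top ?_ ?_) h3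
    · exact ENNReal.rpow_ne_top_of_nonneg hq0.le (by simp)
    · exact ENNReal.rpow_ne_top_of_nonneg hq0.le ENNReal.ofReal_ne_top
  have hlim := tendsto_lintegral_of_dominated_convergence (μ := volume.restrict D)
    (F := fun n x => ‖g x - mollify n g x‖ₑ ^ q) (f := fun _ => 0) (fun x => (2 * c * M x) ^ q)
    (fun n => ?_) (fun n => ?_) hfin ?_
  · simpa using hlim
  · have := (contDiff_mollify hg n (m := 0)).continuous.measurable
    fun_prop
  · refine ae_restrict_of_ae ?_
    filter_upwards [ae_enorm_le_maxFun hg] with x hx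
    refine ENNReal.rpow_le_rpow ?_ hq0.le
    calc ‖g x - mollify n g x‖ₑ ≤ ‖g x‖ₑ + ‖mollify n g x‖ₑ := enorm_sub_le
      _ ≤ c * M x + c * M x := add_le_add hx ((enorm_mollify_le n g x).trans
          (lmollify_le_maxFun n _ x))
      _ = _ := by ring
  · refine ae_restrict_of_ae ?_
    filter_upwards [ae_tendsto_mollify hg] with x hx
    have h1 : Tendsto (fun n => ‖g x - mollify n g x‖ₑ) atTop (𝓝 0) := by
      simpa using (hx.const_sub (g x)).enorm
    have h2 := ((ENNReal.continuous_rpow_const (y := q)).tendsto 0).comp h1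
    simpa [ENNReal.zero_rpow_of_pos hq0, Function.comp_def] using h2

lemma HajlaszBound.const_mul {d : ℕ} {Ω : Set (E d)} {r : ℝ} {C : ℝ≥0} {u : E d → ℝ}
    {M : E d → ℝ≥0∞} (h : HajlaszBound Ω r C u M) (a : ℝ) :
    HajlaszBound Ω r (‖a‖₊ * C) (fun x => a * u x) M where
  measurable := h.measurable.const_mul a
  measurable_bound := h.measurable_bound
  exists_set := by
    obtain ⟨S, hS, hb⟩ := h.exists_set
    refine ⟨S, hS, fun x hx y hy hxy => ?_⟩
    rw [← mul_sub, enorm_mul, ENNReal.coe_mul, mul_assoc (‖a‖₊ : ℝ≥0∞), mul_assoc (‖a‖₊ : ℝ≥0∞)]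
    exact mul_le_mul' le_rfl (hb x hx y hy hxy)

lemma nearEnergy_add_le {d : ℕ} {φ : ℝ → ℝ} (h : MemClassA d φ) {A B : Set (E d)}
    (hB : MeasurableSet B) (r δ : ℝ) {u v : E d → ℝ} (hu : Measurable u) {ε : ℝ} (h0 : 0 < ε)
    (h1 : ε < 1) : nearEnergy φ A B r δ (fun x => u x + v x) ≤
      nearEnergy φ A B r δ (fun x => (1 - ε)⁻¹ * u x) +
        nearEnergy φ A B r δ (fun x => ε⁻¹ * v x) := by
  have hum : Measurable fun x => (1 - ε)⁻¹ * u x := hu.const_mul _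
  have hm := measurable_energy_integrand h hum δ
  rw [nearEnergy, nearEnergy, nearEnergy, ← mul_add, ← lintegral_add_left
    (measurable_setLIntegral_inter_ball hm hB r)]
  refine mul_le_mul' le_rfl (lintegral_mono fun x => ?_)
  have hmx : Measurable fun y =>
      prof φ (((1 - ε)⁻¹ * u x - (1 - ε)⁻¹ * u y) / δ) * kern d (x - y) := by
    have := measurable_prof h
    have := measurable_kern d
    fun_prop
  dsimp only
  rw [← lintegral_add_left hmx]
  refine lintegral_mono fun y => ?_
  rw [← add_mul]
  refine mul_le_mul' ?_ le_rfl
  have e1 : (u x + v x - (u y + v y)) / δ = (u x - u y) / δ + (v x - v y) / δ := by ring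
  have e2 : ((1 - ε)⁻¹ * u x - (1 - ε)⁻¹ * u y) / δ = (u x - u y) / δ / (1 - ε) := by ring
  have e3 : (ε⁻¹ * v x - ε⁻¹ * v y) / δ = (v x - v y) / δ / ε := by ring
  rw [e1, e2, e3]
  exact prof_add_le h h0 h1 _ _

/-- Convergence of the localized functional for Sobolev functions. -/
lemma exists_tendsto_nearEnergy {d : ℕ} (hd : 1 ≤ d) {φ : ℝ → ℝ} (hφ : MemClassA d φ)
    {Ω : Set (E d)} (hΩ : IsOpen Ω) {u : E d → ℝ} {g : E d → E d} (h : HasWeakGradient Ω u g)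
    (hu : Integrable u) (hg : Integrable g) (hum : Measurable u) (hgm : Measurable g) {p : ℝ}
    (hp : 1 < p) (hgp : ∫⁻ x, ‖g x‖ₑ ^ p ≠ ⊤) {K : Set (E d)} (hK : IsCompact K) (hKΩ : K ⊆ Ω) :
    ∃ r₀ : ℝ, 0 < r₀ ∧ ∀ r : ℝ, 0 < r → r ≤ r₀ →
      Tendsto (fun δ => nearEnergy φ K Ω r δ u) (𝓝[>] 0) (𝓝 (∫⁻ x in K, ‖g x‖ₑ)) := by
  obtain ⟨ρ₂, hρ₂, hρΩ⟩ := hK.exists_cthickening_subset_open hΩ hKΩ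
  set ρ := ρ₂ / 2 with hρ
  have hρ0 : 0 < ρ := by positivity
  set Ω' := Metric.thickening ρ K with hΩ'
  set U := Metric.thickening (ρ / 4) K with hU
  have hKb : Bornology.IsBounded K := hK.isBounded
  have hUΩ' : U ⊆ Ω' := Metric.thickening_mono (by linarith) K
  have hΩ'Ω : Ω' ⊆ Ω := (Metric.thickening_subset_cthickening ρ K).trans
    ((Metric.cthickening_mono (by linarith) K).trans hρΩ)
  have hKU : K ⊆ U := Metric.self_subset_thickening (by positivity) K
  have hΩ'o : IsOpen Ω' := Metric.isOpen_thickening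
  have hUm : MeasurableSet U := Metric.isOpen_thickening.measurableSet
  have hΩ'vol : volume Ω' ≠ ⊤ := hKb.thickening.measure_lt_top.ne
  have hUvol : volume U ≠ ⊤ := measure_ne_top_of_subset hUΩ' hΩ'vol
  obtain ⟨q, hq, hlimq⟩ := exists_tendsto_lintegral_sub_mollify hd hg hgm hp hgp hΩ'vol
  have hq0 : 0 < q := zero_lt_one.trans hq
  obtain ⟨C, hC⟩ := exists_setLIntegral_maxFun_le hd hq hUvol
  obtain ⟨C₁, hC₁⟩ := exists_enorm_sub_le_maxFun d (zero_le_one (α := ℝ))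
  set γ : ℕ → E d → E d := fun n => Ω'.indicator (g - mollify n g) with hγ
  have hgn : ∀ n, Measurable (mollify n g) := fun n =>
    (contDiff_mollify hg n (m := 0)).continuous.measurable
  have hun : ∀ n, Measurable (mollify n u) := fun n =>
    (contDiff_mollify hu n (m := 0)).continuous.measurable
  have hγm : ∀ n, Measurable (γ n) := fun n =>
    (hgm.sub (hgn n)).indicator hΩ'o.measurableSet
  have hγi : ∀ n, Integrable (γ n) := fun n =>
    (hg.sub (integrable_mollify hg n)).indicator hΩ'o.measurableSet
  set M : ℕ → E d → ℝ≥0∞ := fun n => maxFun fun y => ‖γ n y‖ₑ with hM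
  set e : ℕ → ℝ≥0∞ := fun n => ∫⁻ x in U, M n x with he
  -- the error tends to zero
  have he0 : Tendsto e atTop (𝓝 0) := by
    have h1 : ∀ n, ∫⁻ x, ‖γ n x‖ₑ ^ q = ∫⁻ x in Ω', ‖g x - mollify n g x‖ₑ ^ q := by
      intro n
      rw [← lintegral_indicator hΩ'o.measurableSet]
      refine lintegral_congr fun x => ?_
      by_cases hx : x ∈ Ω'
      · simp [hγ, hx]
      · simp [hγ, hx, hq0]
    have h2 : Tendsto (fun n => C * (∫⁻ x, ‖γ n x‖ₑ ^ q) ^ q⁻¹) atTop (𝓝 0) := by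
      simp_rw [h1]
      have h3 := ((ENNReal.continuous_rpow_const (y := q⁻¹)).tendsto 0).comp hlimq
      rw [ENNReal.zero_rpow_of_pos (inv_pos.2 hq0)] at h3
      simpa using ENNReal.Tendsto.const_mul (a := C) h3 (Or.inr ENNReal.coe_ne_top)
    exact tendsto_of_tendsto_of_tendsto_of_le_of_le tendsto_const_nhds h2 (fun _ => bot_le)
      fun n => hC _ (hγm n).enorm
  -- facts valid for small mollification radius
  have hrad : ∀ᶠ n in atTop, (bump d n).rOut < ρ := (tendsto_bump_rOut d).eventually_lt_const hρ0
  have hball : ∀ n, (bump d n).rOut < ρ → ∀ w ∈ Ω', Metric.closedBall w (bump d n).rOut ⊆ Ω := by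
    intro n hn w hw
    refine subset_trans ?_ hρΩ
    obtain ⟨z, hz, hwz⟩ := Metric.mem_thickening_iff.1 hw
    refine subset_trans ?_ (Metric.closedBall_subset_cthickening hz ρ₂)
    refine Metric.closedBall_subset_closedBall' ?_
    rw [hρ] at hn hwz; linarith
  have hHaj : ∀ n, (bump d n).rOut < ρ →
      HajlaszBound U (ρ / 8) C₁ (fun x => u x - mollify n u x) (M n) := by
    intro n hn
    have hw1 := h.mollify hu hg (hball n hn)
    have hw2 := (h.mono hΩ.measurableSet hΩ'Ω).sub hw1 hu (integrable_mollify hu n) hg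
      (integrable_mollify hg n)
    have hw3 : HasWeakGradient Ω' (u - mollify n u) (γ n) := by
      refine hw2.congr EventuallyEq.rfl ?_ (hu.sub (integrable_mollify hu n)) (hγi n)
      filter_upwards [ae_restrict_mem hΩ'o.measurableSet] with x hx
      simp [hγ, hx]
    obtain ⟨S, hS, hS'⟩ := hC₁ Ω' hΩ'o _ _ hw3 (hu.sub (integrable_mollify hu n)) (hγi n)
      (hum.sub (hun n)) (hγm n)
    refine ⟨hum.sub (hun n), measurable_maxFun (hγm n).enorm, S, hS, fun x hx y hy hxy => ?_⟩
    refine hS' x hx.2 y hy.2 ?_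
    obtain ⟨z, hz, hxz⟩ := Metric.mem_thickening_iff.1 hx.1
    have hsub : Metric.ball x (ρ / 2) ⊆ Ω' := by
      intro w hw
      rw [Metric.mem_ball] at hw
      exact Metric.mem_thickening_iff.2 ⟨z, hz, by linarith [dist_triangle w x z]⟩
    refine seeCommonBall_of_ball_subset hsub (Metric.mem_ball_self (by positivity)) ?_
    rw [Metric.mem_ball, dist_comm]; linarith
  refine ⟨ρ / 8, by positivity, fun r hr hrρ => ?_⟩
  have hBall : ∀ x ∈ K, Metric.ball x r ⊆ U := fun x hx y hy =>
    Metric.mem_thickening_iff.2 ⟨x, hx, by rw [Metric.mem_ball] at hy; linarith⟩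
  have hNeq : ∀ δ v, nearEnergy φ K Ω r δ v = nearEnergy φ K U r δ v := by
    intro δ v
    unfold nearEnergy
    congr 1
    refine setLIntegral_congr_fun hK.measurableSet fun x hx => ?_
    simp only [inter_eq_right.2 (hBall x hx),
      inter_eq_right.2 ((hBall x hx).trans (hUΩ'.trans hΩ'Ω))]
  simp_rw [hNeq]
  obtain ⟨κ, hκ⟩ := exists_invSqIntegral_eq hd
  set Q : ℝ≥0∞ := sphereArea d * κ with hQ
  have hQt : Q ≠ ⊤ := ENNReal.mul_ne_top (sphereArea_ne_top d) ENNReal.coe_ne_top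
  have hrem : ∀ n, (bump d n).rOut < ρ → e n ≠ ⊤ → ∀ a δ : ℝ, 0 < δ →
      nearEnergy φ K U r δ (fun x => a * (u x - mollify n u x)) ≤ ‖a‖ₑ * (4 * C₁ * Q * e n) := by
    intro n hn hen a δ hδ
    have hKe : ∫⁻ x in K, M n x ≤ e n := lintegral_mono_set hKU
    have hb := nearEnergy_le hd hφ hKU subset_rfl hK.measurableSet hUm
      ((hHaj n hn).const_mul a) (ne_top_of_le_ne_top hen hKe) hen hδ
    have hmono : nearEnergy φ K U r δ (fun x => a * (u x - mollify n u x)) ≤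
        nearEnergy φ K U (ρ / 8) δ (fun x => a * (u x - mollify n u x)) := by
      unfold nearEnergy
      refine mul_le_mul' le_rfl (lintegral_mono fun x => lintegral_mono_set ?_)
      exact inter_subset_inter_right _ (Metric.ball_subset_ball hrρ)
    refine hmono.trans (hb.trans ?_)
    rw [hκ φ hφ, ← hQ, ENNReal.coe_mul]
    calc _ ≤ 2 * (‖a‖₊ * C₁ : ℝ≥0∞) * Q * (e n + e n) := by gcongr
      _ = ‖a‖ₑ * (4 * C₁ * Q * e n) := by
        rw [enorm_eq_nnnorm]; ring
  set G : ℝ≥0∞ := ∫⁻ x in K, ‖g x‖ₑ with hGdef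
  have hGt : G ≠ ⊤ := ne_top_of_le_ne_top hg.2.ne (setLIntegral_le_lintegral K _)
  set c : ℝ≥0∞ := ENNReal.ofReal (4 ^ d) with hc
  have hct : c ≠ ⊤ := ENNReal.ofReal_ne_top
  set Gn : ℕ → ℝ≥0∞ := fun n => ∫⁻ x in K, ‖fderiv ℝ (mollify n u) x‖ₑ with hGn
  have hfd : ∀ n, (bump d n).rOut < ρ → Gn n = ∫⁻ x in K, ‖mollify n g x‖ₑ := by
    intro n hn
    refine setLIntegral_congr_fun hK.measurableSet fun x hx => ?_
    have : fderiv ℝ (mollify n u) x = innerSL ℝ (mollify n g x) := by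
      ext v
      rw [h.fderiv_mollify hu hg (hball n hn x (hUΩ' (hKU hx))), innerSL_apply_apply]
    simp only [this]
    rw [← ofReal_norm, innerSL_apply_norm, ofReal_norm]
  have hγle : ∀ n, ∫⁻ x in K, ‖g x - mollify n g x‖ₑ ≤ c * e n := by
    intro n
    calc ∫⁻ x in K, ‖g x - mollify n g x‖ₑ = ∫⁻ x in K, ‖γ n x‖ₑ := by
          refine setLIntegral_congr_fun hK.measurableSet fun x hx => ?_
          simp [hγ, hUΩ' (hKU hx)]
      _ ≤ ∫⁻ x in K, c * M n x := lintegral_mono_ae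
          (ae_restrict_of_ae (ae_enorm_le_maxFun (hγi n)))
      _ = c * ∫⁻ x in K, M n x := lintegral_const_mul _ (measurable_maxFun (hγm n).enorm)
      _ ≤ c * e n := mul_le_mul' le_rfl (lintegral_mono_set hKU)
  have hG1 : ∀ n, (bump d n).rOut < ρ → Gn n ≤ G + c * e n := by
    intro n hn
    rw [hfd n hn]
    refine le_trans ?_ (add_le_add le_rfl (hγle n))
    rw [hGdef, ← lintegral_add_left hgm.enorm]
    refine lintegral_mono fun x => ?_
    calc ‖mollify n g x‖ₑ = ‖g x - (g x - mollify n g x)‖ₑ := by rw [sub_sub_cancel]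
      _ ≤ _ := enorm_sub_le
  have hG2 : ∀ n, (bump d n).rOut < ρ → G ≤ Gn n + c * e n := by
    intro n hn
    rw [hfd n hn]
    refine le_trans ?_ (add_le_add le_rfl (hγle n))
    rw [hGdef, ← lintegral_add_left (hgn n).enorm]
    refine lintegral_mono fun x => ?_
    calc ‖g x‖ₑ = ‖mollify n g x + (g x - mollify n g x)‖ₑ := by rw [add_sub_cancel]
      _ ≤ _ := enorm_add_le _ _
  have hsmooth : ∀ n, ∀ a : ℝ, Tendsto (fun δ => nearEnergy φ K U r δ
      (fun x => a * mollify n u x)) (𝓝[>] 0) (𝓝 (‖a‖ₑ * Gn n)) := by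
    intro n a
    have hw : ContDiff ℝ 1 (mollify n u) := contDiff_mollify hu n
    have h1 : ∀ x, ‖fderiv ℝ (fun x => a * mollify n u x) x‖ₑ =
        ‖a‖ₑ * ‖fderiv ℝ (mollify n u) x‖ₑ := fun x => by
      rw [fderiv_const_mul (hw.differentiable one_ne_zero x), enorm_smul]
    have h2 := tendsto_nearEnergy_of_contDiff hd hφ (contDiff_const.mul hw :
      ContDiff ℝ 1 fun x => a * mollify n u x) hK hr hBall
    simp_rw [h1] at h2
    rwa [lintegral_const_mul' _ _ enorm_ne_top] at h2
  have hen : ∀ᶠ n in atTop, e n ≠ ⊤ :=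
    (he0.eventually_lt_const ENNReal.zero_lt_top).mono fun n hn => hn.ne
  have hlin : ∀ b : ℝ≥0∞, b ≠ ⊤ → Tendsto (fun n => b * e n) atTop (𝓝 0) := fun b hb => by
    simpa using ENNReal.Tendsto.const_mul (a := b) he0 (Or.inr hb)
  set Q' : ℝ≥0∞ := 4 * C₁ * Q with hQ'
  have hQ't : Q' ≠ ⊤ := ENNReal.mul_ne_top (by finiteness) hQt
  have hε : ∀ᶠ ε : ℝ in 𝓝[>] 0, 0 < ε ∧ ε < 1 :=
    Ioo_mem_nhdsGT (zero_lt_one (α := ℝ))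
  refine tendsto_of_eventually_le_add hGt (fun η hη => ?_) fun η' hη' => ?_
  · have h1 : Tendsto (fun ε : ℝ => ‖(1 - ε)⁻¹‖ₑ * G) (𝓝[>] 0) (𝓝 G) := by
      have h2 : Tendsto (fun ε : ℝ => (1 - ε)⁻¹) (𝓝[>] 0) (𝓝 1) := by
        have : ContinuousAt (fun ε : ℝ => (1 - ε)⁻¹) 0 := by
          refine ContinuousAt.inv₀ (by fun_prop) (by norm_num)
        simpa [ContinuousAt] using this.tendsto.mono_left nhdsWithin_le_nhds
      simpa using ENNReal.Tendsto.mul_const (b := G) h2.enorm (Or.inr hGt)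
    obtain ⟨ε, ⟨hε0, hε1⟩, hεG⟩ := (hε.and (h1.eventually_lt_const
      (ENNReal.lt_add_right hGt hη.ne'))).exists
    set a := ‖(1 - ε)⁻¹‖ₑ with ha
    have h3 : Tendsto (fun n => a * (G + c * e n) + ‖ε⁻¹‖ₑ * (Q' * e n)) atTop (𝓝 (a * G)) := by
      have h4 := hlin (a * c + ‖ε⁻¹‖ₑ * Q') (by finiteness)
      have h5 := h4.const_add (a * G)
      rw [add_zero] at h5
      refine h5.congr fun n => ?_
      ring
    obtain ⟨n, hn1, hn2, hn3⟩ := ((h3.eventually_lt_const hεG).and (hrad.and hen)).exists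
    have h6 := (hsmooth n (1 - ε)⁻¹).add_const (‖ε⁻¹‖ₑ * (Q' * e n))
    have h7 : a * Gn n + ‖ε⁻¹‖ₑ * (Q' * e n) < G + η :=
      lt_of_le_of_lt (add_le_add (mul_le_mul' le_rfl (hG1 n hn2)) le_rfl) hn1
    filter_upwards [h6.eventually_lt_const h7, self_mem_nhdsWithin] with δ hδ hδ0
    refine le_trans ?_ hδ.le
    have h8 := nearEnergy_add_le hφ (A := K) hUm r δ (v := fun x => u x - mollify n u x)
      (hun n) hε0 hε1
    simp only [add_sub_cancel] at h8
    exact h8.trans (add_le_add le_rfl (hrem n hn2 hn3 _ δ hδ0))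
  · set η := η' / 2 with hηdef
    have hη : 0 < η := ENNReal.half_pos hη'.ne'
    have h1 : Tendsto (fun ε : ℝ => ‖1 - ε‖ₑ * G + η) (𝓝[>] 0) (𝓝 (G + η)) := by
      have h2 : Tendsto (fun ε : ℝ => 1 - ε) (𝓝[>] 0) (𝓝 1) := by
        have : ContinuousAt (fun ε : ℝ => 1 - ε) 0 := by fun_prop
        simpa [ContinuousAt] using this.tendsto.mono_left nhdsWithin_le_nhds
      simpa using (ENNReal.Tendsto.mul_const (b := G) h2.enorm (Or.inr hGt)).add_const η
    obtain ⟨ε, ⟨hε0, hε1⟩, hεG⟩ := (hε.and (h1.eventually_const_lt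
      (ENNReal.lt_add_right hGt hη.ne'))).exists
    set a := ‖1 - ε‖ₑ with ha
    obtain ⟨n, hn1, hn2, hn3⟩ := (((hlin (a * c + ‖ε⁻¹ * -(1 - ε)‖ₑ * Q')
      (by finiteness)).eventually_lt_const hη).and (hrad.and hen)).exists
    have h6 := (hsmooth n (1 - ε)).add_const (a * (c * e n) + η)
    have h7 : G < a * Gn n + (a * (c * e n) + η) := by
      rw [← add_assoc, ← mul_add]
      exact hεG.trans_le (add_le_add (mul_le_mul' le_rfl (hG2 n hn2)) le_rfl)
    filter_upwards [h6.eventually_const_lt h7, self_mem_nhdsWithin] with δ hδ hδ0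
    have h8 := nearEnergy_add_le hφ (A := K) hUm r δ (u := fun x => (1 - ε) * u x)
      (v := fun x => -(1 - ε) * (u x - mollify n u x)) (hum.const_mul _) hε0 hε1
    have h9 : (1 - ε) ≠ 0 := by linarith
    have h10 : (fun x => (1 - ε) * u x + -(1 - ε) * (u x - mollify n u x)) =
        fun x => (1 - ε) * mollify n u x := by funext x; ring
    simp only [h10, inv_mul_cancel_left₀ h9, ← mul_assoc (ε⁻¹)] at h8
    have h11 := h8.trans (add_le_add le_rfl (hrem n hn2 hn3 _ δ hδ0))
    calc G ≤ nearEnergy φ K U r δ (fun x => (1 - ε) * mollify n u x) +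
          (a * (c * e n) + η) := hδ.le
      _ ≤ (nearEnergy φ K U r δ u + ‖ε⁻¹ * -(1 - ε)‖ₑ * (Q' * e n)) +
          (a * (c * e n) + η) := add_le_add h11 le_rfl
      _ = nearEnergy φ K U r δ u + ((a * c + ‖ε⁻¹ * -(1 - ε)‖ₑ * Q') * e n + η) := by ring
      _ ≤ nearEnergy φ K U r δ u + (η + η) :=
        add_le_add le_rfl (add_le_add hn1.le le_rfl)
      _ = nearEnergy φ K U r δ u + η' := by rw [hηdef, ENNReal.add_halves]

lemma exists_isCompact_setLIntegral_diff_lt {d : ℕ} {Ω : Set (E d)} (hΩ : MeasurableSet Ω)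
    {f : E d → ℝ≥0∞} (hf : ∫⁻ x in Ω, f x ≠ ⊤) {η : ℝ≥0∞} (hη : η ≠ 0) :
    ∃ K ⊆ Ω, IsCompact K ∧ ∫⁻ x in Ω \ K, f x < η := by
  set ν := (volume.restrict Ω).withDensity f with hν
  have hfin : IsFiniteMeasure ν := isFiniteMeasure_withDensity hf
  obtain ⟨K, hKΩ, hK, hlt⟩ := hΩ.exists_isCompact_sdiff_lt (measure_ne_top ν Ω) hη
  refine ⟨K, hKΩ, hK, ?_⟩
  rwa [hν, withDensity_apply _ (hΩ.diff hK.measurableSet), Measure.restrict_restrict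
    (hΩ.diff hK.measurableSet), inter_eq_left.2 sdiff_subset] at hlt

lemma nearEnergy_le_add_diff {d : ℕ} (φ : ℝ → ℝ) {Ω K K₁ : Set (E d)} (hK : MeasurableSet K)
    {r : ℝ} (hsub : Metric.cthickening r K₁ ⊆ K) (δ : ℝ) (u : E d → ℝ)
    (hΩ : MeasurableSet Ω) (hKΩ : K ⊆ Ω) :
    nearEnergy φ Ω Ω r δ u ≤ nearEnergy φ K Ω r δ u + nearEnergy φ (Ω \ K) (Ω \ K₁) r δ u := by
  simp only [nearEnergy]
  rw [← mul_add, ← lintegral_inter_add_sdiff _ Ω hK, inter_eq_right.2 hKΩ]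
  refine mul_le_mul' le_rfl (add_le_add le_rfl ?_)
  refine setLIntegral_mono_ae' (hΩ.diff hK) (Eventually.of_forall fun x hx => ?_)
  refine lintegral_mono_set fun y hy => ⟨⟨hy.1, fun hyK => hx.2 (hsub ?_)⟩, hy.2⟩
  refine Metric.closedBall_subset_cthickening hyK r ?_
  have := hy.2
  rw [Metric.mem_ball, dist_comm] at this
  exact this.le

/-- Convergence of the functionals for normalized representatives. -/
lemma tendsto_lamScaled {d : ℕ} (hd : 1 ≤ d) {Ω : Set (E d)} (hΩo : IsOpen Ω)
    (hΩb : Bornology.IsBounded Ω) (hΩ : HasSmoothBoundary Ω) {φ : ℝ → ℝ} (hφ : MemClassA d φ)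
    {p : ℝ≥0∞} (hp : 1 < p) {u : E d → ℝ} {g : E d → E d} (h : HasWeakGradient Ω u g)
    (hu : Integrable u) (hg : Integrable g) (hum : Measurable u) (hgm : Measurable g)
    (hg0 : ∀ x ∉ Ω, g x = 0) (hgp : eLpNorm g p (volume.restrict Ω) ≠ ⊤) :
    Tendsto (fun δ => LamScaled φ Ω δ u) (𝓝[>] 0) (𝓝 (∫⁻ x in Ω, ‖g x‖ₑ)) := by
  have hvol : volume Ω ≠ ⊤ := hΩb.measure_lt_top.ne
  have : IsFiniteMeasure (volume.restrict Ω) := ⟨by simpa using hvol.lt_top⟩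
  have hm := hΩo.measurableSet
  obtain ⟨q, hq, hqp⟩ := exists_one_lt_rpow hp
  have hq0 : 0 < q := zero_lt_one.trans hq
  have hgq : ∫⁻ x, ‖g x‖ₑ ^ q ≠ ⊤ := by
    have h1 : MemLp g (ENNReal.ofReal q) (volume.restrict Ω) :=
      MemLp.mono_exponent ⟨hgm.aestronglyMeasurable, hgp.lt_top⟩ hqp
    have h2 := h1.2
    rw [eLpNorm_ofReal_eq hq, ENNReal.rpow_lt_top_iff_of_pos (inv_pos.2 hq0)] at h2
    rw [← setLIntegral_eq_of_support_subset (s := Ω)]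
    · exact h2.ne
    · intro x hx
      by_contra hx'
      exact hx (by simp [hg0 x hx', hq0])
  obtain ⟨r₁, hr₁, C₁, hC₁⟩ := exists_hajlaszBound hΩo hΩb hΩ
  have hH := hC₁ u g h hu hg hum hgm
  obtain ⟨C₃, hC₃⟩ := exists_setLIntegral_maxFun_le_eLpNorm hd hp hvol
  set M := maxFun (fun z => ‖g z‖ₑ) with hM
  have hMm : Measurable M := measurable_maxFun hgm.enorm
  have hMt : ∫⁻ x in Ω, M x ≠ ⊤ := ne_top_of_le_ne_top (by finiteness) (hC₃ g hgm hg0)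
  set G := ∫⁻ x in Ω, ‖g x‖ₑ with hGdef
  have hGt : G ≠ ⊤ := ne_top_of_le_ne_top hg.2.ne (setLIntegral_le_lintegral Ω _)
  set Q := sphereArea d * invSqIntegral (prof φ) with hQ
  have hQt : Q ≠ ⊤ := by
    obtain ⟨κ, hκ⟩ := exists_invSqIntegral_eq hd
    rw [hQ, hκ φ hφ]
    exact ENNReal.mul_ne_top (sphereArea_ne_top d) ENNReal.coe_ne_top
  obtain ⟨b, hb⟩ := exists_prof_le hφ
  -- a compact subset carrying almost everything
  have hloc : ∀ η : ℝ≥0∞, 0 < η → ∃ K K₁ : Set (E d), ∃ r : ℝ, IsCompact K ∧ K ⊆ Ω ∧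
      K₁ ⊆ K ∧ MeasurableSet K₁ ∧ 0 < r ∧ r ≤ r₁ ∧ Metric.cthickening r K₁ ⊆ K ∧
      (∫⁻ x in Ω \ K₁, M x) < η ∧ (∫⁻ x in Ω \ K₁, ‖g x‖ₑ) < η ∧
      Tendsto (fun δ => nearEnergy φ K Ω r δ u) (𝓝[>] 0) (𝓝 (∫⁻ x in K, ‖g x‖ₑ)) := by
    intro η hη
    have hsum : ∫⁻ x in Ω, (M x + ‖g x‖ₑ) ≠ ⊤ := by
      rw [lintegral_add_left hMm]
      exact ENNReal.add_ne_top.2 ⟨hMt, hGt⟩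
    obtain ⟨K₁, hK₁Ω, hK₁, hlt⟩ := exists_isCompact_setLIntegral_diff_lt hm hsum hη.ne'
    rw [lintegral_add_left hMm] at hlt
    obtain ⟨s, hs, hsΩ⟩ := hK₁.exists_cthickening_subset_open hΩo hK₁Ω
    have hK : IsCompact (Metric.cthickening s K₁) := hK₁.cthickening
    obtain ⟨r₂, hr₂, hlim⟩ := exists_tendsto_nearEnergy hd hφ hΩo h hu hg hum hgm hq hgq hK hsΩ
    have hr : 0 < min (min s r₁) r₂ := lt_min (lt_min hs hr₁) hr₂
    refine ⟨Metric.cthickening s K₁, K₁, min (min s r₁) r₂, hK, hsΩ,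
      Metric.self_subset_cthickening K₁, hK₁.measurableSet, hr,
      (min_le_left _ _).trans (min_le_right _ _),
      Metric.cthickening_mono ((min_le_left _ _).trans (min_le_left _ _)) K₁,
      lt_of_le_of_lt le_self_add hlt, lt_of_le_of_lt le_add_self hlt,
      hlim _ hr (min_le_right _ _)⟩
  refine tendsto_of_eventually_le_add hGt (fun η hη => ?_) fun η hη => ?_
  · have hsmall : Tendsto (fun t : ℝ≥0∞ => 2 * C₁ * Q * (t + t)) (𝓝[>] 0) (𝓝 0) := by
      have h1 : Tendsto (fun t : ℝ≥0∞ => t + t) (𝓝[>] 0) (𝓝 0) := by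
        have : Continuous fun t : ℝ≥0∞ => t + t := by fun_prop
        simpa using (this.tendsto 0).mono_left nhdsWithin_le_nhds
      simpa using ENNReal.Tendsto.const_mul (a := 2 * C₁ * Q) h1
        (Or.inr (ENNReal.mul_ne_top (by finiteness) hQt))
    obtain ⟨t, ht, ht0⟩ := ((hsmall.eventually_lt_const hη).and self_mem_nhdsWithin).exists
    obtain ⟨K, K₁, r, hK, hKΩ, hK₁K, hK₁m, hr, hrr₁, hthick, hM₁, -, hlim⟩ := hloc t ht0
    set D := b * ENNReal.ofReal ((r ^ (d + 1))⁻¹) * volume Ω * volume Ω with hD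
    have hDt : D ≠ ⊤ := by finiteness
    have hfar : Tendsto (fun δ : ℝ => ENNReal.ofReal δ * D) (𝓝[>] 0) (𝓝 0) := by
      have h1 : Tendsto ENNReal.ofReal (𝓝[>] 0) (𝓝 0) := by
        simpa using (ENNReal.continuous_ofReal.tendsto 0).mono_left nhdsWithin_le_nhds
      simpa using ENNReal.Tendsto.mul_const (b := D) h1 (Or.inr hDt)
    have htot := (hlim.add_const (2 * C₁ * Q * (t + t))).add hfar
    rw [add_zero] at htot
    have hlt : (∫⁻ x in K, ‖g x‖ₑ) + 2 * C₁ * Q * (t + t) < G + η :=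
      lt_of_le_of_lt (add_le_add (lintegral_mono_set hKΩ) le_rfl)
        (ENNReal.add_lt_add_left hGt ht)
    filter_upwards [htot.eventually_lt_const hlt, self_mem_nhdsWithin] with δ hδ hδ0
    refine le_trans ?_ hδ.le
    refine (lamScaled_le_near_add_far hφ hm hum r δ).trans ?_
    refine add_le_add ?_ (farEnergy_le_of_prof_le hb hm hr δ u)
    refine (nearEnergy_le_add_diff φ hK.measurableSet hthick δ u hm hKΩ).trans ?_
    refine add_le_add le_rfl ?_
    have hHr : HajlaszBound Ω r C₁ u M := by
      obtain ⟨S, hS, hS'⟩ := hH.exists_set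
      exact ⟨hum, hMm, S, hS, fun x hx y hy hxy => hS' x hx y hy (hxy.trans_le hrr₁)⟩
    have hM₂ : ∫⁻ x in Ω \ K, M x ≤ t :=
      (lintegral_mono_set (sdiff_subset_sdiff_right hK₁K)).trans hM₁.le
    have hfin : ∀ D ⊆ Ω, ∫⁻ x in D, M x ≠ ⊤ := fun D hD =>
      ne_top_of_le_ne_top hMt (lintegral_mono_set hD)
    refine (nearEnergy_le hd hφ sdiff_subset sdiff_subset (hm.diff hK.measurableSet)
      (hm.diff hK₁m) hHr (hfin _ sdiff_subset) (hfin _ sdiff_subset) hδ0).trans ?_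
    exact mul_le_mul' le_rfl (add_le_add hM₂ hM₁.le)
  · obtain ⟨K, K₁, r, hK, hKΩ, hK₁K, hK₁m, hr, hrr₁, hthick, -, hg₁, hlim⟩ := hloc η hη
    have hlt : G < (∫⁻ x in K, ‖g x‖ₑ) + η := by
      rw [hGdef, ← lintegral_inter_add_sdiff _ Ω hK.measurableSet, inter_eq_right.2 hKΩ]
      refine ENNReal.add_lt_add_left ?_ (lt_of_le_of_lt
        (lintegral_mono_set (sdiff_subset_sdiff_right hK₁K)) hg₁)
      exact ne_top_of_le_ne_top hGt (lintegral_mono_set hKΩ)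
    filter_upwards [(hlim.add_const η).eventually_const_lt hlt] with δ hδ
    exact hδ.le.trans (add_le_add (nearEnergy_le_lamScaled hφ hKΩ subset_rfl r δ u) le_rfl)

/-- Sobolev functions on a bounded open set have measurable representatives that vanish outside,
together with their weak gradient. -/
lemma exists_normalized {d : ℕ} {Ω : Set (E d)} (hΩo : IsOpen Ω)
    (hΩb : Bornology.IsBounded Ω) {p : ℝ≥0∞} (hp : 1 ≤ p) {u : E d → ℝ} {g : E d → E d}
    (hu : MemLp u p (volume.restrict Ω)) (h : HasWeakGradient Ω u g)
    (hgp : MemLp g p (volume.restrict Ω)) :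
    ∃ (u' : E d → ℝ) (g' : E d → E d), HasWeakGradient Ω u' g' ∧ Integrable u' ∧ Integrable g' ∧
      Measurable u' ∧ Measurable g' ∧ (∀ x ∉ Ω, g' x = 0) ∧ u =ᵐ[volume.restrict Ω] u' ∧
      g =ᵐ[volume.restrict Ω] g' := by
  have hvol : volume Ω ≠ ⊤ := hΩb.measure_lt_top.ne
  obtain ⟨u', hum, hu0, huu'⟩ := exists_measurable_zero_off hΩo.measurableSet hu.1
  obtain ⟨g', hgm, hg0, hgg'⟩ := exists_measurable_zero_off hΩo.measurableSet hgp.1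
  have hu' := integrable_of_memLp_restrict hvol hu0 hp (hu.ae_eq huu')
  have hg' := integrable_of_memLp_restrict hvol hg0 hp (hgp.ae_eq hgg')
  exact ⟨u', g', h.congr huu' hgg' hu' hg', hu', hg', hum, hgm, hg0, huu', hgg'⟩

end NonlocalTV

end

theorem propositionC1 (d : ℕ) (hd : 1 ≤ d) (Ω : Set (NonlocalTV.E d)) (hΩ_open : IsOpen Ω)
    (hΩ_bounded : Bornology.IsBounded Ω) (hΩ_smooth : NonlocalTV.HasSmoothBoundary Ω) :
    (∀ φ : ℝ → ℝ, NonlocalTV.MemClassA d φ →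
      ∀ p : ℝ≥0∞, 1 < p → ∀ u : NonlocalTV.E d → ℝ, NonlocalTV.MemW1p Ω p u →
        ∀ g : NonlocalTV.E d → NonlocalTV.E d, NonlocalTV.HasWeakGradient Ω u g →
          Tendsto (fun δ : ℝ => NonlocalTV.LamScaled φ Ω δ u) (𝓝[>] 0)
            (𝓝 (∫⁻ x in Ω, ‖g x‖ₑ))) ∧
    (IsConnected Ω → ∀ p : ℝ≥0∞, 1 < p → ∃ C : ℝ≥0,
      ∀ φ : ℝ → ℝ, NonlocalTV.MemClassA d φ →
      ∀ u : NonlocalTV.E d → ℝ, NonlocalTV.MemW1p Ω p u →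
        ∀ g : NonlocalTV.E d → NonlocalTV.E d, NonlocalTV.HasWeakGradient Ω u g →
          ∀ δ : ℝ, 0 < δ →
            NonlocalTV.LamScaled φ Ω δ u ≤ C * eLpNorm g p (volume.restrict Ω)) := by

  constructor
  · intro φ hφ p hp u hu g hg
    obtain ⟨hup, G, hG, hGp⟩ := hu
    have hgp := hGp.ae_eq (hG.ae_eq hΩ_open hg)
    obtain ⟨u', g', h', hu', hg', hum, hgm, hg0, huu', hgg'⟩ :=
      NonlocalTV.exists_normalized hΩ_open hΩ_bounded hp.le hup hg hgp
    have hlim := NonlocalTV.tendsto_lamScaled hd hΩ_open hΩ_bounded hΩ_smooth hφ hp h' hu' hg'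
      hum hgm hg0 (hgp.ae_eq hgg').2.ne
    simp_rw [NonlocalTV.lamScaled_congr huu']
    have heq : ∫⁻ x in Ω, ‖g x‖ₑ = ∫⁻ x in Ω, ‖g' x‖ₑ :=
      lintegral_congr_ae (by filter_upwards [hgg'] with x hx; rw [hx])
    rwa [heq]
  · intro hΩ_conn p hp
    obtain ⟨C, hC⟩ :=
      NonlocalTV.exists_lamScaled_le hd hΩ_open hΩ_bounded hΩ_smooth hΩ_conn hp
    refine ⟨C, fun φ hφ u hu g hg δ hδ => ?_⟩
    obtain ⟨hup, G, hG, hGp⟩ := hu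
    have hgp := hGp.ae_eq (hG.ae_eq hΩ_open hg)
    obtain ⟨u', g', h', hu', hg', hum, hgm, hg0, huu', hgg'⟩ :=
      NonlocalTV.exists_normalized hΩ_open hΩ_bounded hp.le hup hg hgp
    rw [NonlocalTV.lamScaled_congr huu', eLpNorm_congr_ae hgg']
    exact hC φ hφ u' g' h' hu' hg' hum hgm hg0 (hgp.ae_eq hgg').2.ne δ hδ
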